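/- Let $\Delta$ be a convex lattice polygon in $\mathbb{R}^2$ that is $h$-transverse (every side has a direction vector $(\pm1,0)$ or $(k,\pm1)$ with $k\in\mathbb{Z}$), horizontal (it has a horizontal top side and a horizontal bottom side) and non-singular (consecutive primitive outgoing normal vectors form a basis of $\mathbb{Z}^2$). Let $X$ be the non-singular compact toric surface defined by the normal fan of $\Delta$, $\chi$ its Euler characteristic, $K_X$ its canonical class, and for $\beta\in H_2(X,\mathbb{Z})$ let $g_{\max}(\beta)=1+\frac{\beta^2+K_X\cdot\beta}{2}$. *Refined invariants.* Let $\beta\in H_2(X,\mathbb{Z})$ be ample, i.e. $\beta\cdot D>0$ for every toric divisor $D$, and let $\Delta_\beta$ be the lattice polygon with the same normal fan as $\Delta$ whose side dual to $D$ has integral length $\beta\cdot D$, for every $D$. A *floor diagram* with Newton polygon $\Delta_\beta$ is a connected, oriented, acyclic graph with as many vertices (floors) as the height of $\Delta_\beta$, bounded edges $e$ of weights $w(e)\in\mathbb{Z}_{>0}$, and as many sinks, resp. sources (unbounded outgoing, resp. incoming edges, of weight $1$) as the length $b^\top$ of the top side, resp. $b^\bot$ of the bottom side; its floors carry integers $L(v),R(v)$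 such that the multiset of the $L(v)$ (resp. $R(v)$) contains each $k\in\mathbb{Z}$ as many times as the integral length of the side with outgoing normal vector $(-1,k)$ (resp. $(1,k)$), and such that for every floor $v$ the total entering weight minus the total leaving weight is $L(v)+R(v)$. Its genus is the first Betti number of the graph. A *marking* is an increasing bijection from the set of floors and edges, partially ordered by the orientation, to $\{1,\dots,N\}$. The genus $g$ tropical refined invariant of $\beta$ with cleared denominators is $$\overline{BG}{}^X_g(\beta)(q)=\sum\ (q^{1/2}-q^{-1/2})^{b^\top+b^\bot}\prod_{e\text{ bounded}}\bigl(q^{w(e)/2}-q^{-w(e)/2}\bigr)^2,$$ where the sum is over the isomorphism classes of marked floor diagrams of genus $g$ with Newton polygon $\Delta_\beta$. Set $\widetilde{BG}{}^X_g(\beta)(x)=x^{\mathrm{Area}(\Delta_\beta)}\,\overline{BG}{}^X_g(\beta)(1/x)\in\mathbb{Z}[\![x]\!]$. *Asymptotic refined invariant.* A function $F:H_2(X,\mathbb{Z})\to\mathbb{Z}[\![x]\!]$ is *polynomial* if it is a polynomial in additive functions $H_2(X,\mathbb{Z})\to\mathbb{Z}$ with coefficients in $\mathbb{Q}[\![x]\!]$.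 The genus $g$ asymptotic refined invariant $AR^X_g$ is the polynomial function $H_2(X,\mathbb{Z})\to\mathbb{Z}[\![x]\!]$ such that for every $N$ there is a $C$ with $$\widetilde{BG}{}^X_g(\beta)\equiv AR^X_g(\beta)\pmod{x^N}$$ for every ample $\beta$ with $\beta\cdot D\ge C$ for all toric divisors $D$. **Theorem.** For $g=1$ there is exactly one such polynomial function, and it is $$AR^X_1(\beta)=p(x)^{\chi}\,\bigl(g_{\max}(\beta)-12E_2(x)\bigr),$$ where $p(x)=\prod_{j\ge1}\frac1{1-x^j}$ and $E_2(x)=\sum_{k\ge1}\sigma_1(k)x^k$, with $\sigma_1(k)=\sum_{d\mid k}d$. -/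

import Mathlib

namespace ToricRefined

open scoped BigOperators LaurentPolynomial PowerSeries PowerSeries.WithPiTopology

/-! ### Fans and lattice polygons -/

/-- The determinant of two vectors of `ℤ²`. -/
def det (u v : ℤ × ℤ) : ℤ := u.1 * v.2 - u.2 * v.1

/-- The value of the monomial exponent `m` on the vector `u` (standard pairing of `ℤ²`). -/
def pairing (m u : ℤ × ℤ) : ℤ := m.1 * u.1 + m.2 * u.2

/-- A complete fan in `ℝ²` with `n` rays. The rays are listed counterclockwise, `ray i` being the
primitive integral generator of the `i`-th ray, and the two-dimensional cones are the cones spanned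
by `ray i` and `ray (i + 1)`. The condition `turn` says that these cones are strictly convex, and
`once` says that each of them contains no other ray, i.e. that the rays go around the origin
exactly once. -/
structure CompleteFan (n : ℕ) [NeZero n] where
  ray : ZMod n → ℤ × ℤ
  primitive : ∀ i, IsCoprime (ray i).1 (ray i).2
  turn : ∀ i, 0 < det (ray i) (ray (i + 1))
  once : ∀ i j, 0 ≤ det (ray i) (ray j) → 0 ≤ det (ray j) (ray (i + 1)) → j = i ∨ j = i + 1

/-- A fan is smooth if the generators of each two-dimensional cone form a basis of `ℤ²`. -/
def CompleteFan.IsSmooth {n : ℕ} [NeZero n] (F : CompleteFan n) : Prop :=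
  ∀ i, det (F.ray i) (F.ray (i + 1)) = 1

/-- A convex lattice polygon with `n` sides (up to translation), given by its sides: the rays of its
normal fan are the primitive outgoing normal vectors of the sides, listed counterclockwise, and
`length i` is the integral length of the side with outgoing normal vector `ray i`. -/
structure LatticePolygon (n : ℕ) [NeZero n] extends CompleteFan n where
  length : ZMod n → ℕ
  length_pos : ∀ i, 0 < length i
  closed : ∑ i, (length i : ℤ) • ray i = 0

namespace LatticePolygon

variable {n : ℕ} [NeZero n] (Δ : LatticePolygon n)

/-- The primitive direction vector of the `i`-th side, in counterclockwise direction: the outgoing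
normal vector turned by a quarter turn. -/
def direction (i : ZMod n) : ℤ × ℤ := (-(Δ.ray i).2, (Δ.ray i).1)

/-- The vertices of the polygon, in counterclockwise order and starting at the origin:
side `k` goes from `vertex k` to `vertex (k + 1)`. -/
def vertex (k : ℕ) : ℤ × ℤ :=
  ∑ j ∈ Finset.range k, (Δ.length (j : ZMod n) : ℤ) • Δ.direction (j : ZMod n)

/-- The polygon as a subset of the plane: the points that are on the inner side of the line
supporting each side. -/
def region : Set (ℝ × ℝ) :=
  {x | ∀ k : ℕ, ((Δ.ray (k : ZMod n)).1 : ℝ) * (x.1 - (Δ.vertex k).1) +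
    ((Δ.ray (k : ZMod n)).2 : ℝ) * (x.2 - (Δ.vertex k).2) ≤ 0}

/-- The Euclidean area. -/
noncomputable def area : ℝ := (MeasureTheory.volume Δ.region).toReal

/-- Twice the Euclidean area, as an integer: for a lattice polygon twice the area is an integer, so
that rounding changes nothing. -/
noncomputable def twiceArea : ℤ := round (2 * Δ.area)

/-- The height of the polygon: the total ascent along its (counterclockwise) boundary. -/
def height : ℕ := ∑ i, Δ.length i * ((Δ.direction i).2).toNat

/-- The length of the top side (`0` if there is no horizontal top side). -/
def topLength : ℕ := ∑ i, if Δ.ray i = (0, 1) then Δ.length i else 0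

/-- The length of the bottom side (`0` if there is no horizontal bottom side). -/
def bottomLength : ℕ := ∑ i, if Δ.ray i = (0, -1) then Δ.length i else 0

/-- The multiset of integers `k`, each appearing a number of times equal to the integral length of
the side with outgoing normal vector `(-1, k)`. -/
def leftSlopes : Multiset ℤ :=
  ∑ i, if (Δ.ray i).1 = -1 then Multiset.replicate (Δ.length i) (Δ.ray i).2 else 0

/-- The multiset of integers `k`, each appearing a number of times equal to the integral length of
the side with outgoing normal vector `(1, k)`. -/
def rightSlopes : Multiset ℤ :=
  ∑ i, if (Δ.ray i).1 = 1 then Multiset.replicate (Δ.length i) (Δ.ray i).2 else 0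

/-- Each side has a direction vector of the form `(±1, 0)` or `(k, ±1)`. -/
def IsHTransverse : Prop :=
  ∀ i, Δ.direction i = (1, 0) ∨ Δ.direction i = (-1, 0) ∨
    (∃ k : ℤ, Δ.direction i = (k, 1)) ∨ ∃ k : ℤ, Δ.direction i = (k, -1)

/-- The polygon has a horizontal top side and a horizontal bottom side. -/
def IsHorizontal : Prop := (∃ i, Δ.ray i = (0, 1)) ∧ ∃ i, Δ.ray i = (0, -1)

end LatticePolygon

/-! ### Floor diagrams -/

/-- A floor diagram with Newton polygon `Δ`. The floors, bounded edges, sinks and sources are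
numbered; floor diagrams are only considered up to isomorphism, so these numberings play no role.
A bounded edge `e` is oriented from the floor `tail e` to the floor `head e`; sinks leave, and
sources enter, the floor to which they are adjacent. All sinks and sources have weight `1`. -/
structure FloorDiagram {n : ℕ} [NeZero n] (Δ : LatticePolygon n) where
  numBounded : ℕ
  tail : Fin numBounded → Fin Δ.height
  head : Fin numBounded → Fin Δ.height
  sinkFloor : Fin Δ.topLength → Fin Δ.height
  sourceFloor : Fin Δ.bottomLength → Fin Δ.height
  /-- The weight of a bounded edge. -/
  weight : Fin numBounded → ℕ
  weight_pos : ∀ e, 0 < weight e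
  L : Fin Δ.height → ℤ
  R : Fin Δ.height → ℤ
  /-- `L` is a bijection from the floors to the multiset of left slopes. -/
  map_L : Finset.univ.val.map L = Δ.leftSlopes
  /-- `R` is a bijection from the floors to the multiset of right slopes. -/
  map_R : Finset.univ.val.map R = Δ.rightSlopes
  /-- The divergence (entering weight minus leaving weight) of each floor is prescribed. -/
  divergence : ∀ v,
    ((∑ e, if head e = v then (weight e : ℤ) else 0) + ∑ s, if sourceFloor s = v then 1 else 0) -
      ((∑ e, if tail e = v then (weight e : ℤ) else 0) + ∑ s, if sinkFloor s = v then 1 else 0) =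
      R v + L v
  connected : (SimpleGraph.fromRel fun v w => ∃ e, tail e = v ∧ head e = w).Connected
  acyclic : ∀ v, ¬ Relation.TransGen (fun v w => ∃ e, tail e = v ∧ head e = w) v v

namespace FloorDiagram

variable {n : ℕ} [NeZero n] {Δ : LatticePolygon n} (D : FloorDiagram Δ)

/-- The genus: the first Betti number of the underlying connected graph, that is the number of
bounded edges minus the number of vertices plus one (sinks and sources are univalent edges
without end vertex and do not contribute to the topology). -/
def genus : ℤ := (D.numBounded : ℤ) - (Δ.height : ℤ) + 1

/-- The floors and the (bounded and unbounded) edges of a floor diagram. -/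
inductive Element : Type
  | floor (v : Fin Δ.height)
  | bounded (e : Fin D.numBounded)
  | sink (s : Fin Δ.topLength)
  | source (s : Fin Δ.bottomLength)

/-- The incidences that generate the partial order on floors and edges given by the orientation. -/
inductive Step : D.Element → D.Element → Prop
  | tail (e : Fin D.numBounded) : Step (.floor (D.tail e)) (.bounded e)
  | head (e : Fin D.numBounded) : Step (.bounded e) (.floor (D.head e))
  | sink (s : Fin Δ.topLength) : Step (.floor (D.sinkFloor s)) (.sink s)
  | source (s : Fin Δ.bottomLength) : Step (.source s) (.floor (D.sourceFloor s))

/-- The strict partial order on floors and edges given by the orientation. -/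
def Precedes : D.Element → D.Element → Prop := Relation.TransGen D.Step

/-- The number of floors and edges. -/
def numElements : ℕ := Δ.height + D.numBounded + Δ.topLength + Δ.bottomLength

/-- The multiplicity with cleared denominators of a floor diagram, a Laurent polynomial in
`T 1 = q^{1/2}`: a bounded edge of weight `w` contributes `(q^{w/2} - q^{-w/2})²` and a sink or a
source contributes `q^{1/2} - q^{-1/2}`. -/
noncomputable def multiplicity : ℤ[T;T⁻¹] :=
  (∏ e, (LaurentPolynomial.T (D.weight e : ℤ) - LaurentPolynomial.T (-(D.weight e : ℤ))) ^ 2) *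
    (LaurentPolynomial.T 1 - LaurentPolynomial.T (-1)) ^ (Δ.topLength + Δ.bottomLength)

end FloorDiagram

/-- A marked floor diagram of genus `g` with Newton polygon `Δ`: the marking is an increasing
bijection from the set of floors and edges to an initial segment of the integers. -/
structure MarkedFloorDiagram {n : ℕ} [NeZero n] (Δ : LatticePolygon n) (g : ℕ)
    extends FloorDiagram Δ where
  genus_eq : toFloorDiagram.genus = g
  marking : toFloorDiagram.Element ≃ Fin toFloorDiagram.numElements
  increasing : ∀ x y, toFloorDiagram.Precedes x y → marking x < marking y

namespace MarkedFloorDiagram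

variable {n : ℕ} [NeZero n] {Δ : LatticePolygon n} {g : ℕ}

/-- An isomorphism of marked floor diagrams: an isomorphism of weighted oriented graphs that is
compatible with `L`, `R` and with the markings. -/
structure Iso (D D' : MarkedFloorDiagram Δ g) where
  onFloors : Fin Δ.height ≃ Fin Δ.height
  onBounded : Fin D.numBounded ≃ Fin D'.numBounded
  onSinks : Fin Δ.topLength ≃ Fin Δ.topLength
  onSources : Fin Δ.bottomLength ≃ Fin Δ.bottomLength
  tail_comm : ∀ e, D'.tail (onBounded e) = onFloors (D.tail e)
  head_comm : ∀ e, D'.head (onBounded e) = onFloors (D.head e)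
  sink_comm : ∀ s, D'.sinkFloor (onSinks s) = onFloors (D.sinkFloor s)
  source_comm : ∀ s, D'.sourceFloor (onSources s) = onFloors (D.sourceFloor s)
  weight_comm : ∀ e, D'.weight (onBounded e) = D.weight e
  L_comm : ∀ v, D'.L (onFloors v) = D.L v
  R_comm : ∀ v, D'.R (onFloors v) = D.R v
  marking_floor : ∀ v, (D'.marking (.floor (onFloors v)) : ℕ) = D.marking (.floor v)
  marking_bounded : ∀ e, (D'.marking (.bounded (onBounded e)) : ℕ) = D.marking (.bounded e)
  marking_sink : ∀ s, (D'.marking (.sink (onSinks s)) : ℕ) = D.marking (.sink s)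
  marking_source : ∀ s, (D'.marking (.source (onSources s)) : ℕ) = D.marking (.source s)

/-- The identity isomorphism. -/
def Iso.refl (D : MarkedFloorDiagram Δ g) : Iso D D where
  onFloors := Equiv.refl _
  onBounded := Equiv.refl _
  onSinks := Equiv.refl _
  onSources := Equiv.refl _
  tail_comm _ := rfl
  head_comm _ := rfl
  sink_comm _ := rfl
  source_comm _ := rfl
  weight_comm _ := rfl
  L_comm _ := rfl
  R_comm _ := rfl
  marking_floor _ := rfl
  marking_bounded _ := rfl
  marking_sink _ := rfl
  marking_source _ := rfl

/-- The inverse isomorphism. -/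
def Iso.symm {D D' : MarkedFloorDiagram Δ g} (f : Iso D D') : Iso D' D where
  onFloors := f.onFloors.symm
  onBounded := f.onBounded.symm
  onSinks := f.onSinks.symm
  onSources := f.onSources.symm
  tail_comm e := by
    have h := f.tail_comm (f.onBounded.symm e); simp at h; simp [h]
  head_comm e := by
    have h := f.head_comm (f.onBounded.symm e); simp at h; simp [h]
  sink_comm e := by
    have h := f.sink_comm (f.onSinks.symm e); simp at h; simp [h]
  source_comm e := by
    have h := f.source_comm (f.onSources.symm e); simp at h; simp [h]
  weight_comm e := by
    have h := f.weight_comm (f.onBounded.symm e); simp at h; simp [h]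
  L_comm e := by
    have h := f.L_comm (f.onFloors.symm e); simp at h; simp [h]
  R_comm e := by
    have h := f.R_comm (f.onFloors.symm e); simp at h; simp [h]
  marking_floor e := by
    have h := f.marking_floor (f.onFloors.symm e); simp at h; simp [h]
  marking_bounded e := by
    have h := f.marking_bounded (f.onBounded.symm e); simp at h; simp [h]
  marking_sink e := by
    have h := f.marking_sink (f.onSinks.symm e); simp at h; simp [h]
  marking_source e := by
    have h := f.marking_source (f.onSources.symm e); simp at h; simp [h]

/-- Composition of isomorphisms. -/
def Iso.trans {D D' D'' : MarkedFloorDiagram Δ g} (f : Iso D D') (h : Iso D' D'') :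
    Iso D D'' where
  onFloors := f.onFloors.trans h.onFloors
  onBounded := f.onBounded.trans h.onBounded
  onSinks := f.onSinks.trans h.onSinks
  onSources := f.onSources.trans h.onSources
  tail_comm e := by simp [h.tail_comm, f.tail_comm]
  head_comm e := by simp [h.head_comm, f.head_comm]
  sink_comm e := by simp [h.sink_comm, f.sink_comm]
  source_comm e := by simp [h.source_comm, f.source_comm]
  weight_comm e := by simp [h.weight_comm, f.weight_comm]
  L_comm e := by simp [h.L_comm, f.L_comm]
  R_comm e := by simp [h.R_comm, f.R_comm]
  marking_floor e := by simp [h.marking_floor, f.marking_floor]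
  marking_bounded e := by simp [h.marking_bounded, f.marking_bounded]
  marking_sink e := by simp [h.marking_sink, f.marking_sink]
  marking_source e := by simp [h.marking_source, f.marking_source]

/-- Isomorphism of marked floor diagrams, as an equivalence relation. -/
instance setoid (Δ : LatticePolygon n) (g : ℕ) : Setoid (MarkedFloorDiagram Δ g) where
  r D D' := Nonempty (Iso D D')
  iseqv := ⟨fun D => ⟨Iso.refl D⟩, fun ⟨f⟩ => ⟨f.symm⟩, fun ⟨f⟩ ⟨h⟩ => ⟨f.trans h⟩⟩

theorem Iso.multiplicity_eq {D D' : MarkedFloorDiagram Δ g} (f : Iso D D') :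
    D.multiplicity = D'.multiplicity := by
  unfold FloorDiagram.multiplicity
  congr 1
  rw [← Equiv.prod_comp f.onBounded]
  simp only [f.weight_comm]

end MarkedFloorDiagram

/-- The isomorphism classes of marked floor diagrams of genus `g` with Newton polygon `Δ`. -/
abbrev MarkedFloorDiagramClass {n : ℕ} [NeZero n] (Δ : LatticePolygon n) (g : ℕ) : Type :=
  Quotient (MarkedFloorDiagram.setoid Δ g)

/-- The multiplicity of an isomorphism class of marked floor diagrams. -/
noncomputable def MarkedFloorDiagramClass.multiplicity {n : ℕ} [NeZero n] {Δ : LatticePolygon n}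
    {g : ℕ} (c : MarkedFloorDiagramClass Δ g) : ℤ[T;T⁻¹] :=
  Quotient.lift (fun D : MarkedFloorDiagram Δ g => D.multiplicity)
    (fun (D D' : MarkedFloorDiagram Δ g) (h : Nonempty (D.Iso D')) =>
      h.elim fun f => f.multiplicity_eq) c

/-- The genus `g` tropical refined invariant with cleared denominators of a polygon, a Laurent
polynomial in `T 1 = q^{1/2}`: the sum of the multiplicities over the (finitely many)
isomorphism classes of marked floor diagrams. -/
noncomputable def clearedInvariant {n : ℕ} [NeZero n] (Δ : LatticePolygon n) (g : ℕ) :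
    ℤ[T;T⁻¹] :=
  ∑ᶠ c : MarkedFloorDiagramClass Δ g, c.multiplicity

/-- The polynomial `x^{Area(Δ)} B(1/x)`, where `B` is the invariant with cleared denominators, as a
formal power series: its `x^i` coefficient is the codegree `i` coefficient of `B`, that is the
coefficient of `q^{Area(Δ) - i}`, or equivalently of `T (2 Area(Δ) - 2 i)`. -/
noncomputable def reversedInvariant {n : ℕ} [NeZero n] (Δ : LatticePolygon n) (g : ℕ) : ℤ⟦X⟧ :=
  PowerSeries.mk fun i => (clearedInvariant Δ g).coeff (Δ.twiceArea - 2 * (i : ℤ))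

/-! ### Toric surfaces -/

/-- A non-singular compact toric surface, given by its fan. The toric divisor corresponding to the
ray `ray i` is denoted by `D_i`. -/
structure ToricSurface (n : ℕ) [NeZero n] extends CompleteFan n where
  smooth : toCompleteFan.IsSmooth

/-- The toric surface associated to a non-singular polygon, i.e. the one defined by its
normal fan. -/
def LatticePolygon.toricSurface {n : ℕ} [NeZero n] (Δ : LatticePolygon n)
    (h : Δ.toCompleteFan.IsSmooth) : ToricSurface n where
  toCompleteFan := Δ.toCompleteFan
  smooth := h

namespace ToricSurface

variable {n : ℕ} [NeZero n] (X : ToricSurface n)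

/-- The Euler characteristic: the number of rays of the fan. -/
def eulerCharacteristic (_ : ToricSurface n) : ℕ := Fintype.card (ZMod n)

/-- The divisor of the character with exponent `m`, as an integral combination of toric
divisors. -/
def characterDivisor : (ℤ × ℤ) →ₗ[ℤ] (ZMod n → ℤ) where
  toFun m := fun i => pairing m (X.ray i)
  map_add' a b := by funext i; simp [pairing]; ring
  map_smul' a b := by funext i; simp [pairing]; ring

/-- The homology group `H₂(X, ℤ)`: the free group on the toric divisors modulo the divisors of
characters. -/
abbrev H2 : Type := (ZMod n → ℤ) ⧸ LinearMap.range X.characterDivisor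

/-- The class of an integral combination of toric divisors. -/
def classOf : (ZMod n → ℤ) →ₗ[ℤ] X.H2 := (LinearMap.range X.characterDivisor).mkQ

/-- The self-intersection number of the toric divisor `D_i`: the integer `-a`, where
`ray (i - 1) + ray (i + 1) = a • ray i`. -/
def selfIntersection (i : ZMod n) : ℤ := -det (X.ray (i - 1)) (X.ray (i + 1))

theorem ray_relation (i : ZMod n) :
    X.ray (i - 1) + X.ray (i + 1) + X.selfIntersection i • X.ray i = 0 := by
  have h1 := X.smooth (i - 1)
  have h2 := X.smooth i
  rw [sub_add_cancel] at h1
  simp only [selfIntersection, det] at *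
  generalize X.ray (i - 1) = u at *
  generalize X.ray i = v at *
  generalize X.ray (i + 1) = w at *
  ext
  · simp only [Prod.fst_add, Prod.smul_fst, smul_eq_mul, Prod.fst_zero]
    linear_combination (-u.1) * h2 - w.1 * h1
  · simp only [Prod.snd_add, Prod.smul_snd, smul_eq_mul, Prod.snd_zero]
    linear_combination (-u.2) * h2 - w.2 * h1

/-- The intersection number with `D_i` of an integral combination of toric divisors: distinct
toric divisors have intersection number `1` if their rays are adjacent, and `0` otherwise. -/
def divisorDot (i : ZMod n) : (ZMod n → ℤ) →ₗ[ℤ] ℤ where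
  toFun c := c (i - 1) + c (i + 1) + X.selfIntersection i * c i
  map_add' a b := by simp; ring
  map_smul' a b := by simp; ring

theorem divisorDot_characterDivisor (i : ZMod n) (m : ℤ × ℤ) :
    X.divisorDot i (X.characterDivisor m) = 0 := by
  have h := X.ray_relation i
  have h1 := congrArg Prod.fst h
  have h2 := congrArg Prod.snd h
  simp only [Prod.fst_add, Prod.smul_fst, smul_eq_mul, Prod.fst_zero] at h1
  simp only [Prod.snd_add, Prod.smul_snd, smul_eq_mul, Prod.snd_zero] at h2
  simp only [divisorDot, characterDivisor, pairing, LinearMap.coe_mk, AddHom.coe_mk]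
  linear_combination m.1 * h1 + m.2 * h2

/-- The intersection number `β · D_i` of a homology class with a toric divisor. -/
def dotDivisor (i : ZMod n) : X.H2 →ₗ[ℤ] ℤ :=
  Submodule.liftQ _ (X.divisorDot i) (by
    rintro _ ⟨m, rfl⟩
    exact X.divisorDot_characterDivisor i m)

@[simp] theorem dotDivisor_classOf (i : ZMod n) (c : ZMod n → ℤ) :
    X.dotDivisor i (X.classOf c) = c (i - 1) + c (i + 1) + X.selfIntersection i * c i := rfl

/-- The intersection form is symmetric on combinations of toric divisors. -/
theorem sum_mul_divisorDot_comm (c d : ZMod n → ℤ) :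
    ∑ i, c i * X.divisorDot i d = ∑ i, d i * X.divisorDot i c := by
  simp only [divisorDot, LinearMap.coe_mk, AddHom.coe_mk, mul_add, Finset.sum_add_distrib]
  have h1 : ∑ i, c i * d (i - 1) = ∑ i, d i * c (i + 1) := by
    rw [← Equiv.sum_comp (Equiv.addRight (1 : ZMod n))]
    simp [mul_comm]
  have h2 : ∑ i, d i * c (i - 1) = ∑ i, c i * d (i + 1) := by
    rw [← Equiv.sum_comp (Equiv.addRight (1 : ZMod n))]
    simp [mul_comm]
  have h3 : ∑ i, c i * (X.selfIntersection i * d i) = ∑ i, d i * (X.selfIntersection i * c i) :=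
    Finset.sum_congr rfl fun i _ => by ring
  rw [h1, h2, h3]
  ring

/-- The intersection form on `H₂(X, ℤ)`, with `(∑ i, c i • D_i) · β = ∑ i, c i * (D_i · β)`. -/
def intersection : X.H2 →ₗ[ℤ] X.H2 →ₗ[ℤ] ℤ :=
  Submodule.liftQ _
    { toFun := fun c => ∑ i, c i • X.dotDivisor i
      map_add' := fun a b => by simp [add_smul, Finset.sum_add_distrib]
      map_smul' := fun a b => by simp [mul_smul, Finset.smul_sum] }
    (by
      rintro _ ⟨m, rfl⟩
      rw [LinearMap.mem_ker]
      refine LinearMap.ext fun β => ?_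
      obtain ⟨c, rfl⟩ := Submodule.mkQ_surjective _ β
      have h := X.sum_mul_divisorDot_comm (X.characterDivisor m) c
      simp only [X.divisorDot_characterDivisor, mul_zero, Finset.sum_const_zero] at h
      simpa [dotDivisor] using h)

@[simp] theorem intersection_classOf (c : ZMod n → ℤ) (β : X.H2) :
    X.intersection (X.classOf c) β = ∑ i, c i * X.dotDivisor i β := by
  have : X.intersection (X.classOf c) = ∑ i, c i • X.dotDivisor i := rfl
  simp [this]

/-- The canonical class `K_X`: minus the sum of the toric divisors. -/
def canonicalClass : X.H2 := X.classOf fun _ => -1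

/-- The genus `1 + (β² + K_X · β) / 2` of a smooth curve in the class `β`; the division is exact,
see `two_mul_maxGenus`. -/
def maxGenus (β : X.H2) : ℤ :=
  1 + (X.intersection β β + X.intersection X.canonicalClass β) / 2

theorem two_mul_maxGenus (β : X.H2) :
    2 * X.maxGenus β = 2 + X.intersection β β + X.intersection X.canonicalClass β := by
  have key : (2 : ℤ) ∣ X.intersection β β + X.intersection X.canonicalClass β := by
    obtain ⟨c, rfl⟩ := Submodule.mkQ_surjective _ β
    change (2 : ℤ) ∣ X.intersection (X.classOf c) (X.classOf c) +
      X.intersection (X.classOf fun _ => -1) (X.classOf c)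
    simp only [intersection_classOf, dotDivisor_classOf, ← Finset.sum_add_distrib]
    have h1 : ∑ i, c i * c (i - 1) = ∑ i, c i * c (i + 1) := by
      rw [← Equiv.sum_comp (Equiv.addRight (1 : ZMod n))]
      simp [mul_comm]
    have h2 : ∑ i, c (i - 1) = ∑ i, c i := by
      rw [← Equiv.sum_comp (Equiv.addRight (1 : ZMod n))]
      simp
    have h3 : ∑ i, c (i + 1) = ∑ i, c i :=
      Equiv.sum_comp (Equiv.addRight (1 : ZMod n)) c
    have h4 : (2 : ℤ) ∣ ∑ i, X.selfIntersection i * (c i * (c i - 1)) :=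
      Finset.dvd_sum fun i _ => Dvd.dvd.mul_left (Int.even_mul_pred_self (c i)).two_dvd _
    have h5 : ∑ i, (c i * (c (i - 1) + c (i + 1) + X.selfIntersection i * c i) +
        -1 * (c (i - 1) + c (i + 1) + X.selfIntersection i * c i)) =
        ∑ i, c i * c (i - 1) + ∑ i, c i * c (i + 1) - ∑ i, c (i - 1) - ∑ i, c (i + 1) +
          ∑ i, X.selfIntersection i * (c i * (c i - 1)) := by
      simp only [← Finset.sum_add_distrib, ← Finset.sum_sub_distrib]
      exact Finset.sum_congr rfl fun i _ => by ring
    rw [h5, h1, h2, h3]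
    obtain ⟨k, hk⟩ := h4
    exact ⟨∑ i, c i * c (i + 1) - ∑ i, c i + k, by rw [hk]; ring⟩
  have := Int.mul_ediv_cancel' key
  unfold maxGenus
  linarith

/-- The ample classes: those with positive intersection number with each toric divisor. -/
def IsAmple (β : X.H2) : Prop := ∀ i, 0 < X.dotDivisor i β

theorem sum_dotDivisor_smul_ray (β : X.H2) : ∑ i, X.dotDivisor i β • X.ray i = 0 := by
  obtain ⟨c, rfl⟩ := Submodule.mkQ_surjective _ β
  have h (m : ℤ × ℤ) := X.sum_mul_divisorDot_comm (X.characterDivisor m) c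
  simp only [X.divisorDot_characterDivisor, mul_zero, Finset.sum_const_zero] at h
  have h1 := h (1, 0)
  have h2 := h (0, 1)
  simp only [characterDivisor, pairing, LinearMap.coe_mk, AddHom.coe_mk, one_mul, zero_mul,
    add_zero, zero_add] at h1 h2
  ext
  · simpa [Prod.fst_sum, dotDivisor, mul_comm] using h1
  · simpa [Prod.snd_sum, dotDivisor, mul_comm] using h2

/-- The polygon `Δ_β` of an ample class `β`: its normal fan is the fan of `X`, and the side with
outgoing normal vector `ray i` has integral length `β · D_i`. -/
def polygon (β : X.H2) (hβ : X.IsAmple β) : LatticePolygon n where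
  toCompleteFan := X.toCompleteFan
  length i := (X.dotDivisor i β).toNat
  length_pos i := by have := hβ i; omega
  closed := by
    rw [← X.sum_dotDivisor_smul_ray β]
    exact Finset.sum_congr rfl fun i _ => by rw [Int.toNat_of_nonneg (hβ i).le]

/-- A function from the lattice `H₂(X, ℤ)` to `ℤ⟦x⟧` is polynomial if it is a polynomial in
additive functions `H₂(X, ℤ) → ℤ`, with coefficients in `ℚ⟦x⟧`. (Rational coefficients are needed
for integer-valued polynomials such as `maxGenus`.) -/
def IsPolynomialMap (F : X.H2 → ℤ⟦X⟧) : Prop :=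
  (fun β => PowerSeries.map (Int.castRingHom ℚ) (F β)) ∈
    Algebra.adjoin ℚ⟦X⟧ (Set.range fun (φ : X.H2 →+ ℤ) (β : X.H2) => ((φ β : ℤ) : ℚ⟦X⟧))

/-- `F` is the genus `g` asymptotic refined invariant of `X`: it is a polynomial function on
`H₂(X, ℤ)` with values in `ℤ⟦x⟧` that differs from the refined invariant of `β` by `o(1)` for the
`x`-adic topology, when the ample class `β` goes to infinity, i.e. when all the intersection
numbers `β · D_i` go to infinity. -/
def IsAsymptoticRefinedInvariant (g : ℕ) (F : X.H2 → ℤ⟦X⟧) : Prop :=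
  X.IsPolynomialMap F ∧
    ∀ N : ℕ, ∃ C : ℕ, ∀ (β : X.H2) (hβ : X.IsAmple β), (∀ i, (C : ℤ) ≤ X.dotDivisor i β) →
      (PowerSeries.X : ℤ⟦X⟧) ^ N ∣ reversedInvariant (X.polygon β hβ) g - F β

end ToricSurface

/-! ### The partition series and the Eisenstein series -/

/-- The series `p(x) = ∏_{j ≥ 1} 1 / (1 - x^j)`. -/
noncomputable def partitionSeries : ℤ⟦X⟧ :=
  ∏' j : ℕ, PowerSeries.invOfUnit (1 - (PowerSeries.X : ℤ⟦X⟧) ^ (j + 1)) 1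

/-- The infinite product converges, and it is the generating series of the partition numbers. -/
theorem hasProd_partitionSeries :
    HasProd (fun j : ℕ => PowerSeries.invOfUnit (1 - (PowerSeries.X : ℤ⟦X⟧) ^ (j + 1)) 1)
      (PowerSeries.mk fun k => (Fintype.card (Nat.Partition k) : ℤ)) := by
  have h := Nat.Partition.hasProd_powerSeriesMk_card_restricted ℤ (fun _ => True)
  simp only [if_true] at h
  have hf : (fun j : ℕ => PowerSeries.invOfUnit (1 - (PowerSeries.X : ℤ⟦X⟧) ^ (j + 1)) 1) =
      fun j : ℕ => ∑' k : ℕ, (PowerSeries.X : ℤ⟦X⟧) ^ ((j + 1) * k) := by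
    funext j
    have h1 := PowerSeries.WithPiTopology.tsum_pow_mul_one_sub_of_constantCoeff_eq_zero
      (f := (PowerSeries.X : ℤ⟦X⟧) ^ (j + 1)) (by simp)
    have h2 := PowerSeries.mul_invOfUnit (1 - (PowerSeries.X : ℤ⟦X⟧) ^ (j + 1)) 1 (by simp)
    simp only [pow_mul]
    exact (left_inv_eq_right_inv h1 h2).symm
  have hg : (PowerSeries.mk fun k => (Fintype.card (Nat.Partition k) : ℤ)) =
      PowerSeries.mk fun k => ((Nat.Partition.restricted k fun _ => True).card : ℤ) := by
    congr 1
    funext k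
    simp [Nat.Partition.restricted]
  rw [hf, hg]
  exact h

theorem partitionSeries_eq :
    partitionSeries = PowerSeries.mk fun k => (Fintype.card (Nat.Partition k) : ℤ) :=
  hasProd_partitionSeries.tprod_eq

/-- The series `E₂(x) = ∑_{k ≥ 1} σ₁(k) x^k`. -/
noncomputable def eisensteinSeries : ℤ⟦X⟧ :=
  PowerSeries.mk fun k => (ArithmeticFunction.sigma 1 k : ℤ)

end ToricRefined

/-! Writing q^{w/2} - q^{-w/2} = q^{w/2} (1 - q^{-w}) shows that a marked diagram contributes
x^defect ∏ (1 - x^{w(e)})² (1 - x)^{b^⊤ + b^⊥} to the reversed invariant. The defect is a sum of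
non-negative costs: the inversions of the sequences L and R read along the marking, w times the
number of floors skipped by a bounded edge of weight w, and the distances of sinks to the last floor
and of sources to the first one (`multiplicity_eq_T_mul`, `sum_weight_add_defect`). Modulo x^N only
diagrams of defect less than N count.

If the sides are long, the flow through every level of such a diagram is large, and this forces an
edge between any two consecutive floors (`exists_chain_edge`). In genus 1 exactly one bounded edge
is left over. The diagram is thus a chain with one additional edge and some ends, and is described
by a `Code`. The invariant becomes a finite sum over codes (`map_reversedInvariant`), evaluated in a
ring where x^N = 0.

The sum is evaluated in layers. A sequence of slopes taking r + 1 consecutive values is a stack of r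
binary words counted by inversions, and each word gives a Gaussian binomial coefficient that has
stabilised to p; this yields p^{rL + rR} (`sum_arrangements`). The ends form complete homogeneous
sums that have reached their limit, p² for the sinks and p² for the sources, up to a factor that
depends on the additional edge (`sum_endSet_dual`). The exponent rL + rR + 4 is the number of rays,
that is χ.

There remains the sum over the additional edge (`sum_levels`). An edge parallel to the chain at
level t shares the available weight with the chain edge, which gives about flow(t) - 1 choices; all
corrections, including those from edges that skip floors, are concentrated near the bottom and the
top. Each of the two ends of the diagram contributes -6 E₂, whence the 12. The sum of the flows is a
constant W minus the inversions; the average (rL + rR) E₂ of the inversions is cancelled by the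
linear variation of the flow near the ends of the chain (`map_reversedInvariant_eq`).

Finally W minus the number a - 1 of levels is the number of interior lattice points by Pick's
formula. It equals g_max(β) because β² is twice the area and -K_X · β is the boundary length
(`intersection_self_eq_sum_support`, `twiceArea_eq`). Uniqueness holds because a polynomial function
that tends to zero along all lines β + k β₀, with β₀ ample, vanishes. -/

namespace ToricRefined

open Finset

/-! ### Geometric series in a ring with a nilpotent element -/

section Nilpotent

variable {R : Type*} [CommRing R]

/-- The series `x^c + x^{2c} + ⋯`, truncated after `N` terms. -/
def geomTail (x : R) (N c : ℕ) : R := ∑ k ∈ range N, x ^ (c * (k + 1))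

theorem pow_eq_zero_of_ge {x : R} {N : ℕ} (hx : x ^ N = 0) {m : ℕ} (h : N ≤ m) : x ^ m = 0 :=
  pow_eq_zero_of_le h hx

/-- Nilpotency makes the truncated geometric series an exact inverse of 1 - x^c. All later estimates
modulo x^N are therefore exact identities in R. -/
theorem one_sub_mul_one_add_geomTail {x : R} {N : ℕ} (hx : x ^ N = 0) {c : ℕ} (hc : 1 ≤ c) :
    (1 - x ^ c) * (1 + geomTail x N c) = 1 := by
  have h1 : 1 + geomTail x N c = ∑ k ∈ range (N + 1), (x ^ c) ^ k := by
    rw [sum_range_succ', geomTail, add_comm]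
    simp [pow_mul]
  have h2 : (x ^ c) ^ (N + 1) = 0 := by
    rw [← pow_mul]; exact pow_eq_zero_of_ge hx (by nlinarith)
  have h3 := mul_neg_geom_sum (x ^ c) (N + 1)
  rw [h1, h3, h2, sub_zero]

theorem geomTail_eq_zero {x : R} {N : ℕ} (hx : x ^ N = 0) {c : ℕ} (hc : N ≤ c) :
    geomTail x N c = 0 :=
  sum_eq_zero fun k _ => pow_eq_zero_of_ge hx (by nlinarith)

theorem pow_mul_one_add_geomTail {x : R} {N : ℕ} (hx : x ^ N = 0) {c : ℕ} (hc : 1 ≤ c) :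
    x ^ c * (1 + geomTail x N c) = geomTail x N c := by
  have := one_sub_mul_one_add_geomTail hx hc
  linear_combination -this

theorem geomTail_sub_mul {x : R} {N : ℕ} (hx : x ^ N = 0) {c : ℕ} (hc : 1 ≤ c) :
    geomTail x N c * (1 - x ^ c) = x ^ c := by
  have := one_sub_mul_one_add_geomTail hx hc
  linear_combination this

theorem geomTail_mul_pow {x : R} {N : ℕ} (hx : x ^ N = 0) {c : ℕ} (hc : 1 ≤ c) {k : ℕ}
    (hk : k ≤ N) :
    geomTail x N c * x ^ (c * k) = ∑ j ∈ Ico k N, x ^ (c * (j + 1)) := by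
  induction k with
  | zero => simp [geomTail]
  | succ k ih =>
    have h1 := ih (by omega)
    rw [sum_eq_sum_Ico_succ_bot (by omega)] at h1
    have h2 := geomTail_sub_mul hx hc
    have h3 : x ^ (c * (k + 1)) = x ^ (c * k) * x ^ c := by rw [mul_add, pow_add, mul_one]
    rw [h3] at h1 ⊢
    linear_combination h1 - x ^ (c * k) * h2

/-- There are j ways to write c (j + 1) as an ordered sum of two positive multiples of c. -/
theorem geomTail_sq {x : R} {N : ℕ} (hx : x ^ N = 0) {c : ℕ} (hc : 1 ≤ c) :
    geomTail x N c ^ 2 = ∑ j ∈ range N, (j : R) * x ^ (c * (j + 1)) := by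
  have h1 : geomTail x N c ^ 2 =
      ∑ k ∈ range N, ∑ j ∈ range N, if k + 1 ≤ j then x ^ (c * (j + 1)) else 0 := by
    rw [pow_two]
    nth_rewrite 1 [geomTail]
    rw [sum_mul]
    refine sum_congr rfl fun k hk => ?_
    rw [mul_comm, geomTail_mul_pow hx hc (by simpa using hk), ← sum_filter]
    refine sum_congr ?_ fun _ _ => rfl
    ext j; simp; omega
  rw [h1, sum_comm]
  refine sum_congr rfl fun j hj => ?_
  rw [← sum_filter, sum_const, nsmul_eq_mul]
  congr 2
  have : (range N).filter (fun k => k + 1 ≤ j) = range j := by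
    ext k; simp at hj ⊢; omega
  rw [this, card_range]

/-- A sum of terms divisible by `geomTail x N t` only involves the indices `t ≤ N`. -/
theorem sum_Ico_eq_sum_range_of_vanish {N a : ℕ} (ha : N + 1 ≤ a) (f : ℕ → R)
    (hf : ∀ t, N + 1 ≤ t → f t = 0) : ∑ t ∈ Ico 1 a, f t = ∑ k ∈ range N, f (k + 1) := by
  rw [range_eq_Ico, sum_Ico_add' f 0 N 1]
  symm
  refine sum_subset (fun t => by simp; omega) fun t h1 h2 => hf t ?_
  simp at h1 h2; omega

/-- Exchanging the two factors of the exponent t (j + 1) in `geomTail_sq` moves the coefficient j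
from the exponent to the index of the series. -/
theorem sum_geomTail_sq {x : R} {N : ℕ} (hx : x ^ N = 0) {a : ℕ} (ha : N + 1 ≤ a) :
    ∑ t ∈ Ico 1 a, geomTail x N t ^ 2 =
      ∑ t ∈ Ico 1 a, (t : R) * geomTail x N t - ∑ t ∈ Ico 1 a, geomTail x N t := by
  rw [← sum_sub_distrib, sum_Ico_eq_sum_range_of_vanish ha, sum_Ico_eq_sum_range_of_vanish ha]
  · rw [sum_congr rfl fun k _ => geomTail_sq hx (Nat.succ_le_succ (Nat.zero_le k)), sum_comm]
    refine sum_congr rfl fun j _ => ?_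
    rw [geomTail, mul_sum, ← sum_sub_distrib]
    refine sum_congr rfl fun k _ => ?_
    rw [mul_comm (k + 1) (j + 1)]
    push_cast; ring
  · intro t ht; rw [geomTail_eq_zero hx (by omega)]; simp
  · intro t ht; rw [geomTail_eq_zero hx (by omega)]; simp

/-- Exactly 2 t - 1 pairs have maximum t. -/
theorem sum_sum_max (F : ℕ → R) (a : ℕ) :
    ∑ c ∈ Ico 1 a, ∑ m ∈ Ico 1 a, F (max c m) = ∑ t ∈ Ico 1 a, (2 * (t : R) - 1) * F t := by
  induction a with
  | zero => simp
  | succ a ih =>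
    rcases Nat.eq_zero_or_pos a with rfl | ha
    · simp
    rw [sum_Ico_succ_top (by omega), sum_Ico_succ_top (by omega), sum_Ico_succ_top (by omega)]
    rw [sum_congr rfl fun c _ => sum_Ico_succ_top (show 1 ≤ a by omega) fun m => F (max c m)]
    rw [sum_add_distrib, ih]
    rw [sum_congr rfl fun c hc => show F (max c a) = F a by
      simp at hc; rw [max_eq_right (by omega)]]
    rw [sum_congr rfl fun c hc => show F (max a c) = F a by
      simp at hc; rw [max_eq_left (by omega)]]
    simp only [sum_const, Nat.card_Ico, nsmul_eq_mul, Nat.cast_sub ha]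
    simp
    ring

end Nilpotent

/-! ### Complete homogeneous sums -/

section Homogeneous

variable {A : Type*} [CommRing A]

/-- The weakly increasing sequences of length `b` with values in `{0, …, G - 1}`. -/
def monotoneSeqs (b G : ℕ) : Finset (Fin b → ℕ) := by
  classical exact (Fintype.piFinset fun _ => range G).filter Monotone

theorem mem_monotoneSeqs {b G : ℕ} {r : Fin b → ℕ} :
    r ∈ monotoneSeqs b G ↔ (∀ s, r s < G) ∧ Monotone r := by
  simp [monotoneSeqs]

/-- The complete homogeneous symmetric sum of degree `b` of `y 0, …, y (G - 1)`. -/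
def homSum (y : ℕ → A) (b G : ℕ) : A := ∑ r ∈ monotoneSeqs b G, ∏ s, y (r s)

theorem homSum_zero (y : ℕ → A) (G : ℕ) : homSum y 0 G = 1 := by
  have : monotoneSeqs 0 G = {fun i => i.elim0} := by
    ext r
    simp only [mem_monotoneSeqs, mem_singleton]
    exact ⟨fun _ => Subsingleton.elim _ _, fun _ => ⟨fun s => s.elim0, fun s => s.elim0⟩⟩
  simp [homSum, this]

/-- The sequences are split according to whether the last term, which is the largest one, takes the
greatest allowed value G. -/
theorem homSum_succ (y : ℕ → A) (b G : ℕ) :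
    homSum y (b + 1) (G + 1) = y G * homSum y b (G + 1) + homSum y (b + 1) G := by
  classical
  unfold homSum
  rw [← sum_filter_add_sum_filter_not (monotoneSeqs (b + 1) (G + 1)) fun r => r (Fin.last b) = G]
  congr 1
  · rw [mul_sum]
    refine sum_nbij' (fun r => Fin.init r) (fun r => Fin.snoc r G) ?_ ?_ ?_ ?_ ?_
    · intro r hr
      simp only [mem_filter, mem_monotoneSeqs] at hr ⊢
      exact ⟨fun s => hr.1.1 _, fun s t h => hr.1.2 (by simpa using h)⟩
    · intro r hr
      simp only [mem_filter, mem_monotoneSeqs] at hr ⊢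
      refine ⟨⟨fun s => ?_, fun s t h => ?_⟩, by simp⟩
      · refine Fin.lastCases ?_ (fun i => ?_) s
        · simp
        · simpa using hr.1 i
      · revert h
        refine Fin.lastCases ?_ (fun i => ?_) s <;> refine Fin.lastCases ?_ (fun j => ?_) t
        · simp
        · intro h; exact absurd h (by simp [Fin.le_def])
        · intro; have := hr.1 i; simp; omega
        · intro h; simpa using hr.2 (by simpa using h)
    · intro r hr
      simp only [mem_filter] at hr
      rw [← hr.2]; simp
    · intro r hr; simp
    · intro r hr
      simp only [mem_filter] at hr
      rw [Fin.prod_univ_castSucc, hr.2, mul_comm]; rfl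
  · refine sum_congr ?_ fun _ _ => rfl
    ext r
    simp only [mem_filter, mem_monotoneSeqs]
    constructor
    · rintro ⟨⟨h1, h2⟩, h3⟩
      refine ⟨fun s => ?_, h2⟩
      have := h2 (Fin.le_last s); have := h1 (Fin.last b); omega
    · rintro ⟨h1, h2⟩
      exact ⟨⟨fun s => by have := h1 s; omega, h2⟩, by have := h1 (Fin.last b); omega⟩

theorem homSum_one {y : ℕ → A} (b : ℕ) : homSum y b 1 = y 0 ^ b := by
  induction b with
  | zero => simp [homSum_zero]
  | succ b ih =>
    rw [homSum_succ, ih, pow_succ']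
    have : homSum y (b + 1) 0 = 0 := by
      rw [homSum]
      have : monotoneSeqs (b + 1) 0 = ∅ := by
        ext r; simp [mem_monotoneSeqs]
      simp [this]
    simp [this]

theorem homSum_smul (t : A) (y : ℕ → A) (b G : ℕ) :
    homSum (fun r => t * y r) b G = t ^ b * homSum y b G := by
  simp only [homSum, prod_mul_distrib, mul_sum, prod_const, card_univ, Fintype.card_fin]

/-- If `z 0 = 1` and the other `z r` are divisible by `x`, then the complete homogeneous sums
converge `x`-adically to the product of the `1 / (1 - z r)`. -/
theorem homSum_dvd_sub {x : A} {z Q : ℕ → A} (z0 : z 0 = 1) (hz : ∀ r, 1 ≤ r → x ∣ z r)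
    (Q0 : Q 0 = 1) (hQ : ∀ r, (1 - z (r + 1)) * Q (r + 1) = Q r) (b G : ℕ) :
    x ^ (b + 1) ∣ homSum z b (G + 1) - Q G := by
  induction b generalizing G with
  | zero =>
    rw [homSum_zero, zero_add, pow_one]
    induction G with
    | zero => simp [Q0]
    | succ G ih =>
      have h := hQ G
      have : 1 - Q (G + 1) = (1 - Q G) - z (G + 1) * Q (G + 1) := by rw [← h]; ring
      rw [this]
      exact dvd_sub ih (Dvd.dvd.mul_right (hz _ (by omega)) _)
  | succ b ihb =>
    induction G with
    | zero => simp [homSum_one, z0, Q0]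
    | succ G ih =>
      have h := hQ G
      -- The recursions for the homogeneous sums and for Q are subtracted. The first term gains one
      -- factor x from z (G + 1), in addition to those given by the induction on b.
      have : homSum z (b + 1) (G + 1 + 1) - Q (G + 1) =
          z (G + 1) * (homSum z b (G + 1 + 1) - Q (G + 1)) +
            (homSum z (b + 1) (G + 1) - Q G) := by
        rw [homSum_succ, ← h]; ring
      rw [this]
      refine dvd_add ?_ ih
      rw [pow_succ' x (b + 1)]
      exact mul_dvd_mul (hz _ (by omega)) (ihb _)

end Homogeneous

/-! ### Sinks and sources -/

section Ends

/-- Consider the sequence `v₀ e₀ v₁ ⋯` of floors and edges of a chain, into which an additional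
edge is inserted after the first `φ` elements. Then `floorsBefore φ r` is the number of floors
among the first `r` elements of the sequence. -/
def floorsBefore (φ r : ℕ) : ℕ := ((if r ≤ φ then r else r - 1) + 1) / 2

/-- Along the chain each value m < a occurs twice, after a floor and after the edge that follows it.
The inserted edge repeats the value reached at its place. The place r = 0 and the end of the
sequence are left out. -/
theorem sum_floorsBefore {M : Type*} [AddCommMonoid M] (F : ℕ → M) {a φ : ℕ} (h2 : φ + 2 ≤ 2 * a) :
    ∑ r ∈ range (2 * a - 1), F (floorsBefore φ (r + 1)) =
      (∑ m ∈ Ico 1 a, 2 • F m) + F ((φ + 1) / 2) := by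
  have key : ∀ n, ∑ r ∈ range (2 * n), F ((r + 2) / 2) = ∑ m ∈ Ico 1 (n + 1), 2 • F m := by
    intro n
    induction n with
    | zero => simp
    | succ n ih =>
      rw [mul_add, sum_range_succ, sum_range_succ, ih, sum_Ico_succ_top (show 1 ≤ n + 1 by omega)]
      rw [show (2 * n + 2) / 2 = n + 1 by omega, show (2 * n + 1 + 2) / 2 = n + 1 by omega,
        two_smul, add_assoc]
  obtain ⟨n, rfl⟩ : ∃ n, a = n + 1 := ⟨a - 1, by omega⟩
  obtain ⟨k, hk⟩ : ∃ k, 2 * n = φ + k := ⟨2 * n - φ, by omega⟩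
  rw [← key, show 2 * (n + 1) - 1 = φ + 1 + k by omega, sum_range_add, sum_range_succ, hk,
    sum_range_add, add_right_comm]
  congr 1
  · congr 1
    · refine sum_congr rfl fun r hr => ?_
      simp only [mem_range] at hr
      simp only [floorsBefore]
      rw [if_pos (by omega)]
    · refine sum_congr rfl fun r hr => ?_
      simp only [floorsBefore]
      rw [if_neg (by omega)]
      congr 2; omega
  · simp only [floorsBefore]
    rw [if_neg (by omega)]
    congr 2

/-- The possible positions and attachments of `b` sinks (or sources), numbered from the end of the
diagram: `r s` is the number of floors and bounded edges after the sink `s`, and `d s` is the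
number of floors after the floor to which it is attached. -/
def endSet (b a φ : ℕ) : Finset ((Fin b → ℕ) × (Fin b → ℕ)) :=
  (monotoneSeqs b (2 * a) ×ˢ Fintype.piFinset fun _ : Fin b => range a).filter
    fun p => ∀ s, floorsBefore φ (p.1 s) ≤ p.2 s

theorem mem_endSet {b a φ : ℕ} {p : (Fin b → ℕ) × (Fin b → ℕ)} :
    p ∈ endSet b a φ ↔ ((∀ s, p.1 s < 2 * a) ∧ Monotone p.1) ∧ (∀ s, p.2 s < a) ∧
      ∀ s, floorsBefore φ (p.1 s) ≤ p.2 s := by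
  simp [endSet, mem_monotoneSeqs, and_assoc]

/-- Once the positions are fixed, the floors of attachment are chosen independently, so the inner
sum is a product. -/
theorem sum_endSet {A : Type*} [CommRing A] (w : ℕ → A) (b a φ : ℕ) :
    ∑ p ∈ endSet b a φ, ∏ s, w (p.2 s) =
      homSum (fun r => ∑ d ∈ Ico (floorsBefore φ r) a, w d) b (2 * a) := by
  classical
  rw [endSet, sum_filter, sum_product, homSum]
  refine sum_congr rfl fun r _ => ?_
  rw [prod_univ_sum, ← sum_filter]
  refine sum_congr ?_ fun _ _ => rfl
  ext d
  simp only [mem_filter, Fintype.mem_piFinset, mem_range, mem_Ico]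
  exact ⟨fun h s => ⟨h.2 s, h.1 s⟩, fun h => ⟨fun s => (h s).2, fun s => (h s).1⟩⟩

end Ends

end ToricRefined

namespace ToricRefined

open Finset

/-! ### Generating series of sinks and sources, over the dual numbers -/

section EndSums

variable {R : Type*} [CommRing R]

/-- The dual number `p + q ε`. -/
def dual (p q : R) : DualNumber R := TrivSqZeroExt.inl p + TrivSqZeroExt.inr q

@[simp] theorem fst_dual (p q : R) : (dual p q).fst = p := by simp [dual]

@[simp] theorem snd_dual (p q : R) : (dual p q).snd = q := by simp [dual]

theorem dual_mul (p q p' q' : R) : dual p q * dual p' q' = dual (p * p') (p * q' + p' * q) := by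
  ext <;> simp [mul_comm]

theorem dual_one_zero : dual (1 : R) 0 = 1 := by ext <;> simp

/-- The second coordinate is the first one times a logarithmic derivative, and the latter is
additive. This turns a product weight into a count of the ends crossing a level. -/
theorem prod_dual {ι : Type*} (s : Finset ι) (p n : ι → R) :
    ∏ i ∈ s, dual (p i) (p i * n i) = dual (∏ i ∈ s, p i) ((∏ i ∈ s, p i) * ∑ i ∈ s, n i) := by
  classical
  induction s using Finset.induction_on with
  | empty => simp [dual_one_zero]
  | insert i s hi ih =>
    rw [prod_insert hi, prod_insert hi, sum_insert hi, ih, dual_mul]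
    congr 1; ring

theorem sum_dual {ι : Type*} (s : Finset ι) (p q : ι → R) :
    ∑ i ∈ s, dual (p i) (q i) = dual (∑ i ∈ s, p i) (∑ i ∈ s, q i) := by
  classical
  induction s using Finset.induction_on with
  | empty => ext <;> simp
  | insert i s hi ih => rw [sum_insert hi, sum_insert hi, sum_insert hi, ih]; ext <;> simp

theorem sum_Ico_one_sub_mul_pow (x : R) {m n : ℕ} (h : m ≤ n) :
    ∑ d ∈ Ico m n, (1 - x) * x ^ d = x ^ m - x ^ n := by
  induction n, h using Nat.le_induction with
  | base => simp
  | succ n h ih => rw [sum_Ico_succ_top h, ih]; ring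

/-- The sum of (1 - x) x^d telescopes, and its upper boundary term x^a vanishes. The indicator of c
≤ d only raises the lower limit. -/
theorem sum_dual_weights {x : R} {a c m : ℕ} (hx : x ^ a = 0) :
    ∑ d ∈ Ico m a, dual ((1 - x) * x ^ d) ((1 - x) * x ^ d * if c ≤ d then 1 else 0) =
      dual (x ^ m) (x ^ max m c) := by
  rw [sum_dual]
  have h1 : ∀ m, ∑ d ∈ Ico m a, (1 - x) * x ^ d = x ^ m := by
    intro m
    rcases le_total m a with h | h
    · rw [sum_Ico_one_sub_mul_pow x h, hx, sub_zero]
    · rw [Ico_eq_empty (by omega), sum_empty, pow_eq_zero_of_ge hx h]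
  rw [h1]
  congr 1
  simp only [mul_ite, mul_one, mul_zero]
  rw [← sum_filter, ← h1 (max m c)]
  refine sum_congr ?_ fun _ _ => rfl
  ext d; simp

/-- The factor by which an additional edge changes the number of sinks that cross a level. -/
def crossTerm (x : R) (N c m : ℕ) : R := geomTail x N m * (x ^ (c - m) - x ^ c)

theorem one_le_floorsBefore {φ r : ℕ} (h1 : 1 ≤ φ) (hr : 1 ≤ r) : 1 ≤ floorsBefore φ r := by
  unfold floorsBefore; split_ifs <;> omega

/-- A single homogeneous sum over the dual numbers gives the series of the ends and, as its ε-part,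
the same series weighted by the number of ends that cross the level c. Since b ≥ N, the sum has
reached its limit ∏ 1 / (1 - z r) by `homSum_dvd_sub`, and the logarithmic derivatives of the
factors of this limit are the terms `crossTerm`. -/
theorem sum_endSet_dual {x : R} {N : ℕ} (hx : x ^ N = 0) {b a φ c : ℕ} (hb : N ≤ b) (ha : N ≤ a)
    (h1 : 1 ≤ φ) (ha' : 1 ≤ a) :
    ∑ p ∈ endSet b a φ, dual ((1 - x) ^ b * x ^ ∑ s, p.2 s)
        ((1 - x) ^ b * (x ^ ∑ s, p.2 s) * ∑ s, if c ≤ p.2 s then 1 else 0) =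
      dual (∏ r ∈ range (2 * a - 1), (1 + geomTail x N (floorsBefore φ (r + 1))))
        ((∏ r ∈ range (2 * a - 1), (1 + geomTail x N (floorsBefore φ (r + 1)))) *
          (b * x ^ c + ∑ r ∈ range (2 * a - 1), crossTerm x N c (floorsBefore φ (r + 1)))) := by
  have hxa : x ^ a = 0 := pow_eq_zero_of_ge hx ha
  have hw : ∀ p : (Fin b → ℕ) × (Fin b → ℕ), dual ((1 - x) ^ b * x ^ ∑ s, p.2 s)
        ((1 - x) ^ b * (x ^ ∑ s, p.2 s) * ∑ s, if c ≤ p.2 s then 1 else 0) =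
      ∏ s, dual ((1 - x) * x ^ p.2 s) ((1 - x) * x ^ p.2 s * if c ≤ p.2 s then 1 else 0) := by
    intro p
    rw [prod_dual, prod_mul_distrib, prod_const, prod_pow_eq_pow_sum]
    simp
  simp only [hw]
  rw [sum_endSet (fun d => dual ((1 - x) * x ^ d) ((1 - x) * x ^ d * if c ≤ d then 1 else 0))]
  simp only [sum_dual_weights hxa]
  -- All variables are divided by the value 1 + x^c ε of the variable with r = 0, since the limit
  -- theorem requires z 0 = 1. The b-th power of the divisor is the origin of the summand b x^c.
  set z : ℕ → DualNumber R := fun r =>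
    dual (x ^ floorsBefore φ r) (x ^ max (floorsBefore φ r) c - x ^ (c + floorsBefore φ r)) with hz
  have hyz : (fun r => dual (x ^ floorsBefore φ r) (x ^ max (floorsBefore φ r) c)) =
      fun r => dual 1 (x ^ c) * z r := by
    funext r
    rw [hz, dual_mul, pow_add]
    congr 1 <;> ring
  rw [hyz, homSum_smul]
  set Q : ℕ → DualNumber R := fun G =>
    dual (∏ r ∈ range G, (1 + geomTail x N (floorsBefore φ (r + 1))))
      ((∏ r ∈ range G, (1 + geomTail x N (floorsBefore φ (r + 1)))) *
        ∑ r ∈ range G, crossTerm x N c (floorsBefore φ (r + 1))) with hQ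
  have key := homSum_dvd_sub (x := dual x 0) (z := z) (Q := Q)
    (by simp only [hz, floorsBefore]; simp [dual_one_zero])
    (by
      intro r hr
      have h := one_le_floorsBefore h1 hr
      obtain ⟨m, hm⟩ : ∃ m, floorsBefore φ r = m + 1 := ⟨floorsBefore φ r - 1, by omega⟩
      obtain ⟨k, hk⟩ : ∃ k, max (m + 1) c = k + 1 := ⟨max (m + 1) c - 1, by omega⟩
      refine ⟨dual (x ^ m) (x ^ k - x ^ (c + m)), ?_⟩
      simp only [hz]
      rw [dual_mul, hm, hk]
      congr 1 <;> ring)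
    (by simp [hQ, dual_one_zero])
    (by
      intro r
      have h := one_le_floorsBefore h1 (show 1 ≤ r + 1 by omega)
      simp only [hz, hQ]
      rw [prod_range_succ, sum_range_succ, ← dual_one_zero]
      generalize floorsBefore φ (r + 1) = m at h ⊢
      generalize ∏ r ∈ range r, (1 + geomTail x N (floorsBefore φ (r + 1))) = q
      generalize ∑ r ∈ range r, crossTerm x N c (floorsBefore φ (r + 1)) = t
      have h2 := one_sub_mul_one_add_geomTail hx h
      have h3 := pow_mul_one_add_geomTail hx h
      have h4 : x ^ max m c = x ^ m * x ^ (c - m) := by rw [← pow_add]; congr 1; omega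
      have h5 : dual (1 : R) 0 - dual (x ^ m) (x ^ max m c - x ^ (c + m)) =
          dual (1 - x ^ m) (x ^ m * x ^ c - x ^ m * x ^ (c - m)) := by
        rw [h4, pow_add]; ext <;> simp; ring
      rw [h5, dual_mul, crossTerm]
      congr 1
      · linear_combination q * h2
      · linear_combination q * (t + geomTail x N m * (x ^ (c - m) - x ^ c)) * h2 +
          q * (x ^ c - x ^ (c - m)) * h3) b (2 * a - 1)
  have hX : (dual x 0) ^ (b + 1) = 0 := by
    have : ∀ k, (dual x 0) ^ k = dual (x ^ k) 0 := by
      intro k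
      induction k with
      | zero => simp [dual_one_zero]
      | succ k ih => rw [pow_succ, ih, dual_mul, pow_succ]; simp
    rw [this, pow_eq_zero_of_ge hx (by omega)]
    ext <;> simp
  rw [hX, zero_dvd_iff, sub_eq_zero, show 2 * a - 1 + 1 = 2 * a by omega] at key
  rw [key]
  have hb' : dual 1 (x ^ c) ^ b = dual 1 (b * x ^ c) := by
    generalize b = n
    induction n with
    | zero => simp [dual_one_zero]
    | succ n ih => rw [pow_succ, ih, dual_mul]; push_cast; congr 1 <;> ring
  rw [hb', hQ, dual_mul]
  congr 1 <;> ring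

/-- The product over all `m` of `1 / (1 - x ^ m)`. -/
def geomProd (x : R) (N a : ℕ) : R := ∏ m ∈ Ico 1 a, (1 + geomTail x N m)

theorem prod_floorsBefore (x : R) (N : ℕ) {a φ : ℕ} (h2 : φ + 2 ≤ 2 * a) :
    ∏ r ∈ range (2 * a - 1), (1 + geomTail x N (floorsBefore φ (r + 1))) =
      geomProd x N a ^ 2 * (1 + geomTail x N ((φ + 1) / 2)) := by
  have := sum_floorsBefore (M := Additive R) (fun m => Additive.ofMul (1 + geomTail x N m)) h2
  have h := congrArg Additive.toMul this
  simp only [toMul_sum, toMul_add, toMul_ofMul, toMul_nsmul] at h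
  rw [h, prod_pow, geomProd]

/-- The generating series of the possible sinks. -/
theorem sum_endSet_eq {x : R} {N : ℕ} (hx : x ^ N = 0) {b a φ : ℕ} (hb : N ≤ b) (ha : N ≤ a)
    (h1 : 1 ≤ φ) (h2 : φ + 2 ≤ 2 * a) :
    ∑ p ∈ endSet b a φ, (1 - x) ^ b * x ^ ∑ s, p.2 s =
      geomProd x N a ^ 2 * (1 + geomTail x N ((φ + 1) / 2)) := by
  have h := congrArg TrivSqZeroExt.fst
    (sum_endSet_dual (c := 0) hx hb ha h1 (by omega))
  rw [sum_dual] at h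
  simpa [prod_floorsBefore x N h2] using h

/-- The generating series of the possible sinks, weighted by the number of those that cross the
level of the additional edge. -/
theorem sum_endSet_card {x : R} {N : ℕ} (hx : x ^ N = 0) {b a φ c : ℕ} (hb : N ≤ b) (ha : N ≤ a)
    (h1 : 1 ≤ φ) (h2 : φ + 2 ≤ 2 * a) (hc : (φ + 1) / 2 = c) :
    ∑ p ∈ endSet b a φ, (1 - x) ^ b * (x ^ ∑ s, p.2 s) * ∑ s, (if c ≤ p.2 s then 1 else 0) =
      geomProd x N a ^ 2 *
        ((b + 1) * geomTail x N c + 2 * ∑ m ∈ Ico 1 a, geomTail x N (max c m)) := by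
  have hc1 : 1 ≤ c := by omega
  have h := congrArg TrivSqZeroExt.snd
    (sum_endSet_dual (c := c) hx hb ha h1 (by omega))
  rw [sum_dual] at h
  simp only [snd_dual] at h
  rw [h, prod_floorsBefore x N h2, sum_floorsBefore _ h2, hc, mul_assoc]
  congr 1
  have e1 := pow_mul_one_add_geomTail hx hc1
  have e2 := geomTail_sub_mul hx hc1
  -- For m ≥ c the factor 1 - x^c of `crossTerm` cancels 1 + geomTail x N c. For m ≤ c the factor is
  -- x^(c - m) (1 - x^m), which turns geomTail x N m into x^c.
  have e3 : ∀ m ∈ Ico 1 a, (1 + geomTail x N c) * (2 • crossTerm x N c m) =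
      2 * geomTail x N (max c m) := by
    intro m hm
    simp only [mem_Ico] at hm
    have e4 := one_sub_mul_one_add_geomTail hx hc1
    rw [crossTerm, nsmul_eq_mul]
    rcases le_total c m with hcm | hcm
    · rw [max_eq_right hcm, Nat.sub_eq_zero_of_le hcm]
      push_cast
      linear_combination 2 * geomTail x N m * e4
    · rw [max_eq_left hcm]
      have e5 := geomTail_sub_mul hx hm.1
      have e6 : x ^ c = x ^ (c - m) * x ^ m := by rw [← pow_add]; congr 1; omega
      rw [e6] at e1 ⊢
      push_cast
      linear_combination 2 * (1 + geomTail x N c) * x ^ (c - m) * e5 + 2 * e1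
  rw [mul_add, mul_add, mul_sum, sum_congr rfl e3, ← mul_sum, crossTerm, Nat.sub_self, pow_zero]
  linear_combination ((b : R) + 1) * e1 + (1 + geomTail x N c) * e2
  
end EndSums

end ToricRefined

namespace ToricRefined

open Finset

/-! ### Summation over the places and weights of the additional edge -/

section Levels

variable {R : Type*} [CommRing R]

/-- The sum over the weights of one of two parallel edges, minus its number of terms. -/
def parallelTerm (x : R) (N : ℕ) : R := ∑ w ∈ Ico 1 N, (2 * (1 - x ^ w) ^ 2 - 2)

theorem sum_Ico_pow_mul {x : R} {N : ℕ} (hx : x ^ N = 0) {t : ℕ} (ht : 1 ≤ t) :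
    ∑ w ∈ Ico 1 N, x ^ (w * t) = geomTail x N t := by
  cases N with
  | zero => simp [geomTail]
  | succ M =>
    rw [geomTail, sum_range_succ, sum_Ico_eq_sum_range, pow_eq_zero_of_ge hx (by nlinarith), add_zero]
    refine sum_congr rfl fun k _ => ?_
    congr 1; ring

/-- The pairs of floors that are joined by an edge crossing the level `t`. -/
theorem sum_pow_crossing (y : R) (a t : ℕ) :
    ∑ i ∈ range t, ∑ j ∈ Ico t a, y ^ (j - i - 1) * (1 - y) ^ 2 =
      (1 - y ^ t) * (1 - y ^ (a - t)) := by
  have h1 := mul_neg_geom_sum y t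
  have h2 := mul_neg_geom_sum y (a - t)
  -- Since j - i - 1 = (t - 1 - i) + (j - t), the double sum is a product of two geometric sums, the
  -- first one being read backwards.
  rw [← h1, ← h2, ← sum_range_reflect, mul_mul_mul_comm, sum_mul_sum, mul_sum]
  refine sum_congr rfl fun i hi => ?_
  rw [sum_Ico_eq_sum_range, mul_sum]
  refine sum_congr rfl fun j hj => ?_
  simp only [mem_range] at hi hj
  rw [← pow_add, mul_comm, pow_two]
  congr 2
  omega

/-- The additional edge has two places at each level t: g = 2 t - 1, before the chain edge of that
level, and g = 2 t, after it. -/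
theorem sum_Icc_half (F : ℕ → R) {i j : ℕ} (h : i ≤ j) :
    ∑ g ∈ Ioc (2 * i) (2 * j), F ((g + 1) / 2) = 2 * ∑ t ∈ Ioc i j, F t := by
  induction j, h using Nat.le_induction with
  | base => simp
  | succ j h ih =>
    rw [mul_add, sum_Ioc_succ_top (by omega), sum_Ioc_succ_top (by omega), ih,
      sum_Ioc_succ_top (by omega), mul_add]
    rw [show (2 * j + 1 + 1) / 2 = j + 1 by omega, show (2 * j + 1 + 1 + 1) / 2 = j + 1 by omega]
    ring

/-- The sum over the additional edges that are not parallel to an edge of the chain. -/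
theorem sum_long_edges (x : R) (N a : ℕ) (F : ℕ → R) :
    ∑ w ∈ Ico 1 N, ∑ i ∈ range a, ∑ j ∈ Ico (i + 2) a, ∑ g ∈ Ioc (2 * i) (2 * j),
        x ^ (w * (j - i - 1)) * (1 - x ^ w) ^ 2 * F ((g + 1) / 2) =
      ∑ t ∈ Ico 1 a, F t * ∑ w ∈ Ico 1 N,
        (2 * ((1 - x ^ (w * t)) * (1 - x ^ (w * (a - t)))) - 2 * (1 - x ^ w) ^ 2) := by
  simp only [mul_sum]
  rw [sum_comm (s := Ico 1 a)]
  refine sum_congr rfl fun w _ => ?_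
  -- The missing pairs j = i + 1 are added in order to complete the sum over i < t ≤ j, and
  -- subtracted again. This is where - 2 (1 - x ^ w) ^ 2 comes from.
  have h1 : ∀ i ∈ range a, ∑ j ∈ Ico (i + 2) a, ∑ g ∈ Ioc (2 * i) (2 * j),
        x ^ (w * (j - i - 1)) * (1 - x ^ w) ^ 2 * F ((g + 1) / 2) =
      ∑ j ∈ Ico (i + 1) a, ∑ t ∈ Ioc i j,
        2 * F t * ((x ^ w) ^ (j - i - 1) * (1 - x ^ w) ^ 2) -
        if i + 1 < a then 2 * F (i + 1) * (1 - x ^ w) ^ 2 else 0 := by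
    intro i _
    have : ∀ j ∈ Ico (i + 2) a, ∑ g ∈ Ioc (2 * i) (2 * j),
        x ^ (w * (j - i - 1)) * (1 - x ^ w) ^ 2 * F ((g + 1) / 2) = ∑ t ∈ Ioc i j,
        2 * F t * ((x ^ w) ^ (j - i - 1) * (1 - x ^ w) ^ 2) := by
      intro j hj
      simp only [mem_Ico] at hj
      rw [← mul_sum, sum_Icc_half F (by omega), ← sum_mul, ← mul_sum, ← pow_mul]
      ring
    rw [sum_congr rfl this]
    split_ifs with h
    · rw [sum_eq_sum_Ico_succ_bot h]; simp
    · rw [Ico_eq_empty (by omega), Ico_eq_empty (by omega)]; simp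
  rw [sum_congr rfl h1, sum_sub_distrib]
  have h2 : ∑ i ∈ range a, (if i + 1 < a then 2 * F (i + 1) * (1 - x ^ w) ^ 2 else 0) =
      ∑ t ∈ Ico 1 a, 2 * F t * (1 - x ^ w) ^ 2 := by
    rw [← sum_filter, sum_Ico_eq_sum_range]
    refine sum_congr ?_ fun i _ => by rw [add_comm]
    ext i; simp; omega
  have h3 : ∑ i ∈ range a, ∑ j ∈ Ico (i + 1) a, ∑ t ∈ Ioc i j,
        2 * F t * ((x ^ w) ^ (j - i - 1) * (1 - x ^ w) ^ 2) =
      ∑ t ∈ Ico 1 a, ∑ i ∈ range t, ∑ j ∈ Ico t a,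
        2 * F t * ((x ^ w) ^ (j - i - 1) * (1 - x ^ w) ^ 2) := by
    have : ∀ i ∈ range a, ∑ j ∈ Ico (i + 1) a, ∑ t ∈ Ioc i j,
          2 * F t * ((x ^ w) ^ (j - i - 1) * (1 - x ^ w) ^ 2) =
        ∑ t ∈ Ico (i + 1) a, ∑ j ∈ Ico t a,
          2 * F t * ((x ^ w) ^ (j - i - 1) * (1 - x ^ w) ^ 2) := fun i _ =>
      sum_comm' (by intro j t; simp only [mem_Ico, mem_Ioc]; omega)
    rw [sum_congr rfl this]
    exact sum_comm' (by intro i t; simp only [mem_Ico, mem_range]; omega)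
  rw [h2, h3, ← sum_sub_distrib]
  refine sum_congr rfl fun t ht => ?_
  simp only [mem_Ico] at ht
  simp only [← mul_sum]
  rw [sum_pow_crossing, ← pow_mul, ← pow_mul]
  ring

/-- The sum over all possible additional edges, for fixed `L` and `R`, up to the factor that
comes from sinks and sources far from the additional edge. -/
theorem sum_levels {x : R} {N : ℕ} (hx : x ^ N = 0) {a : ℕ} (ha : 2 * N + 1 ≤ a) (b b' st sb : R)
    (flow : ℕ → R) (hbot : ∀ t, 1 ≤ t → t < N → flow t = b' + t * sb)
    (htop : ∀ c, 1 ≤ c → c < N → flow (a - c) = b + c * st) :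
    (∑ t ∈ Ico 1 a, ((1 + geomTail x N (a - t)) * (1 + geomTail x N t) *
          (flow t - 1 + parallelTerm x N) -
        (1 + geomTail x N t) * ((b + 1) * geomTail x N (a - t) +
          2 * ∑ m ∈ Ico 1 a, geomTail x N (max (a - t) m)) -
        (1 + geomTail x N (a - t)) * ((b' + 1) * geomTail x N t +
          2 * ∑ m ∈ Ico 1 a, geomTail x N (max t m)))) +
      ∑ t ∈ Ico 1 a, (1 + geomTail x N (a - t)) * (1 + geomTail x N t) * ∑ w ∈ Ico 1 N,
        (2 * ((1 - x ^ (w * t)) * (1 - x ^ (w * (a - t)))) - 2 * (1 - x ^ w) ^ 2) =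
    ∑ t ∈ Ico 1 a, flow t - (a - 1) - 12 * ∑ t ∈ Ico 1 a, (t : R) * geomTail x N t +
      (st + sb) * ∑ t ∈ Ico 1 a, (t : R) * geomTail x N t := by
  set u := geomTail x N with hu
  have u0 : ∀ {c}, N ≤ c → u c = 0 := fun h => geomTail_eq_zero hx h
  have uu : ∀ {c c' : ℕ}, a ≤ c + c' → u c * u c' = 0 := by
    intro c c' h
    rcases le_total N c with h1 | h1
    · rw [u0 h1, zero_mul]
    · rw [u0 (show N ≤ c' by omega), mul_zero]
  have refl : ∀ f : ℕ → R, ∑ t ∈ Ico 1 a, f (a - t) = ∑ t ∈ Ico 1 a, f t := by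
    intro f
    have := sum_Ico_reflect f 1 (show a ≤ a + 1 by omega)
    rw [add_tsub_cancel_left] at this
    simpa using this
  rw [← sum_add_distrib]
  -- Products u c * u c' with c + c' ≥ a vanish because a > 2 N, so each summand splits into its
  -- value far from the ends, a part in u (a - t) for the top and a part in u t for the bottom.
  -- `parallelTerm` cancels against the opposite term produced by the edges that skip floors.
  have key : ∀ t ∈ Ico 1 a, ((1 + u (a - t)) * (1 + u t) * (flow t - 1 + parallelTerm x N) -
        (1 + u t) * ((b + 1) * u (a - t) + 2 * ∑ m ∈ Ico 1 a, u (max (a - t) m)) -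
        (1 + u (a - t)) * ((b' + 1) * u t + 2 * ∑ m ∈ Ico 1 a, u (max t m))) +
      (1 + u (a - t)) * (1 + u t) * ∑ w ∈ Ico 1 N,
        (2 * ((1 - x ^ (w * t)) * (1 - x ^ (w * (a - t)))) - 2 * (1 - x ^ w) ^ 2) =
      flow t - 1 + (st * ((a - t : ℕ) * u (a - t)) - 4 * u (a - t) - 2 * u (a - t) ^ 2 -
        2 * ∑ m ∈ Ico 1 a, u (max (a - t) m)) + (sb * (t * u t) - 4 * u t - 2 * u t ^ 2 -
        2 * ∑ m ∈ Ico 1 a, u (max t m)) := by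
    intro t ht
    simp only [mem_Ico] at ht
    have e1 : ∑ w ∈ Ico 1 N,
        (2 * ((1 - x ^ (w * t)) * (1 - x ^ (w * (a - t)))) - 2 * (1 - x ^ w) ^ 2) =
        -2 * (u t + u (a - t)) - parallelTerm x N := by
      rw [hu, ← sum_Ico_pow_mul hx ht.1, ← sum_Ico_pow_mul hx (show 1 ≤ a - t by omega),
        ← sum_add_distrib, mul_sum, parallelTerm, ← sum_sub_distrib]
      refine sum_congr rfl fun w hw => ?_
      simp only [mem_Ico] at hw
      have : x ^ (w * t) * x ^ (w * (a - t)) = 0 := by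
        rw [← pow_add, ← mul_add]
        refine pow_eq_zero_of_ge hx ?_
        have : t + (a - t) = a := by omega
        rw [this]; nlinarith
      linear_combination 2 * this
    rw [e1]
    have e2 : u (a - t) * u t = 0 := uu (by omega)
    have e3 : u t * flow t = u t * (b' + t * sb) := by
      by_cases h : t < N
      · rw [hbot t ht.1 h]
      · rw [u0 (by omega)]; ring
    have e4 : u (a - t) * flow t = u (a - t) * (b + (a - t : ℕ) * st) := by
      by_cases h : a - t < N
      · rw [← htop (a - t) (by omega) h]; congr 2; omega
      · rw [u0 (by omega)]; ring
    have e5 : u t * ∑ m ∈ Ico 1 a, u (max (a - t) m) = 0 := by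
      rw [mul_sum]
      exact sum_eq_zero fun m _ => uu (by omega)
    have e6 : u (a - t) * ∑ m ∈ Ico 1 a, u (max t m) = 0 := by
      rw [mul_sum]
      exact sum_eq_zero fun m _ => uu (by omega)
    linear_combination e3 + e4 - 2 * e5 - 2 * e6 +
      (flow t - 1 - 2 * (u t + u (a - t)) - (b + 1) - (b' + 1) - 4) * e2
  rw [sum_congr rfl key, sum_add_distrib, sum_add_distrib]
  rw [refl fun c => st * ((c : ℕ) * u c) - 4 * u c - 2 * u c ^ 2 - 2 * ∑ m ∈ Ico 1 a, u (max c m)]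
  simp only [sum_sub_distrib, ← mul_sum]
  have h1 := sum_geomTail_sq hx (show N + 1 ≤ a by omega)
  have h2 := sum_sum_max (R := R) u a
  have h3 : ∑ t ∈ Ico 1 a, (2 * (t : R) - 1) * u t =
      2 * ∑ t ∈ Ico 1 a, (t : R) * u t - ∑ t ∈ Ico 1 a, u t := by
    rw [mul_sum, ← sum_sub_distrib]; exact sum_congr rfl fun t _ => by ring
  -- With E = ∑ t u_t, each end of the chain contributes -4 ∑ u - 2 (E - ∑ u) - 2 (2 E - ∑ u) = -6 E
  -- besides the term in `st` or `sb`. The two ends together give -12 E.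
  rw [h2, h3, h1]
  have h4 : ∑ t ∈ Ico 1 a, (1 : R) = a - 1 := by
    rw [sum_const, Nat.card_Ico, nsmul_eq_mul, Nat.cast_sub (by omega)]; simp
  rw [h4]
  ring

end Levels

end ToricRefined

namespace ToricRefined

open Finset

/-- If `pos` is a numbering of a finite set, then `k` elements have a number less than `k`. -/
theorem card_filter_pos_lt {α : Type*} [Fintype α] {M : ℕ} {pos : α → ℕ}
    (hinj : Function.Injective pos) (hlt : ∀ x, pos x < M) (hcard : Fintype.card α = M)
    {k : ℕ} (hk : k ≤ M) : #{y | pos y < k} = k := by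
  have himg : univ.image pos = range M := by
    refine eq_of_subset_of_card_le (fun k hk => ?_) ?_
    · simp only [mem_image, mem_univ, true_and] at hk
      obtain ⟨y, rfl⟩ := hk
      simpa using hlt y
    · rw [card_image_of_injective _ hinj, card_range, card_univ, hcard]
  have : (univ.filter fun y => pos y < k).image pos = range k := by
    ext j
    simp only [mem_image, mem_filter, mem_univ, true_and, mem_range]
    constructor
    · rintro ⟨y, h, rfl⟩; exact h
    · intro h
      have hj : j ∈ univ.image pos := by rw [himg]; simp; omega
      obtain ⟨y, -, rfl⟩ := mem_image.mp hj
      exact ⟨y, h, rfl⟩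
  rw [← card_image_of_injective _ hinj, this, card_range]

/-- An initial segment with respect to a numbering is determined by its cardinality. -/
theorem lt_card_iff_of_antitone {α : Type*} [Fintype α] {M : ℕ} {pos : α → ℕ}
    (hinj : Function.Injective pos) (hlt : ∀ x, pos x < M) (hcard : Fintype.card α = M)
    {p : α → Prop} [DecidablePred p] (hp : ∀ x y, pos x ≤ pos y → p y → p x) (x : α) :
    pos x < #{y | p y} ↔ p x := by
  have hc := fun k => card_filter_pos_lt hinj hlt hcard (k := k)
  constructor
  · intro h
    by_contra hx
    have hsub : (univ.filter fun y => p y) ⊆ univ.filter fun y => pos y < pos x := by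
      intro y
      simp only [mem_filter, mem_univ, true_and]
      intro hy
      by_contra hn
      exact hx (hp x y (by omega) hy)
    have := card_le_card hsub
    rw [hc _ (hlt x).le] at this
    omega
  · intro h
    have hsub : (univ.filter fun y => pos y < pos x + 1) ⊆ univ.filter fun y => p y := by
      intro y
      simp only [mem_filter, mem_univ, true_and]
      intro hy
      exact hp y x (by omega) h
    have := card_le_card hsub
    rw [hc _ (hlt x)] at this
    omega

/-! ### Binary words -/

section Words

/-- The number of pairs consisting of a letter `true` and a later letter `false`. -/
def wordInv {a : ℕ} (f : Fin a → Bool) : ℕ :=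
  ∑ u, ∑ v, if u < v ∧ f u = true ∧ f v = false then 1 else 0

/-- The number of letters `true`. -/
def wordCount {a : ℕ} (f : Fin a → Bool) : ℕ := ∑ u, if f u = true then 1 else 0

variable {R : Type*} [CommRing R]

/-- The generating series of inversions of the words of length `a` with `s` letters `true`. -/
def wordSum (x : R) (a s : ℕ) : R := ∑ f : Fin a → Bool with wordCount f = s, x ^ wordInv f

theorem wordCount_snoc {a : ℕ} (f : Fin a → Bool) (c : Bool) :
    wordCount (Fin.snoc (α := fun _ => Bool) f c) = wordCount f + if c = true then 1 else 0 := by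
  simp only [wordCount, Fin.sum_univ_castSucc, Fin.snoc_castSucc, Fin.snoc_last]

theorem wordInv_snoc {a : ℕ} (f : Fin a → Bool) (c : Bool) :
    wordInv (Fin.snoc (α := fun _ => Bool) f c) =
      wordInv f + if c = true then 0 else wordCount f := by
  have h : ∀ i : Fin a, ¬ Fin.last a < i.castSucc := fun i => by simp [Fin.le_last]
  simp only [wordInv, wordCount, Fin.sum_univ_castSucc, Fin.snoc_castSucc, Fin.snoc_last,
    Fin.castSucc_lt_castSucc_iff, Fin.castSucc_lt_last, lt_self_iff_false, h, true_and, false_and,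
    if_false, sum_const_zero, add_zero, sum_add_distrib]
  congr 1
  cases c <;> simp

/-- Pascal's rule for Gaussian binomial coefficients: the last letter is removed, and a final
`false` forms an inversion with each of the s + 1 letters `true`. -/
theorem wordSum_succ (x : R) (a s : ℕ) :
    wordSum x (a + 1) (s + 1) = wordSum x a s + x ^ (s + 1) * wordSum x a (s + 1) := by
  simp only [wordSum, sum_filter, mul_sum]
  rw [← (Fin.snocEquiv fun _ : Fin (a + 1) => Bool).sum_comp, Fintype.sum_prod_type,
    Fintype.sum_bool]
  have hc : ∀ (f : Fin a → Bool) (c : Bool), (Fin.snocEquiv fun _ : Fin (a + 1) => Bool) (c, f) =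
      Fin.snoc (α := fun _ => Bool) f c := fun _ _ => rfl
  simp only [hc, wordCount_snoc, wordInv_snoc]
  congr 1 <;> refine sum_congr rfl fun f _ => ?_
  · simp
  · by_cases h : wordCount f = s + 1
    · simp [h, pow_add, mul_comm]
    · simp [h]

theorem wordSum_zero (x : R) (a : ℕ) : wordSum x a 0 = 1 := by
  have h : (univ.filter fun f : Fin a → Bool => wordCount f = 0) = {fun _ => false} := by
    ext f
    simp [wordCount, funext_iff]
  rw [wordSum, h, sum_singleton]
  simp [wordInv]

theorem wordCount_le {a : ℕ} (f : Fin a → Bool) : wordCount f ≤ a := by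
  rw [wordCount]
  refine (sum_le_card_nsmul univ _ 1 fun u _ => ?_).trans (by simp)
  split_ifs <;> simp

theorem wordSum_of_lt (x : R) {a s : ℕ} (h : a < s) : wordSum x a s = 0 := by
  rw [wordSum, filter_eq_empty_iff.mpr, sum_empty]
  intro f _ hf
  have := wordCount_le f
  omega

/-- The product formula for Gaussian binomial coefficients, with denominators cleared so that it
holds in any commutative ring. -/
theorem wordSum_mul_prod (x : R) (s t : ℕ) :
    wordSum x (s + t) s * ∏ j ∈ range s, (1 - x ^ (j + 1)) =
      ∏ j ∈ range s, (1 - x ^ (t + j + 1)) := by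
  induction s generalizing t with
  | zero => simp [wordSum_zero]
  | succ s ihs =>
    induction t with
    | zero =>
      have h := ihs 0
      rw [show s + 1 + 0 = s + 1 by ring, wordSum_succ, wordSum_of_lt x (Nat.lt_succ_self s),
        prod_range_succ, mul_zero, add_zero, ← mul_assoc]
      rw [add_zero] at h
      rw [h, prod_range_succ, zero_add]
    | succ t iht =>
      have h := ihs (t + 1)
      rw [show s + 1 + (t + 1) = (s + (t + 1)) + 1 by ring, wordSum_succ, add_mul,
        prod_range_succ, ← mul_assoc, h]
      rw [show s + (t + 1) = s + 1 + t by ring, mul_assoc, ← prod_range_succ, iht,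
        prod_range_succ', prod_range_succ]
      have e : ∀ k, t + 1 + k + 1 = t + (k + 1) + 1 := fun k => by ring
      simp only [e]
      ring

/-- When both letters occur at least N times, the numerator of the Gaussian binomial coefficient is
1 and its denominator has stabilised, so the value is the partition series whatever a and s are. -/
theorem wordSum_eq {x : R} {N : ℕ} (hx : x ^ N = 0) {a s A : ℕ} (hs : N ≤ s) (ht : s + N ≤ a)
    (hA : N + 1 ≤ A) : wordSum x a s = geomProd x N A := by
  obtain ⟨t, rfl⟩ : ∃ t, a = s + t := ⟨a - s, by omega⟩
  have h1 := wordSum_mul_prod x s t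
  have h2 : ∏ j ∈ range s, (1 - x ^ (t + j + 1)) = 1 :=
    prod_eq_one fun j _ => by rw [pow_eq_zero_of_ge hx (by omega), sub_zero]
  have h3 : ∀ S, N ≤ S → ∏ j ∈ range S, (1 - x ^ (j + 1)) = ∏ j ∈ range N, (1 - x ^ (j + 1)) := by
    intro S hS
    refine (prod_subset (range_subset_range.mpr hS) fun j _ h => ?_).symm
    rw [mem_range, not_lt] at h
    rw [pow_eq_zero_of_ge hx (by omega), sub_zero]
  have h4 : (∏ j ∈ range (A - 1), (1 - x ^ (j + 1))) * geomProd x N A = 1 := by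
    rw [geomProd, prod_Ico_eq_prod_range, ← prod_mul_distrib]
    refine prod_eq_one fun j _ => ?_
    rw [add_comm 1 j]
    exact one_sub_mul_one_add_geomTail hx (by omega)
  rw [h2, h3 s hs] at h1
  rw [h3 _ (by omega)] at h4
  calc wordSum x (s + t) s = wordSum x (s + t) s * 1 := (mul_one _).symm
    _ = _ := by rw [← h4, ← mul_assoc, h1, one_mul]

/-- Each letter `false` after u is an inversion with u, so there are fewer than N of them. All other
later letters are `true` and are bounded by the count. -/
theorem lt_of_wordInv_lt {a N : ℕ} {f : Fin a → Bool} (h : wordInv f < N) {u : Fin a}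
    (hu : f u = true) : a < u + wordCount f + N := by
  have h1 : ∑ v, (if u < v ∧ f v = false then 1 else 0) ≤ wordInv f := by
    have := single_le_sum (f := fun u => ∑ v, if u < v ∧ f u = true ∧ f v = false then 1 else 0)
      (fun _ _ => Nat.zero_le _) (mem_univ u)
    simpa [hu, wordInv] using this
  have h2 : ∑ v, (if u < v ∧ f v = true then 1 else 0) + 1 ≤ wordCount f := by
    rw [wordCount, ← add_sum_erase _ _ (mem_univ u), if_neg (by simp), zero_add,
      ← add_sum_erase _ (fun v => if f v = true then 1 else 0) (mem_univ u), if_pos hu, add_comm]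
    gcongr with v
    split_ifs <;> simp_all
  have h3 : ∑ v, (if u < v ∧ f v = false then 1 else 0) +
      ∑ v, (if u < v ∧ f v = true then 1 else 0) = a - 1 - u := by
    rw [← sum_add_distrib]
    have : ∀ v, ((if u < v ∧ f v = false then 1 else 0) + if u < v ∧ f v = true then 1 else 0) =
        if u < v then 1 else 0 := by
      intro v; cases f v <;> simp
    simp only [this]
    rw [← card_filter, filter_lt_eq_Ioi, Fin.card_Ioi]
  omega

theorem lt_of_wordInv_lt' {a N : ℕ} {f : Fin a → Bool} (h : wordInv f < N) {u : Fin a}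
    (hu : f u = false) : u + wordCount f < a + N := by
  have h1 : ∑ v, (if v < u ∧ f v = true then 1 else 0) ≤ wordInv f := by
    have := single_le_sum (f := fun v => ∑ u, if u < v ∧ f u = true ∧ f v = false then 1 else 0)
      (fun _ _ => Nat.zero_le _) (mem_univ u)
    rw [wordInv, sum_comm]
    simpa [hu] using this
  have h2 : ∑ v, (if u < v ∧ f v = true then 1 else 0) ≤ a - 1 - u := by
    rw [← Fin.card_Ioi, ← filter_lt_eq_Ioi, card_filter]
    gcongr with v
    split_ifs <;> simp_all
  have h3 : ∑ v, (if v < u ∧ f v = true then 1 else 0) +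
      ∑ v, (if u < v ∧ f v = true then 1 else 0) = wordCount f := by
    rw [← sum_add_distrib, wordCount]
    refine sum_congr rfl fun v _ => ?_
    rcases lt_trichotomy u v with h | rfl | h
    · simp [h, h.not_gt]
    · simp [hu]
    · simp [h, h.not_gt]
  omega

/-- The number of pairs of a letter `true` and a later letter, counted in two ways. -/
theorem two_mul_sum_word {a : ℕ} (f : Fin a → Bool) :
    2 * ∑ u : Fin a, ((a : ℤ) - 1 - u) * (if f u = true then 1 else 0) =
      2 * wordInv f + wordCount f * (wordCount f - 1) := by
  induction a with
  | zero => simp [wordInv, wordCount]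
  | succ a ih =>
    obtain ⟨c, g, rfl⟩ : ∃ c g, f = Fin.snoc (α := fun _ => Bool) g c :=
      ⟨f (Fin.last a), Fin.init f, (Fin.snoc_init_self f).symm⟩
    have h := ih g
    rw [wordCount_snoc, wordInv_snoc, Fin.sum_univ_castSucc]
    simp only [Fin.snoc_castSucc, Fin.snoc_last, Fin.val_castSucc, Fin.val_last]
    have h2 : ∑ u : Fin a, (((a + 1 : ℕ) : ℤ) - 1 - (u : ℕ)) * (if g u = true then 1 else 0) =
        ∑ u : Fin a, ((a : ℤ) - 1 - (u : ℕ)) * (if g u = true then 1 else 0) + wordCount g := by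
      rw [wordCount]
      push_cast
      rw [← sum_add_distrib]
      exact sum_congr rfl fun u _ => by ring
    rw [h2, mul_add, mul_add, h]
    cases c <;> simp <;> ring

end Words

end ToricRefined

namespace ToricRefined

open Finset

/-! ### Orderings of the slopes and their inversions -/

section Slopes

/-- The total weight of the inversions of a sequence of integers. -/
def slopeInv {a : ℕ} (L : Fin a → ℤ) : ℕ := ∑ u, ∑ v, if u < v then (L u - L v).toNat else 0

/-- The positions at which a sequence is at least `k`. -/
def threshold {a : ℕ} (k : ℤ) (L : Fin a → ℤ) (u : Fin a) : Bool := decide (k ≤ L u)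

/-- The sequences of length `a` with values in `{k₀, …, k₀ + r}` such that, for `t = 1, …, r`, the
number of values at least `k₀ + t` is `m t`. -/
noncomputable def arrangements (a : ℕ) (k₀ : ℤ) (r : ℕ) (m : ℕ → ℕ) : Finset (Fin a → ℤ) :=
  (Fintype.piFinset fun _ : Fin a => Icc k₀ (k₀ + r)).filter
    fun L => ∀ t ∈ range r, wordCount (threshold (k₀ + (t + 1 : ℕ)) L) = m (t + 1)

variable {a : ℕ} {k₀ : ℤ} {r : ℕ} {m : ℕ → ℕ}

theorem mem_arrangements {L : Fin a → ℤ} : L ∈ arrangements a k₀ r m ↔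
    (∀ u, k₀ ≤ L u ∧ L u ≤ k₀ + r) ∧
      ∀ t < r, wordCount (threshold (k₀ + (t + 1 : ℕ)) L) = m (t + 1) := by
  simp [arrangements]

theorem card_threshold {l : ℤ} {r : ℕ} (h : l ≤ r) :
    ∑ t ∈ range r, (if ((t + 1 : ℕ) : ℤ) ≤ l then 1 else 0) = l.toNat := by
  rw [← card_filter]
  have : (range r).filter (fun t => ((t + 1 : ℕ) : ℤ) ≤ l) = range l.toNat := by
    ext t; simp; omega
  rw [this, card_range]

theorem eq_add_sum_threshold {L : Fin a → ℤ} {u : Fin a} (h : k₀ ≤ L u ∧ L u ≤ k₀ + r) :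
    L u = k₀ + ∑ t ∈ range r, if threshold (k₀ + (t + 1 : ℕ)) L u = true then 1 else 0 := by
  have h1 := card_threshold (l := L u - k₀) (r := r) (by omega)
  have h2 : ∀ t : ℕ, (threshold (k₀ + (t + 1 : ℕ)) L u = true) ↔ ((t + 1 : ℕ) : ℤ) ≤ L u - k₀ := by
    intro t; simp only [threshold, decide_eq_true_eq]; omega
  simp only [h2]
  have h3 := congrArg (Nat.cast : ℕ → ℤ) h1
  rw [Int.toNat_of_nonneg (by omega)] at h3
  push_cast at h3 ⊢
  rw [h3]; ring

/-- Layer by layer: a drop L u - L v is the number of thresholds that separate the two values. -/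
theorem slopeInv_eq_sum {L : Fin a → ℤ} (h : ∀ u, k₀ ≤ L u ∧ L u ≤ k₀ + r) :
    slopeInv L = ∑ t ∈ range r, wordInv (threshold (k₀ + (t + 1 : ℕ)) L) := by
  simp only [wordInv, slopeInv]
  rw [sum_comm (s := range r)]
  refine sum_congr rfl fun u _ => ?_
  rw [sum_comm (s := range r)]
  refine sum_congr rfl fun v _ => ?_
  by_cases huv : u < v
  · simp only [huv, if_true, true_and, threshold, decide_eq_true_eq, decide_eq_false_iff_not]
    rw [← card_filter]
    have hu := h u
    have hv := h v
    have : (range r).filter (fun t => k₀ + ((t + 1 : ℕ) : ℤ) ≤ L u ∧ ¬ k₀ + ((t + 1 : ℕ) : ℤ) ≤ L v) =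
        Ico (L v - k₀).toNat (L u - k₀).toNat := by
      ext t; simp only [mem_filter, mem_range, mem_Ico]; omega
    rw [this, Nat.card_Ico]
    omega
  · simp [huv]

/-- The sequence with given thresholds. -/
def ofThresholds (k₀ : ℤ) (F : Fin r → Fin a → Bool) (u : Fin a) : ℤ :=
  k₀ + ((univ.filter fun t => F t u = true).card : ℤ)

variable {R : Type*} [CommRing R]

/-- A sequence amounts to its r threshold words, and the inversions add up. These words have to be
nested, but words with fewer than N inversions in all are nested automatically, since their counts
differ by at least 2 N. Modulo x^N the words are therefore independent, and each contributes one
factor by `wordSum_eq`. -/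
theorem sum_arrangements {x : R} {N : ℕ} (hx : x ^ N = 0) {A : ℕ} (hA : N + 1 ≤ A)
    (hm : ∀ t, 1 ≤ t → t < r → m (t + 1) + 2 * N ≤ m t) (hm1 : 1 ≤ r → m 1 + N ≤ a)
    (hmr : 1 ≤ r → N ≤ m r) :
    ∑ L ∈ arrangements a k₀ r m, x ^ slopeInv L = geomProd x N A ^ r := by
  classical
  have mono : ∀ s t, 1 ≤ s → s ≤ t → t ≤ r → m t ≤ m s := by
    intro s t hs hst
    induction t, hst using Nat.le_induction with
    | base => simp
    | succ t hst ih =>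
      intro h
      have := hm t (by omega) (by omega)
      have := ih (by omega)
      omega
  have hprod : geomProd x N A ^ r = ∑ F ∈ Fintype.piFinset fun t : Fin r =>
      univ.filter fun f : Fin a → Bool => wordCount f = m (t + 1),
        x ^ ∑ t, wordInv (F t) := by
    have h1 : ∀ t : Fin r, geomProd x N A = wordSum x a (m (t + 1)) := by
      intro t
      have := t.2
      have := mono 1 (t + 1) le_rfl (by omega) (by omega)
      have := mono (t + 1) r (by omega) (by omega) le_rfl
      have := hm1 (by omega)
      have := hmr (by omega)
      exact (wordSum_eq hx (by omega) (by omega) hA).symm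
    calc geomProd x N A ^ r = ∏ t : Fin r, wordSum x a (m (t + 1)) := by
          rw [← prod_congr rfl fun t _ => h1 t]; simp
      _ = _ := by
          simp only [wordSum]
          rw [prod_univ_sum]
          simp only [prod_pow_eq_pow_sum]
  rw [hprod]
  rw [← sum_filter_add_sum_filter_not _ (fun L => slopeInv L < N),
    ← sum_filter_add_sum_filter_not (Fintype.piFinset _)
      (fun F : Fin r → Fin a → Bool => ∑ t, wordInv (F t) < N)]
  rw [sum_eq_zero (s := filter (fun L => ¬ slopeInv L < N) _),
    sum_eq_zero (s := filter (fun F : Fin r → Fin a → Bool => ¬ ∑ t, wordInv (F t) < N) _),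
    add_zero, add_zero]
  rotate_left
  · intro F hF
    exact pow_eq_zero_of_ge hx (by simpa using (mem_filter.mp hF).2)
  · intro F hF
    exact pow_eq_zero_of_ge hx (by simpa using (mem_filter.mp hF).2)
  have thr : ∀ F : Fin r → Fin a → Bool, (∀ t, wordCount (F t) = m (t + 1)) →
      ∑ t, wordInv (F t) < N → ∀ (t : Fin r) (u : Fin a),
        threshold (k₀ + ((t : ℕ) + 1 : ℕ)) (ofThresholds k₀ F) u = F t u := by
    intro F hc hF t u
    have hF' : ∀ t, wordInv (F t) < N := fun t =>
      (single_le_sum (f := fun t => wordInv (F t)) (fun _ _ => Nat.zero_le _) (mem_univ t)).trans_lt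
        hF
    have down : ∀ s t : Fin r, (s : ℕ) ≤ t → F t u = true → F s u = true := by
      intro s t hst ht
      rcases hst.eq_or_lt with h | h
      · rwa [Fin.ext h]
      by_contra hs
      have h1 := lt_of_wordInv_lt (hF' t) ht
      have h2 := lt_of_wordInv_lt' (hF' s) (by simpa using hs)
      have h3 := hm (s + 1) (by omega) (by omega)
      have h4 := mono (s + 1 + 1) (t + 1) (by omega) (by omega) (by omega)
      rw [hc] at h1 h2
      omega
    have key := lt_card_iff_of_antitone (α := Fin r) (M := r) (pos := fun t => (t : ℕ))
      Fin.val_injective (fun t => t.2) (by simp) (p := fun t => F t u = true) down t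
    have : (threshold (k₀ + ((t : ℕ) + 1 : ℕ)) (ofThresholds k₀ F) u = true) ↔ F t u = true := by
      rw [← key, threshold, decide_eq_true_eq, ofThresholds]
      omega
    exact Bool.eq_iff_iff.mpr this
  have range' : ∀ (F : Fin r → Fin a → Bool) u,
      k₀ ≤ ofThresholds k₀ F u ∧ ofThresholds k₀ F u ≤ k₀ + r := by
    intro F u
    have := card_le_univ (univ.filter fun t => F t u = true)
    rw [Fintype.card_fin] at this
    simp only [ofThresholds]
    omega
  have invF : ∀ F : Fin r → Fin a → Bool, (∀ t, wordCount (F t) = m (t + 1)) →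
      ∑ t, wordInv (F t) < N → slopeInv (ofThresholds k₀ F) = ∑ t, wordInv (F t) := by
    intro F hc hF
    rw [slopeInv_eq_sum (range' F), ← Fin.sum_univ_eq_sum_range
      fun t => wordInv (threshold (k₀ + (t + 1 : ℕ)) (ofThresholds k₀ F))]
    refine sum_congr rfl fun t _ => ?_
    congr 1
    funext u
    exact thr F hc hF t u
  refine sum_nbij' (fun L t => threshold (k₀ + ((t : ℕ) + 1 : ℕ)) L) (ofThresholds k₀) ?_ ?_ ?_ ?_ ?_
  · intro L hL
    simp only [mem_filter, mem_arrangements, Fintype.mem_piFinset, mem_univ, true_and] at hL ⊢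
    refine ⟨fun t => hL.1.2 t t.2, ?_⟩
    rw [Fin.sum_univ_eq_sum_range fun t => wordInv (threshold (k₀ + (t + 1 : ℕ)) L),
      ← slopeInv_eq_sum hL.1.1]
    exact hL.2
  · intro F hF
    simp only [mem_filter, mem_arrangements, Fintype.mem_piFinset, mem_univ, true_and] at hF ⊢
    refine ⟨⟨range' F, fun t ht => ?_⟩, by rw [invF F hF.1 hF.2]; exact hF.2⟩
    rw [← hF.1 ⟨t, ht⟩]
    congr 1
    funext u
    exact thr F hF.1 hF.2 ⟨t, ht⟩ u
  · intro L hL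
    simp only [mem_filter, mem_arrangements] at hL
    funext u
    rw [eq_add_sum_threshold (hL.1.1 u), ofThresholds, card_filter,
      Fin.sum_univ_eq_sum_range
        fun t => if threshold (k₀ + (t + 1 : ℕ)) L u = true then 1 else 0]
    push_cast
    rfl
  · intro F hF
    simp only [mem_filter, Fintype.mem_piFinset, mem_univ, true_and] at hF
    funext t u
    exact thr F hF.1 hF.2 t u
  · intro L hL
    simp only [mem_filter, mem_arrangements] at hL
    rw [Fin.sum_univ_eq_sum_range fun t => wordInv (threshold (k₀ + (t + 1 : ℕ)) L),
      ← slopeInv_eq_sum hL.1.1]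

/-- The number of inversions has the generating series `r E₂ p^r`. -/
theorem sum_arrangements_inv {x : R} {N : ℕ} (hx : x ^ N = 0) {A : ℕ} (hA : N + 1 ≤ A)
    (hm : ∀ t, 1 ≤ t → t < r → m (t + 1) + 2 * N ≤ m t) (hm1 : 1 ≤ r → m 1 + N ≤ a)
    (hmr : 1 ≤ r → N ≤ m r) :
    ∑ L ∈ arrangements a k₀ r m, x ^ slopeInv L * (slopeInv L : R) =
      geomProd x N A ^ r * (r * ∑ t ∈ Ico 1 A, (t : R) * geomTail x N t) := by
  -- The dual number x + x ε encodes the operator x d/dx. It is nilpotent of the same order as x, so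
  -- `sum_arrangements` applies to it, and the ε-parts are compared.
  have hpow : ∀ k : ℕ, dual x x ^ k = dual (x ^ k) (x ^ k * k) := by
    intro k
    induction k with
    | zero => simp [dual_one_zero]
    | succ k ih => rw [pow_succ, ih, dual_mul]; push_cast; congr 1 <;> ring
  have hN : dual x x ^ N = 0 := by rw [hpow, hx]; ext <;> simp
  have h := sum_arrangements hN hA hm hm1 hmr (k₀ := k₀)
  simp only [hpow] at h
  rw [sum_dual] at h
  have hg : ∀ t, 1 ≤ t → 1 + geomTail (dual x x) N t =
      dual (1 + geomTail x N t) ((1 + geomTail x N t) * (t * geomTail x N t)) := by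
    intro t ht
    have h1 := one_sub_mul_one_add_geomTail hN ht
    have h2 := one_sub_mul_one_add_geomTail hx ht
    have h3 := pow_mul_one_add_geomTail hx ht
    have h4 : (1 - dual x x ^ t) *
        dual (1 + geomTail x N t) ((1 + geomTail x N t) * (t * geomTail x N t)) = 1 := by
      have : (1 : DualNumber R) - dual x x ^ t = dual (1 - x ^ t) (-(x ^ t * t)) := by
        rw [hpow]; ext <;> simp
      rw [this, dual_mul, ← dual_one_zero]
      congr 1
      linear_combination (t * geomTail x N t) * h2 - (t : R) * h3
    exact eq_comm.mp (left_inv_eq_right_inv (by rw [mul_comm]; exact h4) h1)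
  have hP : geomProd (dual x x) N A =
      dual (geomProd x N A) (geomProd x N A * ∑ t ∈ Ico 1 A, (t : R) * geomTail x N t) := by
    rw [geomProd, prod_congr rfl fun t ht => hg t (mem_Ico.mp ht).1, prod_dual]
    rfl
  have hPr : ∀ (p q : R) (k : ℕ), dual p (p * q) ^ k = dual (p ^ k) (p ^ k * (k * q)) := by
    intro p q k
    induction k with
    | zero => simp [dual_one_zero]
    | succ k ih => rw [pow_succ, ih, dual_mul]; push_cast; congr 1 <;> ring
  rw [hP, hPr] at h
  simpa using congrArg TrivSqZeroExt.snd h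

/-- The values near the end of a sequence with few inversions. -/
theorem eq_top_of_slopeInv_lt {N : ℕ} {L : Fin a → ℤ} (hL : L ∈ arrangements a k₀ r m)
    (hmr : 1 ≤ r → 2 * N ≤ m r) (h : slopeInv L < N) {u : Fin a} (hu : a ≤ u + N) :
    L u = k₀ + r := by
  rw [mem_arrangements] at hL
  rcases Nat.eq_zero_or_pos r with hr | hr
  · subst hr
    have := hL.1 u
    simp at this ⊢; omega
  obtain ⟨q, rfl⟩ : ∃ q, r = q + 1 := ⟨r - 1, by omega⟩
  rw [slopeInv_eq_sum hL.1] at h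
  have h1 := (single_le_sum (f := fun t => wordInv (threshold (k₀ + (t + 1 : ℕ)) L))
    (fun _ _ => Nat.zero_le _) (mem_range.mpr (Nat.lt_succ_self q))).trans_lt h
  by_contra hne
  -- A value below the maximum is a letter `false` of the highest threshold word. So close to the
  -- end of the word it would be preceded by too many letters `true`.
  have h2 := lt_of_wordInv_lt' h1 (u := u) (by
    have := hL.1 u
    simp only [threshold, decide_eq_false_iff_not]; omega)
  rw [hL.2 q (by omega)] at h2
  have := hmr (by omega)
  omega

theorem eq_bot_of_slopeInv_lt {N : ℕ} {L : Fin a → ℤ} (hL : L ∈ arrangements a k₀ r m)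
    (hm1 : 1 ≤ r → m 1 + 2 * N ≤ a) (h : slopeInv L < N) {u : Fin a} (hu : u < N) :
    L u = k₀ := by
  rw [mem_arrangements] at hL
  rcases Nat.eq_zero_or_pos r with hr | hr
  · subst hr
    have := hL.1 u
    simp at this ⊢; omega
  rw [slopeInv_eq_sum hL.1] at h
  have h1 := (single_le_sum (f := fun t => wordInv (threshold (k₀ + (t + 1 : ℕ)) L))
    (fun _ _ => Nat.zero_le _) (mem_range.mpr hr)).trans_lt h
  by_contra hne
  have h2 := lt_of_wordInv_lt h1 (u := u) (by
    have := hL.1 u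
    simp only [threshold, decide_eq_true_eq]; omega)
  rw [hL.2 0 hr, zero_add] at h2
  have := hm1 hr
  omega

theorem sum_arrangement {L : Fin a → ℤ} (hL : L ∈ arrangements a k₀ r m) :
    ∑ u, L u = a * k₀ + ∑ t ∈ range r, (m (t + 1) : ℤ) := by
  rw [mem_arrangements] at hL
  rw [sum_congr rfl fun u _ => eq_add_sum_threshold (hL.1 u), sum_add_distrib, sum_comm]
  simp only [sum_const, card_univ, Fintype.card_fin, nsmul_eq_mul]
  congr 1
  refine sum_congr rfl fun t ht => ?_
  rw [← hL.2 t (mem_range.mp ht), wordCount]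
  push_cast
  rfl

/-- The same holds for each threshold word by `two_mul_sum_word`. As a consequence the total flow of
a diagram depends on the order of the slopes only through the number of inversions. -/
theorem two_mul_sum_arrangement {L : Fin a → ℤ} (hL : L ∈ arrangements a k₀ r m) :
    2 * ∑ u : Fin a, ((a : ℤ) - 1 - u) * L u =
      2 * slopeInv L + k₀ * (a * (a - 1)) + ∑ t ∈ range r, (m (t + 1) : ℤ) * (m (t + 1) - 1) := by
  rw [mem_arrangements] at hL
  have h1 : ∀ u ∈ univ, ((a : ℤ) - 1 - (u : Fin a)) * L u = ((a : ℤ) - 1 - (u : ℕ)) * k₀ +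
      ∑ t ∈ range r, ((a : ℤ) - 1 - (u : ℕ)) *
        (if threshold (k₀ + (t + 1 : ℕ)) L u = true then 1 else 0) := by
    intro u _
    conv_lhs => rw [eq_add_sum_threshold (hL.1 u), mul_add, mul_sum]
  rw [sum_congr rfl h1, sum_add_distrib, sum_comm, ← sum_mul, mul_add, mul_sum _ _ (2 : ℤ)]
  rw [sum_congr rfl fun t _ => two_mul_sum_word (threshold (k₀ + (t + 1 : ℕ)) L), sum_add_distrib,
    ← mul_sum, slopeInv_eq_sum hL.1]
  have h2 : 2 * ∑ u : Fin a, ((a : ℤ) - 1 - (u : ℕ)) = a * (a - 1) := by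
    clear h1 hL L
    induction a with
    | zero => simp
    | succ a ih =>
      rw [Fin.sum_univ_succ]
      have : ∀ u : Fin a, ((a + 1 : ℕ) : ℤ) - 1 - ((u.succ : Fin (a + 1)) : ℕ) = (a : ℤ) - 1 - (u : ℕ) := by
        intro u; push_cast [Fin.val_succ]; ring
      simp only [this]
      rw [mul_add, ih]; push_cast; simp; ring
  rw [← mul_assoc, h2]
  have h3 : ∑ t ∈ range r, ((wordCount (threshold (k₀ + (t + 1 : ℕ)) L) : ℤ) *
      (wordCount (threshold (k₀ + (t + 1 : ℕ)) L) - 1)) =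
      ∑ t ∈ range r, (m (t + 1) : ℤ) * (m (t + 1) - 1) :=
    sum_congr rfl fun t ht => by rw [hL.2 t (mem_range.mp ht)]
  rw [h3]
  push_cast
  ring

/-- Partial sums lie almost below the chord. -/
theorem mul_sum_le_of_slopeInv (L : Fin a → ℤ) (t : ℕ) (ht : t ≤ a) :
    (a : ℤ) * (∑ u : Fin a, if (u : ℕ) < t then L u else 0) ≤ t * ∑ u, L u + slopeInv L := by
  have hc : ∑ u : Fin a, (if (u : ℕ) < t then (1 : ℤ) else 0) = t := by
    rw [Fin.sum_univ_eq_sum_range (fun u => if u < t then (1 : ℤ) else 0), ← sum_filter, sum_const]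
    have : (range a).filter (· < t) = range t := by ext; simp; omega
    rw [this]; simp
  -- The difference is a sum of L u - L v over all u < t and all v. Pairs with both indices below t
  -- cancel by antisymmetry, and the remaining pairs satisfy u < v.
  have key : (a : ℤ) * (∑ u : Fin a, if (u : ℕ) < t then L u else 0) - t * ∑ u, L u =
      ∑ u : Fin a, ∑ v : Fin a, if (u : ℕ) < t ∧ ¬ (v : ℕ) < t then L u - L v else 0 := by
    have e1 : (a : ℤ) * (∑ u : Fin a, if (u : ℕ) < t then L u else 0) =
        ∑ u : Fin a, ∑ _v : Fin a, if (u : ℕ) < t then L u else 0 := by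
      simp [mul_sum]
    have e2 : t * ∑ u, L u = ∑ u : Fin a, ∑ v : Fin a, if (u : ℕ) < t then L v else 0 := by
      rw [← hc, sum_mul]
      refine sum_congr rfl fun u _ => ?_
      split_ifs <;> simp
    have e3 : ∑ u : Fin a, ∑ v : Fin a, (if (u : ℕ) < t ∧ (v : ℕ) < t then L u - L v else 0) = 0 := by
      have e4 : ∑ u : Fin a, ∑ v : Fin a, (if (u : ℕ) < t ∧ (v : ℕ) < t then L u - L v else 0) =
          - ∑ u : Fin a, ∑ v : Fin a, (if (u : ℕ) < t ∧ (v : ℕ) < t then L u - L v else 0) := by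
        conv_lhs => rw [sum_comm]
        rw [← sum_neg_distrib]
        refine sum_congr rfl fun u _ => ?_
        rw [← sum_neg_distrib]
        refine sum_congr rfl fun v _ => ?_
        split_ifs <;> omega
      omega
    suffices h : (a : ℤ) * (∑ u : Fin a, if (u : ℕ) < t then L u else 0) - t * ∑ u, L u =
        ∑ u : Fin a, ∑ v : Fin a, (if (u : ℕ) < t ∧ ¬ (v : ℕ) < t then L u - L v else 0) +
        ∑ u : Fin a, ∑ v : Fin a, (if (u : ℕ) < t ∧ (v : ℕ) < t then L u - L v else 0) by
      rw [h, e3, add_zero]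
    rw [e1, e2, ← sum_sub_distrib, ← sum_add_distrib]
    refine sum_congr rfl fun u _ => ?_
    rw [← sum_sub_distrib, ← sum_add_distrib]
    refine sum_congr rfl fun v _ => ?_
    by_cases h1 : (u : ℕ) < t <;> by_cases h2 : (v : ℕ) < t <;> simp [h1, h2]
  have bound : ∑ u : Fin a, ∑ v : Fin a,
      (if (u : ℕ) < t ∧ ¬ (v : ℕ) < t then L u - L v else 0) ≤ (slopeInv L : ℤ) := by
    rw [slopeInv]
    push_cast
    gcongr with u _ v _
    split_ifs with h1 h2 h2
    · exact Int.self_le_toNat _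
    · exact absurd (show u < v by rw [Fin.lt_def]; omega) h2
    · simp
    · simp
  linarith

end Slopes

end ToricRefined

namespace ToricRefined

open Finset

/-! ### Codes of floor diagrams that are close to a chain -/

/-- The data describing a marked floor diagram of genus `1` that consists of a chain
`v₀ e₀ v₁ e₁ ⋯` of `a` floors and `a - 1` edges, of an additional edge, and of sinks and sources.
The additional edge goes from the floor `i` to the floor `j`, has weight `w`, and is preceded by `g`
elements of the chain in the marking. Sinks are numbered from the last one to the first one, and
`sink` consists of the numbers of floors and bounded edges after each sink, and of the distances of
the floors to which they are attached to the last floor; `source` is defined symmetrically. -/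
@[ext]
structure Code (a b b' : ℕ) where
  L : Fin a → ℤ
  R : Fin a → ℤ
  i : ℕ
  j : ℕ
  g : ℕ
  w : ℕ
  sink : (Fin b → ℕ) × (Fin b → ℕ)
  source : (Fin b' → ℕ) × (Fin b' → ℕ)

/-- The total weight of the edges that cross the level below the floor `t`. -/
def levelFlow {a : ℕ} (b' : ℕ) (L R : Fin a → ℤ) (t : ℕ) : ℤ :=
  b' - ∑ u : Fin a, if (u : ℕ) < t then L u + R u else 0

theorem levelFlow_zero {a : ℕ} (b' : ℕ) (L R : Fin a → ℤ) : levelFlow b' L R 0 = b' := by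
  simp [levelFlow]

theorem levelFlow_succ {a : ℕ} (b' : ℕ) (L R : Fin a → ℤ) (v : Fin a) :
    levelFlow b' L R (v + 1) = levelFlow b' L R v - (L v + R v) := by
  have : ∀ u : Fin a, (if (u : ℕ) < v + 1 then L u + R u else 0) =
      (if (u : ℕ) < v then L u + R u else 0) + if u = v then L u + R u else 0 := by
    intro u
    rcases lt_trichotomy (u : ℕ) v with h | h | h
    · rw [if_pos (by omega), if_pos h, if_neg (by rw [Fin.ext_iff]; omega), add_zero]
    · rw [if_pos (by omega), if_neg (by omega), if_pos (Fin.ext h), zero_add]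
    · rw [if_neg (by omega), if_neg (by omega), if_neg (by rw [Fin.ext_iff]; omega), add_zero]
  simp only [levelFlow, this, sum_add_distrib, sum_ite_eq', mem_univ, if_true]
  ring

theorem levelFlow_top {a : ℕ} (b' : ℕ) (L R : Fin a → ℤ) :
    levelFlow b' L R a = b' - (∑ u, L u + ∑ u, R u) := by
  simp [levelFlow, sum_add_distrib]

/-- The number of ends that cross a level. -/
def crossing {b : ℕ} (d : Fin b → ℕ) (c : ℕ) : ℕ := ∑ s, if c ≤ d s then 1 else 0

namespace Code

variable {a b b' : ℕ} (κ : Code a b b')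

/-- The weight of the edge of the chain below the floor `t`. -/
def chainWeight (t : ℕ) : ℤ :=
  levelFlow b' κ.L κ.R t - crossing κ.sink.2 (a - t) - crossing κ.source.2 t -
    if κ.i < t ∧ t ≤ κ.j then κ.w else 0

/-- The codes of floor diagrams with given slopes. -/
structure Valid (ML MR : Multiset ℤ) : Prop where
  map_L : univ.val.map κ.L = ML
  map_R : univ.val.map κ.R = MR
  lt : κ.i < κ.j
  j_lt : κ.j < a
  lt_g : 2 * κ.i < κ.g
  g_le : κ.g ≤ 2 * κ.j
  -- Of two parallel edges the additional one is the later in the marking. This normal form makes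
  -- the code unique.
  parallel : κ.j = κ.i + 1 → κ.g = 2 * κ.j
  w_pos : 0 < κ.w
  -- The chain has 2 a - 1 elements. Read from its end, the additional edge comes after 2 a - 1 - g
  -- of them.
  sink_mem : κ.sink ∈ endSet b a (2 * a - 1 - κ.g)
  source_mem : κ.source ∈ endSet b' a κ.g
  chainWeight_pos : ∀ t, 1 ≤ t → t < a → 0 < κ.chainWeight t

/-- The position of the element number `c` of the chain, once the additional edge is inserted. -/
def shift (c : ℕ) : ℕ := if c < κ.g then c else c + 1

/-- The position of a floor or bounded edge. The last bounded edge is the additional one. -/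
def corePos : Fin a ⊕ Fin a → ℕ
  | .inl k => κ.shift (2 * k)
  | .inr e => if (e : ℕ) + 1 < a then κ.shift (2 * e + 1) else κ.g

theorem corePos_lt (hg : κ.g + 1 < 2 * a) (c : Fin a ⊕ Fin a) : κ.corePos c < 2 * a := by
  rcases c with k | e
  · simp only [corePos, shift]; have := k.2; split_ifs <;> omega
  · simp only [corePos, shift]; have := e.2; split_ifs <;> omega

theorem corePos_injective : Function.Injective κ.corePos := by
  intro c c'
  rcases c with k | e <;> rcases c' with k' | e' <;> simp only [corePos, shift] <;> intro h
  · congr 1; apply Fin.ext; split_ifs at h <;> omega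
  · exfalso; split_ifs at h <;> omega
  · exfalso; split_ifs at h <;> omega
  · congr 1; apply Fin.ext; have := e.2; have := e'.2; split_ifs at h <;> omega

theorem card_corePos_lt (hg : κ.g + 1 < 2 * a) {q : ℕ} (hq : q ≤ 2 * a) :
    #{c | κ.corePos c < q} = q :=
  card_filter_pos_lt κ.corePos_injective (κ.corePos_lt hg) (by simp; omega) hq

/-- This and the next statement translate the inequality defining `endSet`, which counts floors,
into a precedence of positions: a sink comes after its floor, a source before it. -/
theorem floorsBefore_sub (hg : κ.g + 1 < 2 * a) {r d : ℕ} (hd : d < a) :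
    floorsBefore (2 * a - 1 - κ.g) r ≤ d ↔ κ.shift (2 * (a - 1 - d)) < 2 * a - r := by
  simp only [floorsBefore, shift]
  split_ifs <;> omega

theorem floorsBefore_le {r d : ℕ} : floorsBefore κ.g r ≤ d ↔ r ≤ κ.shift (2 * d) := by
  simp only [floorsBefore, shift]
  split_ifs <;> omega

variable {κ}

theorem Valid.g_lt {ML MR : Multiset ℤ} (h : κ.Valid ML MR) : κ.g + 1 < 2 * a := by
  have := h.g_le; have := h.j_lt; omega

end Code

/-! ### Elements of floor diagrams -/

section Rank

variable {α K : Type*} [Fintype α] [LinearOrder K]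

/-- The numbering of a finite set in the order of an injective function. -/
noncomputable def rankEquiv (key : α → K) (hk : Function.Injective key) {T : ℕ}
    (h : Fintype.card α = T) : α ≃ Fin T :=
  letI := LinearOrder.lift' key hk
  (Fintype.orderIsoFinOfCardEq α h).symm.toEquiv

theorem rankEquiv_lt {key : α → K} {hk : Function.Injective key} {T : ℕ}
    {h : Fintype.card α = T} {x y : α} :
    rankEquiv key hk h x < rankEquiv key hk h y ↔ key x < key y := by
  let := LinearOrder.lift' key hk
  exact (Fintype.orderIsoFinOfCardEq α h).symm.lt_iff_lt

theorem val_eq_card_lt {T : ℕ} (e : α ≃ Fin T) (x : α) : (e x : ℕ) = #{y | e y < e x} := by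
  have : (univ.filter fun y => e y < e x).map e.toEmbedding = Iio (e x) := by
    ext k
    simp only [mem_map, mem_filter, mem_univ, true_and, Equiv.coe_toEmbedding, mem_Iio]
    constructor
    · rintro ⟨y, hy, rfl⟩; exact hy
    · intro h; exact ⟨e.symm k, by simpa using h, by simp⟩
  rw [← card_map, this, Fin.card_Iio]

/-- The number of an element is the number of elements with a smaller one, so a bijection that
respects the order of two numberings respects the numbers themselves. -/
theorem val_eq_of_lt_imp {β : Type*} {T T' : ℕ} (ψ : α ≃ β) (e : α ≃ Fin T) (e' : β ≃ Fin T')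
    (h : ∀ x y, e x < e y → e' (ψ x) < e' (ψ y)) (x : α) : (e' (ψ x) : ℕ) = e x := by
  have h1 : ∀ x y, e' (ψ x) < e' (ψ y) ↔ e x < e y := by
    intro x y
    refine ⟨fun hlt => ?_, h x y⟩
    rcases lt_trichotomy (e x) (e y) with h2 | h2 | h2
    · exact h2
    · rw [e.injective h2] at hlt; exact absurd hlt (lt_irrefl _)
    · exact absurd (h y x h2) hlt.not_gt
  have h3 := val_eq_card_lt (ψ.trans e') x
  simp only [Equiv.trans_apply, h1] at h3
  rw [h3, val_eq_card_lt e x]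

end Rank

namespace FloorDiagram

variable {n : ℕ} [NeZero n] {Δ : LatticePolygon n} (D : FloorDiagram Δ)

/-- The elements of a floor diagram as a sum type. -/
def elementEquiv : D.Element ≃
    (Fin Δ.height ⊕ Fin D.numBounded) ⊕ (Fin Δ.topLength ⊕ Fin Δ.bottomLength) where
  toFun
    | .floor v => .inl (.inl v)
    | .bounded e => .inl (.inr e)
    | .sink s => .inr (.inl s)
    | .source s => .inr (.inr s)
  invFun
    | .inl (.inl v) => .floor v
    | .inl (.inr e) => .bounded e
    | .inr (.inl s) => .sink s
    | .inr (.inr s) => .source s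
  left_inv x := by cases x <;> rfl
  right_inv x := by rcases x with (x | x) | (x | x) <;> rfl

noncomputable instance : Fintype D.Element := Fintype.ofEquiv _ D.elementEquiv.symm

theorem card_element : Fintype.card D.Element = D.numElements := by
  rw [Fintype.card_congr D.elementEquiv]
  simp [numElements]
  ring

/-- The floors and bounded edges. -/
def coreElement : Fin Δ.height ⊕ Fin D.numBounded → D.Element :=
  Sum.elim .floor .bounded

end FloorDiagram

/-- The number of floors and bounded edges that come before a given element. -/
def MarkedFloorDiagram.coreBefore {n : ℕ} [NeZero n] {Δ : LatticePolygon n} {g : ℕ}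
    (D : MarkedFloorDiagram Δ g) (x : D.Element) : ℕ :=
  #{c | D.marking (D.coreElement c) < D.marking x}

/-! ### The floor diagram with a given code -/

namespace Code

/-- The last index a - 1 is reserved for the additional edge; the smaller ones number the edges of
the chain. -/
theorem sum_chain {M : Type*} [AddCommMonoid M] {a : ℕ} (ha : 0 < a) (F : ℕ → M) (G : M) :
    ∑ e : Fin a, (if (e : ℕ) + 1 < a then F e else G) = ∑ k ∈ range (a - 1), F k + G := by
  obtain ⟨n, rfl⟩ : ∃ n, a = n + 1 := ⟨a - 1, by omega⟩
  rw [Fin.sum_univ_eq_sum_range (fun e => if e + 1 < n + 1 then F e else G), sum_range_succ,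
    if_neg (by omega), Nat.add_sub_cancel]
  congr 1
  exact sum_congr rfl fun k hk => if_pos (by simpa using hk)

theorem prod_chain {M : Type*} [CommMonoid M] {a : ℕ} (ha : 0 < a) (F : ℕ → M) (G : M) :
    ∏ e : Fin a, (if (e : ℕ) + 1 < a then F e else G) = (∏ k ∈ range (a - 1), F k) * G := by
  obtain ⟨n, rfl⟩ : ∃ n, a = n + 1 := ⟨a - 1, by omega⟩
  rw [Fin.prod_univ_eq_prod_range (fun e => if e + 1 < n + 1 then F e else G), prod_range_succ,
    if_neg (by omega), Nat.add_sub_cancel]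
  congr 1
  exact prod_congr rfl fun k hk => if_pos (by simpa using hk)

section Diagram

variable {n : ℕ} [NeZero n] {Δ : LatticePolygon n} {κ : Code Δ.height Δ.topLength Δ.bottomLength}

theorem crossing_succ {b : ℕ} (d : Fin b → ℕ) (c : ℕ) :
    crossing d c = crossing d (c + 1) + ∑ s, if d s = c then 1 else 0 := by
  simp only [crossing, ← sum_add_distrib]
  refine sum_congr rfl fun s _ => ?_
  split_ifs <;> omega

theorem crossing_eq_zero {b : ℕ} {d : Fin b → ℕ} {c : ℕ} (h : ∀ s, d s < c) : crossing d c = 0 :=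
  sum_eq_zero fun s _ => if_neg (by have := h s; omega)

theorem crossing_zero {b : ℕ} (d : Fin b → ℕ) : crossing d 0 = b := by simp [crossing]

/-- `chainWeight` is the flow through a level minus everything else that crosses it, so the balance
at v is the difference of the formulas for two consecutive levels. The first and the last floor need
no separate treatment, because the formula gives weight 0 at the levels 0 and a, at the latter by
`hbal`. -/
theorem Valid.divergence {a b b' : ℕ} {κ : Code a b b'} {ML MR : Multiset ℤ} (h : κ.Valid ML MR)
    (hbal : ∑ u, κ.L u + ∑ u, κ.R u = (b' : ℤ) - b) (v : Fin a) :
    ((∑ e : Fin a, if (if (e : ℕ) + 1 < a then (e : ℕ) + 1 else κ.j) = v then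
          (((if (e : ℕ) + 1 < a then (κ.chainWeight (e + 1)).toNat else κ.w) : ℕ) : ℤ) else 0) +
        ∑ s, if κ.source.2 s = v then 1 else 0) -
      ((∑ e : Fin a, if (if (e : ℕ) + 1 < a then (e : ℕ) else κ.i) = v then
          (((if (e : ℕ) + 1 < a then (κ.chainWeight (e + 1)).toNat else κ.w) : ℕ) : ℤ) else 0) +
        ∑ s, if a - 1 - κ.sink.2 s = v then 1 else 0) = κ.R v + κ.L v := by
  have hv := v.2
  have hsrc := (mem_endSet.mp h.source_mem).2.1
  have hsnk := (mem_endSet.mp h.sink_mem).2.1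
  have hw0 : κ.chainWeight 0 = 0 := by
    rw [chainWeight, levelFlow_zero, crossing_zero, Nat.sub_zero, crossing_eq_zero hsnk,
      if_neg (by omega)]
    simp
  have hwa : κ.chainWeight a = 0 := by
    rw [chainWeight, levelFlow_top, crossing_eq_zero hsrc, Nat.sub_self, crossing_zero,
      if_neg (by have := h.j_lt; omega)]
    rw [hbal]; simp
  have h1 : (∑ e : Fin a, if (if (e : ℕ) + 1 < a then (e : ℕ) + 1 else κ.j) = v then
          (((if (e : ℕ) + 1 < a then (κ.chainWeight (e + 1)).toNat else κ.w) : ℕ) : ℤ) else 0) =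
      κ.chainWeight v + if κ.j = v then (κ.w : ℤ) else 0 := by
    have : ∀ e : Fin a, (if (if (e : ℕ) + 1 < a then (e : ℕ) + 1 else κ.j) = v then
          (((if (e : ℕ) + 1 < a then (κ.chainWeight (e + 1)).toNat else κ.w) : ℕ) : ℤ) else 0) =
        if (e : ℕ) + 1 < a then (if (e : ℕ) + 1 = v then (κ.chainWeight (e + 1)).toNat else 0 : ℤ)
          else if κ.j = v then (κ.w : ℤ) else 0 := by
      intro e; split_ifs <;> simp_all
    rw [sum_congr rfl fun e _ => this e, sum_chain (by omega)
      fun e => (if e + 1 = (v : ℕ) then (κ.chainWeight (e + 1)).toNat else 0 : ℤ)]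
    congr 1
    rcases Nat.eq_zero_or_pos (v : ℕ) with h0 | h0
    · rw [h0, hw0]; simp
    · rw [sum_eq_single (v - 1 : ℕ)]
      · rw [if_pos (by omega), show (v : ℕ) - 1 + 1 = v by omega]
        exact Int.toNat_of_nonneg (h.chainWeight_pos v h0 hv).le
      · intro k _ hk; exact if_neg (by omega)
      · intro hk; simp at hk; omega
  have h2 : (∑ e : Fin a, if (if (e : ℕ) + 1 < a then (e : ℕ) else κ.i) = v then
          (((if (e : ℕ) + 1 < a then (κ.chainWeight (e + 1)).toNat else κ.w) : ℕ) : ℤ) else 0) =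
      κ.chainWeight (v + 1) + if κ.i = v then (κ.w : ℤ) else 0 := by
    have : ∀ e : Fin a, (if (if (e : ℕ) + 1 < a then (e : ℕ) else κ.i) = v then
          (((if (e : ℕ) + 1 < a then (κ.chainWeight (e + 1)).toNat else κ.w) : ℕ) : ℤ) else 0) =
        if (e : ℕ) + 1 < a then (if (e : ℕ) = v then (κ.chainWeight (e + 1)).toNat else 0 : ℤ)
          else if κ.i = v then (κ.w : ℤ) else 0 := by
      intro e; split_ifs <;> simp_all
    rw [sum_congr rfl fun e _ => this e, sum_chain (by omega)
      fun e => (if e = (v : ℕ) then (κ.chainWeight (e + 1)).toNat else 0 : ℤ)]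
    congr 1
    rw [sum_ite_eq' (range (a - 1)) (v : ℕ)]
    split_ifs with hva
    · rw [mem_range] at hva
      exact Int.toNat_of_nonneg (h.chainWeight_pos _ (by omega) (by omega)).le
    · rw [mem_range] at hva
      rw [show (v : ℕ) + 1 = a by omega, hwa]
  rw [h1, h2]
  simp only [chainWeight, levelFlow_succ]
  have e1 := crossing_succ κ.source.2 v
  have e2 := crossing_succ κ.sink.2 (a - (v + 1))
  rw [show a - ((v : ℕ) + 1) + 1 = a - v by omega] at e2
  have e3 : ∑ s, (if a - 1 - κ.sink.2 s = v then (1 : ℤ) else 0) =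
      ((∑ s, if κ.sink.2 s = a - (v + 1) then 1 else 0 : ℕ) : ℤ) := by
    push_cast
    refine sum_congr rfl fun s _ => ?_
    have := hsnk s
    exact if_congr (by omega) rfl rfl
  have e4 : ∑ s, (if κ.source.2 s = (v : ℕ) then (1 : ℤ) else 0) =
      ((∑ s, if κ.source.2 s = v then 1 else 0 : ℕ) : ℤ) := by push_cast; rfl
  have e5 : ((if κ.i < (v : ℕ) ∧ (v : ℕ) ≤ κ.j then κ.w else 0 : ℕ) : ℤ) + (if κ.i = v then κ.w else 0 : ℕ) =
      ((if κ.i < (v : ℕ) + 1 ∧ (v : ℕ) + 1 ≤ κ.j then κ.w else 0 : ℕ) : ℤ) +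
        (if κ.j = v then κ.w else 0 : ℕ) := by
    have := h.lt
    split_ifs <;> omega
  rw [e3, e4]
  push_cast at e1 e2 e5 ⊢
  have e1' := congrArg (Nat.cast : ℕ → ℤ) e1
  have e2' := congrArg (Nat.cast : ℕ → ℤ) e2
  push_cast at e1' e2'
  linarith

end Diagram

end Code

end ToricRefined

namespace ToricRefined

open Finset

namespace Code

variable {n : ℕ} [NeZero n] {Δ : LatticePolygon n} {κ : Code Δ.height Δ.topLength Δ.bottomLength}

/-- The floor diagram with a given code. -/
def toFloorDiagram (h : κ.Valid Δ.leftSlopes Δ.rightSlopes)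
    (hbal : ∑ u, κ.L u + ∑ u, κ.R u = (Δ.bottomLength : ℤ) - Δ.topLength) : FloorDiagram Δ where
  numBounded := Δ.height
  tail e := if (e : ℕ) + 1 < Δ.height then e else ⟨κ.i, h.lt.trans h.j_lt⟩
  head e := if he : (e : ℕ) + 1 < Δ.height then ⟨e + 1, he⟩ else ⟨κ.j, h.j_lt⟩
  sinkFloor s := ⟨Δ.height - 1 - κ.sink.2 s, by have := h.j_lt; omega⟩
  sourceFloor s := ⟨κ.source.2 s, (mem_endSet.mp h.source_mem).2.1 s⟩
  weight e := if (e : ℕ) + 1 < Δ.height then (κ.chainWeight (e + 1)).toNat else κ.w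
  weight_pos e := by
    split_ifs with he
    · have := h.chainWeight_pos (e + 1) (by omega) he; omega
    · exact h.w_pos
  L := κ.L
  R := κ.R
  map_L := h.map_L
  map_R := h.map_R
  divergence v := by
    rw [← h.divergence hbal v]
    congr 2
    all_goals
      refine sum_congr rfl fun e _ => if_congr ?_ rfl rfl
      rw [Fin.ext_iff]
      try split_ifs <;> rfl
  connected := by
    have hpos : 0 < Δ.height := by have := h.j_lt; omega
    have : Nonempty (Fin Δ.height) := ⟨⟨0, hpos⟩⟩
    refine SimpleGraph.Connected.mk ?_
    have key : ∀ (k : ℕ) (hk : k < Δ.height), (SimpleGraph.fromRel fun v w => ∃ e : Fin Δ.height,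
        (if (e : ℕ) + 1 < Δ.height then e else ⟨κ.i, h.lt.trans h.j_lt⟩) = v ∧
        (if he : (e : ℕ) + 1 < Δ.height then (⟨e + 1, he⟩ : Fin Δ.height) else ⟨κ.j, h.j_lt⟩) =
          w).Reachable ⟨0, hpos⟩ ⟨k, hk⟩ := by
      intro k
      induction k with
      | zero => intro _; rfl
      | succ k ih =>
        intro hk
        refine (ih (by omega)).trans (SimpleGraph.Adj.reachable ?_)
        rw [SimpleGraph.fromRel_adj]
        refine ⟨by simp, Or.inl ⟨⟨k, by omega⟩, ?_, ?_⟩⟩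
        · exact if_pos hk
        · exact dif_pos hk
    exact fun u v => (key u u.2).symm.trans (key v v.2)
  acyclic v hv := by
    have key : ∀ u w, Relation.TransGen (fun v w => ∃ e : Fin Δ.height,
        (if (e : ℕ) + 1 < Δ.height then e else ⟨κ.i, h.lt.trans h.j_lt⟩) = v ∧
        (if he : (e : ℕ) + 1 < Δ.height then (⟨e + 1, he⟩ : Fin Δ.height) else ⟨κ.j, h.j_lt⟩) =
          w) u w → u < w := by
      have hstep : ∀ u w : Fin Δ.height, (∃ e : Fin Δ.height,
          (if (e : ℕ) + 1 < Δ.height then e else ⟨κ.i, h.lt.trans h.j_lt⟩) = u ∧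
          (if he : (e : ℕ) + 1 < Δ.height then (⟨e + 1, he⟩ : Fin Δ.height) else ⟨κ.j, h.j_lt⟩) =
          w) → u < w := by
        rintro u w ⟨e, rfl, rfl⟩
        have := h.lt
        split_ifs <;> rw [Fin.lt_def] <;> simp <;> omega
      intro u w huw
      induction huw with
      | single h1 => exact hstep _ _ h1
      | tail _ h1 ih => exact ih.trans (hstep _ _ h1)
    exact lt_irrefl _ (key v v hv)

variable (h : κ.Valid Δ.leftSlopes Δ.rightSlopes)
  (hbal : ∑ u, κ.L u + ∑ u, κ.R u = (Δ.bottomLength : ℤ) - Δ.topLength)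

/-- The keys by which the elements of the floor diagram are ordered. -/
def key : (toFloorDiagram h hbal).Element → ℕ ×ₗ ℕ
  -- Odd first coordinates belong to floors and bounded edges, even ones to the gaps between them.
  -- Inside a gap the sources come first, and the sinks in decreasing order of s because they are
  -- numbered from the last one.
  | .floor v => toLex (2 * κ.corePos (.inl v) + 1, 0)
  | .bounded e => toLex (2 * κ.corePos (.inr e) + 1, 0)
  | .sink s => toLex (2 * (2 * Δ.height - κ.sink.1 s), Δ.bottomLength + (Δ.topLength - s))
  | .source s => toLex (2 * κ.source.1 s, s)

theorem key_coreElement (c : Fin Δ.height ⊕ Fin Δ.height) :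
    key h hbal ((toFloorDiagram h hbal).coreElement c) = toLex (2 * κ.corePos c + 1, 0) := by
  rcases c with c | c <;> rfl

theorem key_injective : Function.Injective (key h hbal) := by
  have inj := κ.corePos_injective
  intro x y
  rcases x with v | e | s | s <;> rcases y with v' | e' | s' | s' <;> intro hxy <;>
    have h1 := congrArg (fun z => (ofLex z).1) hxy <;>
    have h2 := congrArg (fun z => (ofLex z).2) hxy <;>
    simp only [key, ofLex_toLex] at h1 h2
  · exact congrArg _ (Sum.inl.inj (inj (by omega)))
  · exact absurd (inj (show κ.corePos (.inl v) = κ.corePos (.inr e') by omega)) (by simp)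
  · omega
  · omega
  · exact absurd (inj (show κ.corePos (.inr e) = κ.corePos (.inl v') by omega)) (by simp)
  · exact congrArg _ (Sum.inr.inj (inj (Nat.eq_of_mul_eq_mul_left two_pos (Nat.succ.inj h1))))
  · omega
  · omega
  · omega
  · omega
  · congr 1; apply Fin.ext; omega
  · omega
  · omega
  · omega
  · omega
  · congr 1; apply Fin.ext; omega

theorem key_lt_of_step {x y : (toFloorDiagram h hbal).Element}
    (hxy : (toFloorDiagram h hbal).Step x y) : key h hbal x < key h hbal y := by
  have hlt := h.lt_g
  have hle := h.g_le
  cases hxy with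
  | tail e =>
    have ht : ((toFloorDiagram h hbal).tail e : ℕ) =
        if (e : ℕ) + 1 < Δ.height then (e : ℕ) else κ.i :=
      apply_ite Fin.val _ _ _
    simp only [key, Prod.Lex.toLex_lt_toLex]
    left
    change 2 * κ.shift (2 * ((toFloorDiagram h hbal).tail e : ℕ)) + 1 <
      2 * (if (e : ℕ) + 1 < Δ.height then κ.shift (2 * e + 1) else κ.g) + 1
    rw [ht]
    simp only [shift]
    split_ifs <;> omega
  | head e =>
    have ht : ((toFloorDiagram h hbal).head e : ℕ) =
        if (e : ℕ) + 1 < Δ.height then (e : ℕ) + 1 else κ.j := by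
      simp only [toFloorDiagram]; split_ifs <;> rfl
    simp only [key, Prod.Lex.toLex_lt_toLex]
    left
    change 2 * (if (e : ℕ) + 1 < Δ.height then κ.shift (2 * e + 1) else κ.g) + 1 <
      2 * κ.shift (2 * ((toFloorDiagram h hbal).head e : ℕ)) + 1
    rw [ht]
    simp only [shift]
    split_ifs <;> omega
  | sink s =>
    simp only [key, Prod.Lex.toLex_lt_toLex]
    left
    have hs := mem_endSet.mp h.sink_mem
    have := (κ.floorsBefore_sub h.g_lt (hs.2.1 s)).mp (hs.2.2 s)
    simp only [corePos, toFloorDiagram]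
    omega
  | source s =>
    simp only [key, Prod.Lex.toLex_lt_toLex]
    left
    have hs := mem_endSet.mp h.source_mem
    have := (κ.floorsBefore_le).mp (hs.2.2 s)
    simp only [corePos, toFloorDiagram]
    omega

/-- The marked floor diagram with a given code. -/
noncomputable def toMarked : MarkedFloorDiagram Δ 1 where
  toFloorDiagram := toFloorDiagram h hbal
  genus_eq := by simp [FloorDiagram.genus, toFloorDiagram]
  marking := rankEquiv (key h hbal) (key_injective h hbal) (FloorDiagram.card_element _)
  increasing x y hxy := by
    rw [rankEquiv_lt]
    induction hxy with
    | single h1 => exact key_lt_of_step h hbal h1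
    | tail _ h1 ih => exact ih.trans (key_lt_of_step h hbal h1)

theorem toMarked_marking_lt {x y : (toMarked h hbal).Element} :
    (toMarked h hbal).marking x < (toMarked h hbal).marking y ↔ key h hbal x < key h hbal y :=
  rankEquiv_lt

theorem coreBefore_toMarked (x : (toMarked h hbal).Element) {q : ℕ} (hq : q ≤ 2 * Δ.height)
    (hx : (ofLex (key h hbal x)).1 = 2 * q ∨
      (ofLex (key h hbal x)) = (2 * q + 1, 0)) : (toMarked h hbal).coreBefore x = q := by
  rw [← card_corePos_lt κ h.g_lt hq]
  have : ∀ c : Fin Δ.height ⊕ Fin Δ.height,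
      (toMarked h hbal).marking ((toMarked h hbal).coreElement c) < (toMarked h hbal).marking x ↔
        κ.corePos c < q := by
    intro c
    rw [toMarked_marking_lt]
    have hk : key h hbal ((toMarked h hbal).coreElement c) = toLex (2 * κ.corePos c + 1, 0) :=
      key_coreElement h hbal c
    rw [hk, Prod.Lex.lt_iff]
    simp only [ofLex_toLex]
    rcases hx with hx | hx
    · rw [hx]; omega
    · rw [hx]; simp
  change #{c : Fin Δ.height ⊕ Fin Δ.height | (toMarked h hbal).marking
    ((toMarked h hbal).coreElement c) < (toMarked h hbal).marking x} = _
  exact congrArg card (filter_congr fun c _ => this c)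

theorem coreBefore_sink (s : Fin Δ.topLength) :
    (toMarked h hbal).coreBefore (.sink s) = 2 * Δ.height - κ.sink.1 s :=
  coreBefore_toMarked h hbal _ (by omega) (Or.inl rfl)

theorem coreBefore_source (s : Fin Δ.bottomLength) :
    (toMarked h hbal).coreBefore (.source s) = κ.source.1 s :=
  coreBefore_toMarked h hbal _ ((mem_endSet.mp h.source_mem).1.1 s).le (Or.inl rfl)

theorem coreBefore_bounded (e : Fin Δ.height) :
    (toMarked h hbal).coreBefore (.bounded e) = κ.corePos (.inr e) :=
  coreBefore_toMarked h hbal _ (κ.corePos_lt h.g_lt _).le (Or.inr rfl)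

end Code

/-! ### Isomorphic diagrams have the same code -/

namespace MarkedFloorDiagram.Iso

variable {n : ℕ} [NeZero n] {Δ : LatticePolygon n} {g : ℕ} {D D' : MarkedFloorDiagram Δ g}
  (f : Iso D D')

/-- The bijection between elements given by an isomorphism. -/
def onElements : D.Element → D'.Element
  | .floor v => .floor (f.onFloors v)
  | .bounded e => .bounded (f.onBounded e)
  | .sink s => .sink (f.onSinks s)
  | .source s => .source (f.onSources s)

theorem marking_onElements (x : D.Element) :
    (D'.marking (f.onElements x) : ℕ) = D.marking x := by
  cases x
  · exact f.marking_floor _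
  · exact f.marking_bounded _
  · exact f.marking_sink _
  · exact f.marking_source _

theorem marking_lt_iff {x y : D.Element} :
    D'.marking (f.onElements x) < D'.marking (f.onElements y) ↔ D.marking x < D.marking y := by
  rw [Fin.lt_def, Fin.lt_def, f.marking_onElements, f.marking_onElements]

theorem coreBefore_onElements (x : D.Element) :
    D'.coreBefore (f.onElements x) = D.coreBefore x := by
  unfold coreBefore
  refine (card_bij (fun c _ => (Equiv.sumCongr f.onFloors f.onBounded) c) ?_ ?_ ?_).symm
  · intro c hc
    simp only [mem_filter, mem_univ, true_and] at hc ⊢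
    rw [← f.marking_lt_iff] at hc
    rcases c with c | c <;> exact hc
  · intro c _ c' _ h; exact (Equiv.injective _) h
  · intro c hc
    refine ⟨(Equiv.sumCongr f.onFloors f.onBounded).symm c, ?_, by simp⟩
    simp only [mem_filter, mem_univ, true_and] at hc ⊢
    rw [← f.marking_lt_iff]
    rcases c with c | c
    · simpa [FloorDiagram.coreElement, onElements] using hc
    · simpa [FloorDiagram.coreElement, onElements] using hc

end MarkedFloorDiagram.Iso

theorem Fin.equiv_eq_of_lt {k : ℕ} (σ : Fin k ≃ Fin k) (h : ∀ s t, s < t → σ s < σ t) (s : Fin k) :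
    σ s = s :=
  Fin.ext (val_eq_of_lt_imp (Equiv.refl _) (Equiv.refl _) σ h s)

namespace Code

variable {n : ℕ} [NeZero n] {Δ : LatticePolygon n}

section

variable {κ : Code Δ.height Δ.topLength Δ.bottomLength}
  (h : κ.Valid Δ.leftSlopes Δ.rightSlopes)
  (hbal : ∑ u, κ.L u + ∑ u, κ.R u = (Δ.bottomLength : ℤ) - Δ.topLength)

theorem marking_floor_lt {v v' : Fin Δ.height} (hv : v < v') :
    (toMarked h hbal).marking (.floor v) < (toMarked h hbal).marking (.floor v') := by
  rw [toMarked_marking_lt]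
  simp only [key, Prod.Lex.toLex_lt_toLex, corePos, shift]
  rw [Fin.lt_def] at hv
  left
  split_ifs <;> omega

theorem marking_sink_lt {s s' : Fin Δ.topLength} (hs : s < s') :
    (toMarked h hbal).marking (.sink s') < (toMarked h hbal).marking (.sink s) := by
  rw [toMarked_marking_lt]
  simp only [key, Prod.Lex.toLex_lt_toLex]
  have := (mem_endSet.mp h.sink_mem).1.2 hs.le
  have h2 := (mem_endSet.mp h.sink_mem).1.1 s'
  rw [Fin.lt_def] at hs
  rcases this.eq_or_lt with h1 | h1
  · right; rw [h1]; refine ⟨rfl, ?_⟩; omega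
  · left; omega

theorem marking_source_lt {s s' : Fin Δ.bottomLength} (hs : s < s') :
    (toMarked h hbal).marking (.source s) < (toMarked h hbal).marking (.source s') := by
  rw [toMarked_marking_lt]
  simp only [key, Prod.Lex.toLex_lt_toLex]
  have := (mem_endSet.mp h.source_mem).1.2 hs.le
  rw [Fin.lt_def] at hs
  rcases this.eq_or_lt with h1 | h1
  · right; rw [h1]; exact ⟨rfl, hs⟩
  · left; omega

end

/-- In the diagram of a code, floors, sinks and sources are numbered compatibly with the marking, so
an isomorphism fixes each of them. The code is then read off from the incidences, the weights and
`coreBefore`, which are invariant. The only ambiguity is which bounded edge is the additional one.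
-/
theorem eq_of_iso {κ κ' : Code Δ.height Δ.topLength Δ.bottomLength}
    (h : κ.Valid Δ.leftSlopes Δ.rightSlopes) (h' : κ'.Valid Δ.leftSlopes Δ.rightSlopes)
    (hbal : ∑ u, κ.L u + ∑ u, κ.R u = (Δ.bottomLength : ℤ) - Δ.topLength)
    (hbal' : ∑ u, κ'.L u + ∑ u, κ'.R u = (Δ.bottomLength : ℤ) - Δ.topLength)
    (f : MarkedFloorDiagram.Iso (toMarked h hbal) (toMarked h' hbal')) : κ = κ' := by
  have hF : ∀ v, f.onFloors v = v := Fin.equiv_eq_of_lt _ fun v v' hv => by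
    by_contra hn
    have hlt : f.onFloors v' < f.onFloors v :=
      lt_of_le_of_ne (not_lt.mp hn) fun he => hv.ne' (f.onFloors.injective he)
    have h1 := marking_floor_lt h' hbal' hlt
    exact ((f.marking_lt_iff (x := .floor v') (y := .floor v)).mp h1).not_gt (marking_floor_lt h hbal hv)
  have hS : ∀ s, f.onSinks s = s := Fin.equiv_eq_of_lt _ fun v v' hv => by
    by_contra hn
    have hlt : f.onSinks v' < f.onSinks v :=
      lt_of_le_of_ne (not_lt.mp hn) fun he => hv.ne' (f.onSinks.injective he)
    have h1 := marking_sink_lt h' hbal' hlt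
    exact ((f.marking_lt_iff (x := .sink v) (y := .sink v')).mp h1).not_gt (marking_sink_lt h hbal hv)
  have hO : ∀ s, f.onSources s = s := Fin.equiv_eq_of_lt _ fun v v' hv => by
    by_contra hn
    have hlt : f.onSources v' < f.onSources v :=
      lt_of_le_of_ne (not_lt.mp hn) fun he => hv.ne' (f.onSources.injective he)
    have h1 := marking_source_lt h' hbal' hlt
    exact ((f.marking_lt_iff (x := .source v') (y := .source v)).mp h1).not_gt
      (marking_source_lt h hbal hv)
  have hij := h.lt
  have hja := h.j_lt
  have hij' := h'.lt
  have hja' := h'.j_lt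
  have htail : ∀ e, (((toMarked h' hbal').tail (f.onBounded e) : Fin Δ.height) : ℕ) =
      (toMarked h hbal).tail e := fun e => by rw [f.tail_comm, hF]
  have hhead : ∀ e, (((toMarked h' hbal').head (f.onBounded e) : Fin Δ.height) : ℕ) =
      (toMarked h hbal).head e := fun e => by rw [f.head_comm, hF]
  have tail1 : ∀ {κ : Code Δ.height Δ.topLength Δ.bottomLength} (h : κ.Valid Δ.leftSlopes
      Δ.rightSlopes) (hbal) (e : Fin Δ.height), ((toMarked h hbal).tail e : ℕ) =
        if (e : ℕ) + 1 < Δ.height then (e : ℕ) else κ.i := by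
    intro κ h hbal e
    exact apply_ite Fin.val _ _ _
  have head1 : ∀ {κ : Code Δ.height Δ.topLength Δ.bottomLength} (h : κ.Valid Δ.leftSlopes
      Δ.rightSlopes) (hbal) (e : Fin Δ.height), ((toMarked h hbal).head e : ℕ) =
        if (e : ℕ) + 1 < Δ.height then (e : ℕ) + 1 else κ.j := by
    intro κ h hbal e
    simp only [toMarked, toFloorDiagram]; split_ifs <;> rfl
  have hcore : ∀ e : Fin Δ.height, κ'.corePos (.inr (f.onBounded e)) = κ.corePos (.inr e) := by
    intro e
    exact (coreBefore_bounded h' hbal' _).symm.trans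
      ((f.coreBefore_onElements (.bounded e)).trans (coreBefore_bounded h hbal e))
  let φ : Fin Δ.height → Fin Δ.height := f.onBounded
  have hφ : Function.Injective φ := f.onBounded.injective
  set E : Fin Δ.height := ⟨Δ.height - 1, by omega⟩ with hE
  -- Otherwise the additional edge of κ goes to a chain edge from i to i + 1, and the chain edge
  -- number i of κ goes to the additional edge of κ'. Both additional edges are then parallel to the
  -- chain at the same level, and the normal form puts them after the chain edge, which contradicts
  -- the invariance of `corePos`.
  have hfE : φ E = E := by
    by_contra hne
    have hlast : ∀ e : Fin Δ.height, e ≠ E → (e : ℕ) + 1 < Δ.height := by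
      intro e he
      by_contra hn
      exact he (Fin.ext (by simp only [hE]; omega))
    have hnE : ¬ (E : ℕ) + 1 < Δ.height := by simp only [hE]; omega
    have h1 : (φ E : ℕ) = κ.i := by
      have := (tail1 h' hbal' (φ E)).symm.trans ((htail E).trans (tail1 h hbal E))
      rwa [if_pos (hlast _ hne), if_neg hnE] at this
    have h2 : (φ E : ℕ) + 1 = κ.j := by
      have := (head1 h' hbal' (φ E)).symm.trans ((hhead E).trans (head1 h hbal E))
      rwa [if_pos (hlast _ hne), if_neg hnE] at this
    set I : Fin Δ.height := ⟨κ.i, by omega⟩ with hI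
    have hIval : (I : ℕ) = κ.i := rfl
    have hIE : I ≠ E := fun h3 => by have := congrArg Fin.val h3; simp only [hI, hE] at this; omega
    have hI1 := hlast I hIE
    have h3 : φ I = E := by
      by_contra hn
      have := (tail1 h' hbal' (φ I)).symm.trans ((htail I).trans (tail1 h hbal I))
      rw [if_pos (hlast _ hn), if_pos hI1] at this
      exact hIE (hφ (Fin.ext (by omega)))
    have h4 : κ'.i = κ.i := by
      have := (tail1 h' hbal' (φ I)).symm.trans ((htail I).trans (tail1 h hbal I))
      rwa [h3, if_neg hnE, if_pos hI1] at this
    have h5 : κ'.j = κ.i + 1 := by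
      have := (head1 h' hbal' (φ I)).symm.trans ((hhead I).trans (head1 h hbal I))
      rwa [h3, if_neg hnE, if_pos hI1] at this
    have h6 := h.parallel (by omega)
    have h7 := h'.parallel (by omega)
    have h8 : κ'.corePos (.inr (φ I)) = κ.corePos (.inr I) := hcore I
    rw [h3] at h8
    simp only [corePos, shift, if_neg hnE, if_pos hI1] at h8
    split_ifs at h8 <;> omega
  have hnE : ¬ (E : ℕ) + 1 < Δ.height := by simp only [hE]; omega
  refine Code.ext ?_ ?_ ?_ ?_ ?_ ?_ ?_ ?_
  · funext v; have := f.L_comm v; rw [hF] at this; exact this.symm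
  · funext v; have := f.R_comm v; rw [hF] at this; exact this.symm
  · have := (tail1 h' hbal' (φ E)).symm.trans ((htail E).trans (tail1 h hbal E))
    rw [hfE, if_neg hnE, if_neg hnE] at this
    exact this.symm
  · have := (head1 h' hbal' (φ E)).symm.trans ((hhead E).trans (head1 h hbal E))
    rw [hfE, if_neg hnE, if_neg hnE] at this
    exact this.symm
  · have h8 : κ'.corePos (.inr (φ E)) = κ.corePos (.inr E) := hcore E
    rw [hfE] at h8
    simp only [corePos, if_neg hnE] at h8
    exact h8.symm
  · have h8 : (toMarked h' hbal').weight (φ E) = (toMarked h hbal).weight E := f.weight_comm E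
    rw [hfE] at h8
    simp only [toMarked, toFloorDiagram, if_neg hnE] at h8
    exact h8.symm
  · have m1 := mem_endSet.mp h.sink_mem
    have m2 := mem_endSet.mp h'.sink_mem
    refine Prod.ext ?_ ?_ <;> funext s
    · have := f.coreBefore_onElements (.sink s)
      simp only [MarkedFloorDiagram.Iso.onElements, hS] at this
      rw [coreBefore_sink, coreBefore_sink] at this
      have := m1.1.1 s; have := m2.1.1 s
      omega
    · have := congrArg Fin.val (f.sink_comm s)
      rw [hF, hS] at this
      simp only [toMarked, toFloorDiagram] at this
      have := m1.2.1 s; have := m2.2.1 s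
      omega
  · refine Prod.ext ?_ ?_ <;> funext s
    · have := f.coreBefore_onElements (.source s)
      simp only [MarkedFloorDiagram.Iso.onElements, hO] at this
      rw [coreBefore_source, coreBefore_source] at this
      exact this.symm
    · have := congrArg Fin.val (f.source_comm s)
      rw [hF, hO] at this
      simp only [toMarked, toFloorDiagram] at this
      exact this.symm

end Code

end ToricRefined

namespace ToricRefined

open Finset

/-! ### Flow through the levels, and the defect of a diagram -/

namespace MarkedFloorDiagram

variable {n : ℕ} [NeZero n] {Δ : LatticePolygon n} {g : ℕ} (D : MarkedFloorDiagram Δ g)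

theorem marking_floor_injective : Function.Injective fun v => D.marking (.floor v) :=
  fun v v' h => by simpa using D.marking.injective h

/-- The position of a floor among the floors, in the order of the marking. -/
noncomputable def floorRank : Fin Δ.height ≃ Fin Δ.height :=
  rankEquiv (fun v => D.marking (.floor v)) D.marking_floor_injective (by simp)

theorem floorRank_lt {v v' : Fin Δ.height} :
    D.floorRank v < D.floorRank v' ↔ D.marking (.floor v) < D.marking (.floor v') :=
  rankEquiv_lt

theorem marking_tail_lt (e : Fin D.numBounded) :
    D.marking (.floor (D.tail e)) < D.marking (.bounded e) :=
  D.increasing _ _ (.single (.tail e))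

theorem marking_lt_head (e : Fin D.numBounded) :
    D.marking (.bounded e) < D.marking (.floor (D.head e)) :=
  D.increasing _ _ (.single (.head e))

theorem marking_lt_sink (s : Fin Δ.topLength) :
    D.marking (.floor (D.sinkFloor s)) < D.marking (.sink s) :=
  D.increasing _ _ (.single (.sink s))

theorem marking_source_lt (s : Fin Δ.bottomLength) :
    D.marking (.source s) < D.marking (.floor (D.sourceFloor s)) :=
  D.increasing _ _ (.single (.source s))

/-- The position of the tail of a bounded edge. -/
noncomputable def tailRank (e : Fin D.numBounded) : ℕ := D.floorRank (D.tail e)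

/-- The position of the head of a bounded edge. -/
noncomputable def headRank (e : Fin D.numBounded) : ℕ := D.floorRank (D.head e)

/-- The position of the floor of a sink. -/
noncomputable def sinkRank (s : Fin Δ.topLength) : ℕ := D.floorRank (D.sinkFloor s)

/-- The position of the floor of a source. -/
noncomputable def sourceRank (s : Fin Δ.bottomLength) : ℕ := D.floorRank (D.sourceFloor s)

theorem tailRank_lt_headRank (e : Fin D.numBounded) : D.tailRank e < D.headRank e :=
  Fin.lt_def.mp (D.floorRank_lt.mpr ((D.marking_tail_lt e).trans (D.marking_lt_head e)))

theorem headRank_lt (e : Fin D.numBounded) : D.headRank e < Δ.height := (D.floorRank _).2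

theorem sinkRank_lt (s : Fin Δ.topLength) : D.sinkRank s < Δ.height := (D.floorRank _).2

theorem sourceRank_lt (s : Fin Δ.bottomLength) : D.sourceRank s < Δ.height := (D.floorRank _).2

/-- The left slopes in the order of the marking. -/
noncomputable def leftSeq : Fin Δ.height → ℤ := D.L ∘ D.floorRank.symm

/-- The right slopes in the order of the marking. -/
noncomputable def rightSeq : Fin Δ.height → ℤ := D.R ∘ D.floorRank.symm

theorem map_comp_equiv {k : ℕ} (f : Fin k → ℤ) (σ : Fin k ≃ Fin k) :
    univ.val.map (f ∘ σ) = univ.val.map f := by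
  have h : (univ : Finset (Fin k)).val.map σ = univ.val := by

    simp
  rw [← Multiset.map_map, h]

theorem map_leftSeq : univ.val.map D.leftSeq = Δ.leftSlopes :=
  (map_comp_equiv _ _).trans D.map_L

theorem map_rightSeq : univ.val.map D.rightSeq = Δ.rightSlopes :=
  (map_comp_equiv _ _).trans D.map_R

/-- The total weight of the edges that cross a level. -/
theorem flow_eq (t : ℕ) :
    (∑ e, if D.tailRank e < t ∧ t ≤ D.headRank e then (D.weight e : ℤ) else 0) +
        (∑ s, if D.sinkRank s < t then 1 else 0) + (∑ s, if t ≤ D.sourceRank s then 1 else 0) =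
      levelFlow Δ.bottomLength D.leftSeq D.rightSeq t := by
  have e1 : ∀ {ι : Type} [Fintype ι] (p : ι → Fin Δ.height) (w : ι → ℤ),
      ∑ v, (if (D.floorRank v : ℕ) < t then ∑ e, (if p e = v then w e else 0) else 0) =
        ∑ e, if (D.floorRank (p e) : ℕ) < t then w e else 0 := by
    intro ι _ p w
    have : ∀ v, (if (D.floorRank v : ℕ) < t then ∑ e, (if p e = v then w e else 0) else 0) =
        ∑ e, if p e = v then (if (D.floorRank v : ℕ) < t then w e else 0) else 0 := by
      intro v
      split_ifs <;> simp
    rw [sum_congr rfl fun v _ => this v, sum_comm]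
    refine sum_congr rfl fun e _ => ?_
    rw [sum_ite_eq]; simp
  -- The divergence conditions are added over the floors below the level; edges with both ends below
  -- it cancel.
  have h : ∑ v, (if (D.floorRank v : ℕ) < t then D.R v + D.L v else 0) =
      ∑ v, if (D.floorRank v : ℕ) < t then
        ((∑ e, if D.head e = v then (D.weight e : ℤ) else 0) +
          ∑ s, if D.sourceFloor s = v then 1 else 0) -
        ((∑ e, if D.tail e = v then (D.weight e : ℤ) else 0) +
          ∑ s, if D.sinkFloor s = v then 1 else 0) else 0 :=
    sum_congr rfl fun v _ => by rw [D.divergence v]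
  have e2 : ∀ (c : Prop) [Decidable c] (p q r s : ℤ), (if c then (p + q) - (r + s) else 0) =
      ((if c then p else 0) + (if c then q else 0)) -
        ((if c then r else 0) + (if c then s else 0)) := by
    intro c _ p q r s; split_ifs <;> simp
  simp only [e2, sum_sub_distrib, sum_add_distrib, e1] at h
  have e3 : ∑ u : Fin Δ.height, (if (u : ℕ) < t then D.leftSeq u + D.rightSeq u else 0) =
      ∑ v, (if (D.floorRank v : ℕ) < t then D.R v + D.L v else 0) := by
    rw [← D.floorRank.sum_comp]
    refine sum_congr rfl fun v _ => ?_
    simp [leftSeq, rightSeq, add_comm]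
  have e4 : ∑ s, (if t ≤ D.sourceRank s then (1 : ℤ) else 0) +
      ∑ s, (if (D.floorRank (D.sourceFloor s) : ℕ) < t then (1 : ℤ) else 0) = Δ.bottomLength := by
    rw [← sum_add_distrib]
    have : ∀ s, ((if t ≤ D.sourceRank s then (1 : ℤ) else 0) +
      if (D.floorRank (D.sourceFloor s) : ℕ) < t then (1 : ℤ) else 0) = 1 := by
      intro s; simp only [sourceRank]; split_ifs <;> omega
    simp [this]
  have e5 : ∑ e, (if D.tailRank e < t ∧ t ≤ D.headRank e then (D.weight e : ℤ) else 0) +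
      ∑ e, (if (D.floorRank (D.head e) : ℕ) < t then (D.weight e : ℤ) else 0) =
      ∑ e, (if (D.floorRank (D.tail e) : ℕ) < t then (D.weight e : ℤ) else 0) := by
    rw [← sum_add_distrib]
    refine sum_congr rfl fun e _ => ?_
    have := D.tailRank_lt_headRank e
    simp only [tailRank, headRank] at this ⊢
    split_ifs <;> omega
  rw [levelFlow, e3, h]
  have e6 : ∀ s, (if D.sinkRank s < t then (1 : ℤ) else 0) =
      if (D.floorRank (D.sinkFloor s) : ℕ) < t then 1 else 0 := fun s => rfl
  simp only [e6]
  linear_combination e4 + e5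

/-- The difference between the maximal total weight of bounded edges and the actual one. -/
noncomputable def defect : ℕ :=
  slopeInv D.leftSeq + slopeInv D.rightSeq +
    ((∑ e, D.weight e * (D.headRank e - D.tailRank e - 1)) +
      ∑ s, (Δ.height - 1 - D.sinkRank s) + ∑ s, D.sourceRank s)

/-- Double counting of crossings: an edge crosses one level for each step from its tail to its head,
a sink crosses the levels above its floor and a source those below it. -/
theorem sum_levelFlow : ∑ t ∈ Ico 1 Δ.height, levelFlow Δ.bottomLength D.leftSeq D.rightSeq t =
    (∑ e, D.weight e * (D.headRank e - D.tailRank e) +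
      ∑ s, (Δ.height - 1 - D.sinkRank s) + ∑ s, D.sourceRank s : ℕ) := by
  rw [sum_congr rfl fun t _ => (D.flow_eq t).symm, sum_add_distrib, sum_add_distrib, sum_comm,
    sum_comm (t := (univ : Finset (Fin Δ.topLength))),
    sum_comm (t := (univ : Finset (Fin Δ.bottomLength)))]
  push_cast
  congr 1
  congr 1
  · refine sum_congr rfl fun e _ => ?_
    have h1 := D.tailRank_lt_headRank e
    have h2 := D.headRank_lt e
    rw [← sum_filter, sum_const]
    have : (Ico 1 Δ.height).filter (fun t => D.tailRank e < t ∧ t ≤ D.headRank e) =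
        Ioc (D.tailRank e) (D.headRank e) := by
      ext t; simp only [mem_filter, mem_Ico, mem_Ioc]; omega
    rw [this, Nat.card_Ioc, nsmul_eq_mul, mul_comm]
  · refine sum_congr rfl fun s _ => ?_
    have h2 := D.sinkRank_lt s
    rw [← sum_filter, sum_const]
    have : (Ico 1 Δ.height).filter (fun t => D.sinkRank s < t) =
        Ioo (D.sinkRank s) Δ.height := by
      ext t; simp only [mem_filter, mem_Ico, mem_Ioo]; omega
    rw [this, Nat.card_Ioo, nsmul_eq_mul, mul_one]
    congr 1; omega
  · refine sum_congr rfl fun s _ => ?_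
    have h2 := D.sourceRank_lt s
    rw [← sum_filter, sum_const]
    have : (Ico 1 Δ.height).filter (fun t => t ≤ D.sourceRank s) =
        Ioc 0 (D.sourceRank s) := by
      ext t; simp only [mem_filter, mem_Ico, mem_Ioc]; omega
    rw [this, Nat.card_Ioc, nsmul_eq_mul, mul_one, Nat.sub_zero]

/-- In the count of crossings a bounded edge of weight w contributes w plus w times the number of
floors it skips. For the polygons considered later the right-hand side does not depend on the
diagram, so the defect determines the total weight. -/
theorem sum_weight_add_defect : (∑ e, (D.weight e : ℤ)) + D.defect =
    ∑ t ∈ Ico 1 Δ.height, levelFlow Δ.bottomLength D.leftSeq D.rightSeq t +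
      slopeInv D.leftSeq + slopeInv D.rightSeq := by
  rw [sum_levelFlow, defect]
  have : ∑ e, D.weight e * (D.headRank e - D.tailRank e) =
      ∑ e, D.weight e + ∑ e, D.weight e * (D.headRank e - D.tailRank e - 1) := by
    rw [← sum_add_distrib]
    refine sum_congr rfl fun e _ => ?_
    have h1 := D.tailRank_lt_headRank e
    obtain ⟨k, hk⟩ : ∃ k, D.headRank e - D.tailRank e = k + 1 :=
      ⟨D.headRank e - D.tailRank e - 1, by omega⟩
    rw [hk, Nat.add_sub_cancel]; ring
  rw [this]
  push_cast
  ring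

/-- Without an edge between the two consecutive floors, everything that crosses the level
contributes at least as much to the defect as to the flow. -/
theorem exists_chain_edge {N : ℕ} (hN : D.defect < N) {t : ℕ} (h1 : 1 ≤ t) (h2 : t < Δ.height)
    (hflow : (N : ℤ) ≤ levelFlow Δ.bottomLength D.leftSeq D.rightSeq t) :
    ∃ e, D.tailRank e + 1 = t ∧ D.headRank e = t := by
  by_contra! hne
  have hle : levelFlow Δ.bottomLength D.leftSeq D.rightSeq t ≤ (D.defect : ℤ) := by
    rw [← D.flow_eq t, defect]
    push_cast
    have e1 : ∑ e, (if D.tailRank e < t ∧ t ≤ D.headRank e then (D.weight e : ℤ) else 0) ≤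
        ∑ e, (D.weight e : ℤ) * ((D.headRank e - D.tailRank e - 1 : ℕ) : ℤ) := by
      refine sum_le_sum fun e _ => ?_
      split_ifs with h
      · have := hne e
        have h3 : 1 ≤ D.headRank e - D.tailRank e - 1 := by omega
        exact_mod_cast Nat.le_mul_of_pos_right _ h3
      · positivity
    have e2 : ∑ s, (if D.sinkRank s < t then (1 : ℤ) else 0) ≤
        ∑ s, ((Δ.height - 1 - D.sinkRank s : ℕ) : ℤ) := by
      refine sum_le_sum fun s _ => ?_
      split_ifs with h <;> omega
    have e3 : ∑ s, (if t ≤ D.sourceRank s then (1 : ℤ) else 0) ≤ ∑ s, (D.sourceRank s : ℤ) := by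
      refine sum_le_sum fun s _ => ?_
      split_ifs with h <;> omega
    have : (0 : ℤ) ≤ slopeInv D.leftSeq + slopeInv D.rightSeq := by positivity
    linarith
  omega

end MarkedFloorDiagram

/-! ### Genus 1: a chain of floors and one additional edge -/

namespace MarkedFloorDiagram

variable {n : ℕ} [NeZero n] {Δ : LatticePolygon n} (D : MarkedFloorDiagram Δ 1)

theorem numBounded_eq : D.numBounded = Δ.height := by
  have := D.genus_eq
  simp only [FloorDiagram.genus, Nat.cast_one] at this
  omega

/-- In genus 1 there are as many bounded edges as floors. One edge is chosen for each of the a - 1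
levels, and exactly one is left over. If it is parallel to a chain edge and not later in the
marking, the two are exchanged. -/
theorem exists_chain {N : ℕ} (hN : D.defect < N) (ha : 0 < Δ.height)
    (hflow : ∀ t, 1 ≤ t → t < Δ.height →
      (N : ℤ) ≤ levelFlow Δ.bottomLength D.leftSeq D.rightSeq t) :
    ∃ σ : Fin Δ.height ≃ Fin D.numBounded,
      (∀ k : Fin Δ.height, (k : ℕ) + 1 < Δ.height →
        D.tailRank (σ k) = k ∧ D.headRank (σ k) = k + 1) ∧
      ∀ k E : Fin Δ.height, (k : ℕ) + 1 < Δ.height → (E : ℕ) + 1 = Δ.height →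
        D.tailRank (σ E) = k → D.headRank (σ E) = k + 1 →
        D.marking (.bounded (σ k)) < D.marking (.bounded (σ E)) := by
  have hc : ∀ t : Fin Δ.height, ∃ e, (t : ℕ) + 1 < Δ.height →
      D.tailRank e = t ∧ D.headRank e = t + 1 := by
    intro t
    by_cases ht : (t : ℕ) + 1 < Δ.height
    · obtain ⟨e, h1, h2⟩ := D.exists_chain_edge hN (by omega) ht (hflow _ (by omega) ht)
      exact ⟨e, fun _ => ⟨by omega, h2⟩⟩
    · exact ⟨Fin.cast D.numBounded_eq.symm t, fun h => absurd h ht⟩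
  choose ch hch using hc
  obtain ⟨f, hf⟩ : ∃ f, ∀ t : Fin Δ.height, (t : ℕ) + 1 < Δ.height → ch t ≠ f := by
    by_contra! hn
    have hsub : (univ : Finset (Fin D.numBounded)) ⊆
        (univ.filter fun t : Fin Δ.height => (t : ℕ) + 1 < Δ.height).image ch := by
      intro f _
      obtain ⟨t, ht, rfl⟩ := hn f
      exact mem_image_of_mem _ (by simpa using ht)
    have h1 := card_le_card hsub
    have h2 := card_image_le (s := univ.filter fun t : Fin Δ.height => (t : ℕ) + 1 < Δ.height)
      (f := ch)
    have h3 : (univ.filter fun t : Fin Δ.height => (t : ℕ) + 1 < Δ.height) ⊆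
        univ.erase ⟨Δ.height - 1, by omega⟩ := by
      intro t ht
      simp only [mem_filter, mem_univ, true_and, mem_erase, and_true, ne_eq, Fin.ext_iff] at ht ⊢
      omega
    have h4 := card_le_card h3
    rw [card_erase_of_mem (mem_univ _)] at h4
    simp only [card_univ, Fintype.card_fin] at h1 h4
    have := D.numBounded_eq
    omega
  set F : Fin Δ.height → Fin D.numBounded :=
    fun t => if (t : ℕ) + 1 < Δ.height then ch t else f with hF
  have hinj : Function.Injective F := by
    intro t t' h
    simp only [hF] at h
    split_ifs at h with h1 h2 h2
    · apply Fin.ext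
      rw [← (hch t h1).1, ← (hch t' h2).1, h]
    · exact absurd h (hf t h1)
    · exact absurd h.symm (hf t' h2)
    · apply Fin.ext; omega
  have hbij : Function.Bijective F :=
    (Fintype.bijective_iff_injective_and_card F).mpr ⟨hinj, by simp [D.numBounded_eq]⟩
  set σ := Equiv.ofBijective F hbij with hσ
  have hσc : ∀ k : Fin Δ.height, (k : ℕ) + 1 < Δ.height →
        D.tailRank (σ k) = k ∧ D.headRank (σ k) = k + 1 := by
    intro k hk
    have : σ k = ch k := if_pos hk
    rw [this]; exact hch k hk
  set E : Fin Δ.height := ⟨Δ.height - 1, by omega⟩ with hE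
  have hEu : ∀ E' : Fin Δ.height, (E' : ℕ) + 1 = Δ.height → E' = E := fun E' h =>
    Fin.ext (by simp only [hE]; omega)
  by_cases hbad : ∃ k : Fin Δ.height, (k : ℕ) + 1 < Δ.height ∧ D.tailRank (σ E) = k ∧
      D.headRank (σ E) = k + 1 ∧ ¬ D.marking (.bounded (σ k)) < D.marking (.bounded (σ E))
  · obtain ⟨k, hk, hkt, hkh, hkm⟩ := hbad
    have hkE : k ≠ E := fun h => by have := congrArg Fin.val h; simp only [hE] at this; omega
    refine ⟨(Equiv.swap k E).trans σ, ?_, ?_⟩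
    · intro t ht
      rw [Equiv.trans_apply]
      rcases eq_or_ne t k with rfl | h1
      · rw [Equiv.swap_apply_left]; exact ⟨hkt, hkh⟩
      · rw [Equiv.swap_apply_of_ne_of_ne h1
          (fun h => by have := congrArg Fin.val h; simp only [hE] at this; omega)]
        exact hσc t ht
    · intro k' E' hk' hE' h1 h2
      rw [hEu E' hE'] at h1 h2 ⊢
      rw [Equiv.trans_apply, Equiv.swap_apply_right] at h1 h2
      have : k' = k := Fin.ext (by rw [← h1, (hσc k hk).1])
      subst this
      rw [Equiv.trans_apply, Equiv.trans_apply, Equiv.swap_apply_left, Equiv.swap_apply_right]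
      refine lt_of_le_of_ne (not_lt.mp hkm) fun h => hkE ?_
      have h3 := D.marking.injective h
      simp only [FloorDiagram.Element.bounded.injEq] at h3
      exact (σ.injective h3).symm
  · push Not at hbad
    refine ⟨σ, hσc, fun k E' hk hE' h1 h2 => ?_⟩
    rw [hEu E' hE'] at h1 h2 ⊢
    exact hbad k hk h1 h2

end MarkedFloorDiagram

end ToricRefined

namespace ToricRefined

open Finset

theorem Code.cast_crossing {b : ℕ} (d : Fin b → ℕ) (c : ℕ) :
    (crossing d c : ℤ) = ∑ s, if c ≤ d s then 1 else 0 := by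
  simp [crossing]

/-! ### The code of a chain-like diagram -/

namespace MarkedFloorDiagram

variable {n : ℕ} [NeZero n] {Δ : LatticePolygon n} (D : MarkedFloorDiagram Δ 1)
  (σ : Fin Δ.height ≃ Fin D.numBounded)

/-- The sinks, from the last to the first. -/
noncomputable def sinkNumbering : Fin Δ.topLength ≃ Fin Δ.topLength :=
  (rankEquiv (fun s => OrderDual.toDual (D.marking (.sink s)))
    (fun s s' h => by simpa using D.marking.injective (OrderDual.toDual.injective h))
    (by simp)).symm

theorem sinkNumbering_lt {s s' : Fin Δ.topLength} (h : s < s') :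
    D.marking (.sink (D.sinkNumbering s')) < D.marking (.sink (D.sinkNumbering s)) := by
  have hk : Function.Injective fun s => OrderDual.toDual (D.marking (.sink s)) :=
    fun s s' h => by simpa using D.marking.injective (OrderDual.toDual.injective h)
  rw [← OrderDual.toDual_lt_toDual]
  refine (rankEquiv_lt (hk := hk) (h := Fintype.card_fin _)).mp ?_
  simpa [sinkNumbering] using h

/-- The sources, from the first to the last. -/
noncomputable def sourceNumbering : Fin Δ.bottomLength ≃ Fin Δ.bottomLength :=
  (rankEquiv (fun s => D.marking (.source s))
    (fun s s' h => by simpa using D.marking.injective h) (by simp)).symm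

theorem sourceNumbering_lt {s s' : Fin Δ.bottomLength} (h : s < s') :
    D.marking (.source (D.sourceNumbering s)) < D.marking (.source (D.sourceNumbering s')) := by
  have hk : Function.Injective fun s => D.marking (.source s) :=
    fun s s' h => by simpa using D.marking.injective h
  refine (rankEquiv_lt (hk := hk) (h := Fintype.card_fin _)).mp ?_
  simpa [sourceNumbering] using h

/-- The floors and bounded edges, numbered along the chain. -/
noncomputable def coreNumbering : Fin Δ.height ⊕ Fin Δ.height ≃ Fin Δ.height ⊕ Fin D.numBounded :=
  Equiv.sumCongr D.floorRank.symm σ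

/-- The marking of a numbered floor or bounded edge. -/
noncomputable def coreMark (c : Fin Δ.height ⊕ Fin Δ.height) : Fin D.numElements :=
  D.marking (D.coreElement (D.coreNumbering σ c))

theorem coreElement_injective : Function.Injective D.coreElement := by
  rintro (c | c) (c' | c') h <;> simp_all [FloorDiagram.coreElement]

theorem coreMark_injective : Function.Injective (D.coreMark σ) :=
  D.marking.injective.comp (D.coreElement_injective.comp (D.coreNumbering σ).injective)

theorem coreBefore_eq (x : D.Element) :
    D.coreBefore x = #{c | D.coreMark σ c < D.marking x} := by
  unfold coreBefore
  refine (card_bij (fun c _ => D.coreNumbering σ c) ?_ ?_ ?_).symm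
  · intro c hc; exact mem_filter.mpr ⟨mem_univ _, (mem_filter.mp hc).2⟩
  · intro c _ c' _ h; exact (D.coreNumbering σ).injective h
  · intro c hc
    refine ⟨(D.coreNumbering σ).symm c, mem_filter.mpr ⟨mem_univ _, ?_⟩, by simp⟩
    rw [coreMark, Equiv.apply_symm_apply]
    exact (mem_filter.mp hc).2

theorem coreBefore_mono {x y : D.Element} (h : D.marking x ≤ D.marking y) :
    D.coreBefore x ≤ D.coreBefore y :=
  card_le_card fun c hc => by
    simp only [mem_filter, mem_univ, true_and] at hc ⊢
    exact hc.trans_le h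

theorem coreBefore_le (x : D.Element) : D.coreBefore x ≤ 2 * Δ.height :=
  (card_le_univ _).trans (by simp [D.numBounded_eq]; omega)

/-- The position along the chain. -/
def chainPos {a : ℕ} : Fin a ⊕ Fin a → ℕ :=
  Sum.elim (fun k => 2 * (k : ℕ)) fun e => 2 * (e : ℕ) + 1

theorem chainPos_injective {a : ℕ} : Function.Injective (chainPos (a := a)) := by
  rintro (k | k) (k' | k') h <;> simp only [chainPos, Sum.elim_inl, Sum.elim_inr] at h
  · exact congrArg _ (Fin.ext (by omega))
  · omega
  · omega
  · exact congrArg _ (Fin.ext (by omega))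

theorem chainPos_lt {a : ℕ} (c : Fin a ⊕ Fin a) : chainPos c < 2 * a := by
  rcases c with k | k <;> simp only [chainPos, Sum.elim_inl, Sum.elim_inr] <;> omega

variable (ha : 0 < Δ.height)

/-- The additional edge. -/
def extraEdge : Fin D.numBounded := σ ⟨Δ.height - 1, by omega⟩

/-- The code of a marked floor diagram. -/
noncomputable def code : Code Δ.height Δ.topLength Δ.bottomLength where
  L := D.leftSeq
  R := D.rightSeq
  i := D.tailRank (D.extraEdge σ ha)
  j := D.headRank (D.extraEdge σ ha)
  g := D.coreBefore (.bounded (D.extraEdge σ ha))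
  w := D.weight (D.extraEdge σ ha)
  sink := (fun s => 2 * Δ.height - D.coreBefore (.sink (D.sinkNumbering s)),
    fun s => Δ.height - 1 - D.sinkRank (D.sinkNumbering s))
  source := (fun s => D.coreBefore (.source (D.sourceNumbering s)),
    fun s => D.sourceRank (D.sourceNumbering s))

/-- The floors of the diagram form a chain. -/
structure IsChain : Prop where
  pos : 0 < Δ.height
  chain : ∀ k : Fin Δ.height, (k : ℕ) + 1 < Δ.height →
    D.tailRank (σ k) = k ∧ D.headRank (σ k) = k + 1
  parallel : ∀ k E : Fin Δ.height, (k : ℕ) + 1 < Δ.height → (E : ℕ) + 1 = Δ.height →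
    D.tailRank (σ E) = k → D.headRank (σ E) = k + 1 →
    D.marking (.bounded (σ k)) < D.marking (.bounded (σ E))
  -- A code does not record the relative order of sources and sinks lying in the same gap. Here all
  -- sources precede all sinks, so nothing is lost.
  source_lt_sink : ∀ s s', D.sourceRank s < D.sinkRank s'

variable {D σ ha} (hD : D.IsChain σ)

theorem coreMark_floor_lt {k k' : Fin Δ.height} (h : k < k') :
    D.coreMark σ (.inl k) < D.coreMark σ (.inl k') :=
  D.floorRank_lt.mp (by simpa using h)

theorem coreMark_floor_le {k k' : Fin Δ.height} (h : k ≤ k') :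
    D.coreMark σ (.inl k) ≤ D.coreMark σ (.inl k') := by
  rcases h.eq_or_lt with rfl | h
  · exact le_rfl
  · exact (coreMark_floor_lt h).le

theorem coreMark_tail {e : Fin Δ.height} {k : Fin Δ.height} (h : D.tailRank (σ e) = k) :
    D.coreMark σ (.inl k) < D.coreMark σ (.inr e) := by
  have : k = D.floorRank (D.tail (σ e)) := Fin.ext h.symm
  subst this
  simpa [coreMark, coreNumbering, FloorDiagram.coreElement] using D.marking_tail_lt (σ e)

theorem coreMark_head {e : Fin Δ.height} {k : Fin Δ.height} (h : D.headRank (σ e) = k) :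
    D.coreMark σ (.inr e) < D.coreMark σ (.inl k) := by
  have : k = D.floorRank (D.head (σ e)) := Fin.ext h.symm
  subst this
  simpa [coreMark, coreNumbering, FloorDiagram.coreElement] using D.marking_lt_head (σ e)

namespace IsChain

include hD

theorem coreMark_lt {c c' : Fin Δ.height ⊕ Fin Δ.height} (h : chainPos c < chainPos c')
    (hc' : chainPos c' + 1 < 2 * Δ.height) : D.coreMark σ c < D.coreMark σ c' := by
  rcases c with k | e <;> rcases c' with k' | e' <;>
    simp only [chainPos, Sum.elim_inl, Sum.elim_inr] at h hc'
  · exact coreMark_floor_lt (Fin.lt_def.mpr (by omega))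
  · exact (coreMark_floor_le (Fin.le_def.mpr (by omega))).trans_lt
      (coreMark_tail (hD.chain e' (by omega)).1)
  · exact (coreMark_head (k := ⟨e + 1, by omega⟩) (hD.chain e (by omega)).2).trans_le
      (coreMark_floor_le (Fin.le_def.mpr (by simp; omega)))
  · exact (coreMark_head (k := ⟨e + 1, by omega⟩) (hD.chain e (by omega)).2).trans_le
      ((coreMark_floor_le (Fin.le_def.mpr (by simp; omega))).trans
      (coreMark_tail (hD.chain e' (by omega)).1).le)

/-- Floors and chain edges are marked in the order of the chain, so those that precede the
additional edge form an initial segment. Its length is g, and a segment is determined by its length.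
-/
theorem chainPos_lt_coreBefore (c : Fin Δ.height ⊕ Fin Δ.height) :
    chainPos c < (D.code σ ha).g ↔
      D.coreMark σ c < D.coreMark σ (.inr ⟨Δ.height - 1, by omega⟩) := by
  have : (D.code σ ha).g = _ := D.coreBefore_eq σ (.bounded (D.extraEdge σ ha))
  rw [this]
  refine lt_card_iff_of_antitone chainPos_injective chainPos_lt (by simp; omega)
    (p := fun c => D.coreMark σ c < D.coreMark σ (.inr ⟨Δ.height - 1, by omega⟩)) ?_ c
  intro x y hxy hy
  by_cases hlast : chainPos y + 1 < 2 * Δ.height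
  · rcases hxy.eq_or_lt with h | h
    · rwa [chainPos_injective h]
    · exact (hD.coreMark_lt h hlast).trans hy
  · have : y = .inr ⟨Δ.height - 1, by omega⟩ := by
      apply chainPos_injective
      have := chainPos_lt y
      simp only [chainPos, Sum.elim_inr] at this hlast ⊢
      omega
    rw [this] at hy
    exact absurd hy (lt_irrefl _)

theorem code_lt_g : 2 * (D.code σ ha).i < (D.code σ ha).g :=
  (hD.chainPos_lt_coreBefore (ha := ha)
    (.inl (D.floorRank (D.tail (D.extraEdge σ ha))))).mpr (coreMark_tail rfl)

theorem code_g_le : (D.code σ ha).g ≤ 2 * (D.code σ ha).j := by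
  have h1 := (hD.chainPos_lt_coreBefore (ha := ha)
    (.inl (D.floorRank (D.head (D.extraEdge σ ha))))).not.mpr
    (coreMark_head rfl).not_gt
  exact not_lt.mp h1

theorem code_parallel (h : (D.code σ ha).j = (D.code σ ha).i + 1) :
    (D.code σ ha).g = 2 * (D.code σ ha).j := by
  have hj : (D.code σ ha).j < Δ.height := D.headRank_lt _
  have h1 := (hD.chainPos_lt_coreBefore (ha := ha)
    (.inr ⟨(D.code σ ha).i, by omega⟩)).mpr
    (hD.parallel ⟨(D.code σ ha).i, by omega⟩ ⟨Δ.height - 1, by omega⟩ (by simp; omega)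
      (by simp; omega) rfl h)
  have h2 := hD.code_g_le (ha := ha)
  simp only [chainPos, Sum.elim_inr] at h1
  omega

theorem code_g_lt : (D.code σ ha).g + 1 < 2 * Δ.height := by
  have hj : (D.code σ ha).j < Δ.height := D.headRank_lt _
  have h2 := hD.code_g_le (ha := ha)
  omega

omit hD in
theorem code_corePos (c : Fin Δ.height ⊕ Fin Δ.height) : (D.code σ ha).corePos c =
    if chainPos c + 1 < 2 * Δ.height then (D.code σ ha).shift (chainPos c)
    else (D.code σ ha).g := by
  rcases c with k | e
  · rw [if_pos (by simp [chainPos]; omega)]; rfl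
  · simp only [Code.corePos, chainPos, Sum.elim_inr]
    exact if_congr (by omega) rfl rfl

/-- `shift` leaves the place g free for the additional edge, so `corePos` and the marking order the
floors and bounded edges in the same way. -/
theorem coreMark_lt_of_corePos {c c' : Fin Δ.height ⊕ Fin Δ.height}
    (h : (D.code σ ha).corePos c < (D.code σ ha).corePos c') :
    D.coreMark σ c < D.coreMark σ c' := by
  have hlast : ∀ y : Fin Δ.height ⊕ Fin Δ.height, ¬ chainPos y + 1 < 2 * Δ.height →
      y = .inr ⟨Δ.height - 1, by omega⟩ := by
    intro y hlast
    apply chainPos_injective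
    have := chainPos_lt y
    simp only [chainPos, Sum.elim_inr] at this hlast ⊢
    omega
  have k1 := hD.chainPos_lt_coreBefore (ha := ha) c
  have k2 := hD.chainPos_lt_coreBefore (ha := ha) c'
  rw [code_corePos, code_corePos] at h
  split_ifs at h with h1 h2 h2
  · refine hD.coreMark_lt ?_ h2
    simp only [Code.shift] at h
    split_ifs at h <;> omega
  · rw [hlast c' h2]
    refine k1.mp ?_
    simp only [Code.shift] at h
    split_ifs at h <;> omega
  · rw [hlast c h1]
    refine lt_of_le_of_ne (not_lt.mp (k2.not.mp ?_)) fun he => ?_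
    · simp only [Code.shift] at h
      split_ifs at h <;> omega
    · have := D.coreMark_injective σ he
      rw [← this] at h2
      simp only [chainPos, Sum.elim_inr] at h2
      omega
  · omega

theorem corePos_lt_coreBefore (c : Fin Δ.height ⊕ Fin Δ.height) (x : D.Element) :
    (D.code σ ha).corePos c < D.coreBefore x ↔ D.coreMark σ c < D.marking x := by
  rw [D.coreBefore_eq σ]
  refine lt_card_iff_of_antitone (D.code σ ha).corePos_injective
    ((D.code σ ha).corePos_lt hD.code_g_lt) (by simp; omega)
    (p := fun c => D.coreMark σ c < D.marking x) ?_ c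
  intro c c' h h'
  rcases h.eq_or_lt with h | h
  · rwa [(D.code σ ha).corePos_injective h]
  · exact (hD.coreMark_lt_of_corePos h).trans h'

omit hD in
theorem coreMark_sink (s : Fin Δ.topLength) :
    D.coreMark σ (.inl (D.floorRank (D.sinkFloor s))) < D.marking (.sink s) := by
  simpa [coreMark, coreNumbering, FloorDiagram.coreElement] using D.marking_lt_sink s

omit hD in
theorem coreMark_source (s : Fin Δ.bottomLength) :
    D.marking (.source s) < D.coreMark σ (.inl (D.floorRank (D.sourceFloor s))) := by
  simpa [coreMark, coreNumbering, FloorDiagram.coreElement] using D.marking_source_lt s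

theorem marking_source_lt_sink (s : Fin Δ.bottomLength) (s' : Fin Δ.topLength) :
    D.marking (.source s) < D.marking (.sink s') :=
  (coreMark_source (σ := σ) s).trans
    ((coreMark_floor_lt (Fin.lt_def.mpr (hD.source_lt_sink s s'))).trans (coreMark_sink s'))

/-- In `flow_eq` at the level t, the only bounded edges are the chain edge of that level and
possibly the additional one. All other contributions are those subtracted in `chainWeight`. -/
theorem code_chainWeight {t : ℕ} (h1 : 1 ≤ t) (h2 : t < Δ.height) :
    (D.code σ ha).chainWeight t = D.weight (σ ⟨t - 1, by omega⟩) := by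
  have hf := D.flow_eq t
  rw [← σ.sum_comp] at hf
  have e1 : ∀ e : Fin Δ.height, (if D.tailRank (σ e) < t ∧ t ≤ D.headRank (σ e) then
      (D.weight (σ e) : ℤ) else 0) = if (e : ℕ) + 1 < Δ.height then
        (if (e : ℕ) = t - 1 then (D.weight (σ ⟨t - 1, by omega⟩) : ℤ) else 0) else
        if (D.code σ ha).i < t ∧ t ≤ (D.code σ ha).j then ((D.code σ ha).w : ℤ) else 0 := by
    intro e
    split_ifs with h3 h4 h5 h6 h7 h8
    · congr 3; exact Fin.ext h5
    · rw [(hD.chain e h4).1, (hD.chain e h4).2] at h3; omega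
    · have : e = ⟨Δ.height - 1, by omega⟩ := Fin.ext (by simp; omega)
      rw [this]; rfl
    · have : e = ⟨Δ.height - 1, by omega⟩ := Fin.ext (by simp; omega)
      rw [this] at h3; exact absurd h3 h6
    · rw [(hD.chain e h7).1, (hD.chain e h7).2] at h3; omega
    · rfl
    · rename_i h9
      have : e = ⟨Δ.height - 1, by omega⟩ := Fin.ext (by simp; omega)
      rw [this] at h3; exact absurd h9 h3
    · rfl
  rw [sum_congr rfl fun e _ => e1 e, Code.sum_chain (by omega)
    (fun e => if e = t - 1 then (D.weight (σ ⟨t - 1, by omega⟩) : ℤ) else 0), sum_ite_eq',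
    if_pos (by simp; omega)] at hf
  have e2 : (crossing (D.code σ ha).sink.2 (Δ.height - t) : ℤ) =
      ∑ s, if D.sinkRank s < t then 1 else 0 := by
    rw [← D.sinkNumbering.sum_comp, Code.cast_crossing]
    refine sum_congr rfl fun s _ => if_congr ?_ rfl rfl
    have := D.sinkRank_lt (D.sinkNumbering s)
    simp only [code]
    omega
  have e3 : (crossing (D.code σ ha).source.2 t : ℤ) =
      ∑ s, if t ≤ D.sourceRank s then 1 else 0 := by
    rw [← D.sourceNumbering.sum_comp, Code.cast_crossing]
    rfl
  rw [Code.chainWeight, e2, e3]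
  change levelFlow Δ.bottomLength D.leftSeq D.rightSeq t - _ - _ - _ = _
  rw [← hf]
  push_cast
  ring

theorem code_valid : (D.code σ ha).Valid Δ.leftSlopes Δ.rightSlopes where
  map_L := D.map_leftSeq
  map_R := D.map_rightSeq
  lt := D.tailRank_lt_headRank _
  j_lt := D.headRank_lt _
  lt_g := hD.code_lt_g
  g_le := hD.code_g_le
  parallel := hD.code_parallel
  w_pos := D.weight_pos _
  sink_mem := by
    have key : ∀ s, (D.code σ ha).shift (2 * (Δ.height - 1 - (D.code σ ha).sink.2 s)) <
        D.coreBefore (.sink (D.sinkNumbering s)) := by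
      intro s
      have h1 := (hD.corePos_lt_coreBefore (ha := ha) _ _).mpr
        (coreMark_sink (D.sinkNumbering s))
      have h2 : Δ.height - 1 - (D.code σ ha).sink.2 s =
        D.floorRank (D.sinkFloor (D.sinkNumbering s)) := by
        have := (D.floorRank (D.sinkFloor (D.sinkNumbering s))).2
        simp only [code, sinkRank]
        omega
      rw [h2]; exact h1
    rw [mem_endSet]
    refine ⟨⟨fun s => ?_, fun s s' h => ?_⟩, fun s => ?_, fun s => ?_⟩
    · have := key s
      simp only [code]; omega
    · simp only [code]
      have := D.coreBefore_mono (x := .sink (D.sinkNumbering s'))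
        (y := .sink (D.sinkNumbering s)) (by
          rcases h.eq_or_lt with rfl | h
          · exact le_rfl
          · exact (D.sinkNumbering_lt h).le)
      omega
    · simp only [code]; omega
    · rw [Code.floorsBefore_sub _ hD.code_g_lt (by simp only [code]; omega)]
      have h2 := D.coreBefore_le (.sink (D.sinkNumbering s))
      refine (key s).trans_le ?_
      simp only [code]; omega
  source_mem := by
    have key : ∀ s, D.coreBefore (.source (D.sourceNumbering s)) ≤
        (D.code σ ha).shift (2 * (D.code σ ha).source.2 s) := by
      intro s
      have h1 := (hD.corePos_lt_coreBefore (ha := ha) _ _).not.mpr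
        (coreMark_source (D.sourceNumbering s)).not_gt
      exact not_lt.mp h1
    rw [mem_endSet]
    refine ⟨⟨fun s => ?_, fun s s' h => ?_⟩, fun s => ?_, fun s => ?_⟩
    · exact (key s).trans_lt ((D.code σ ha).corePos_lt hD.code_g_lt
        (.inl (D.floorRank (D.sourceFloor (D.sourceNumbering s)))))
    · exact D.coreBefore_mono (x := .source (D.sourceNumbering s))
        (y := .source (D.sourceNumbering s')) (by
          rcases h.eq_or_lt with rfl | h
          · exact le_rfl
          · exact (D.sourceNumbering_lt h).le)
    · exact D.sourceRank_lt _
    · rw [Code.floorsBefore_le]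
      exact key s
  chainWeight_pos t h1 h2 := by
    rw [hD.code_chainWeight h1 h2]
    exact_mod_cast D.weight_pos _

omit hD in
theorem code_sum : ∑ u, (D.code σ ha).L u + ∑ u, (D.code σ ha).R u =
    (Δ.bottomLength : ℤ) - Δ.topLength := by
  have hf := D.flow_eq Δ.height
  rw [levelFlow_top, sum_eq_zero (fun e _ => if_neg (by have := D.headRank_lt e; omega)),
    sum_congr rfl (fun s _ => if_pos (D.sinkRank_lt s)),
    sum_eq_zero (fun e _ => if_neg (by have := D.sourceRank_lt e; omega))] at hf
  simp only [sum_const, card_univ, Fintype.card_fin, nsmul_eq_mul, mul_one] at hf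
  simp only [code]
  linarith

/-- The bijection between the elements of the diagram with the code of `D` and those of `D`. -/
noncomputable def codeElements : ((D.code σ ha).toMarked hD.code_valid code_sum).Element ≃
    D.Element :=
  (FloorDiagram.elementEquiv _).trans ((Equiv.sumCongr (D.coreNumbering σ)
    (Equiv.sumCongr D.sinkNumbering D.sourceNumbering)).trans D.elementEquiv.symm)

/-- Keys record the gaps in which the ends lie and the order among ends of the same kind, so each
comparison of keys reflects one of markings. A sink never has a smaller key than a source, in view
of `source_lt_sink`. -/
theorem codeElements_lt {x y : ((D.code σ ha).toMarked hD.code_valid code_sum).Element}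
    (h : Code.key hD.code_valid code_sum x < Code.key hD.code_valid code_sum y) :
    D.marking (hD.codeElements x) < D.marking (hD.codeElements y) := by
  have core_core : ∀ c c', 2 * (D.code σ ha).corePos c + 1 < 2 * (D.code σ ha).corePos c' + 1 ∨
      2 * (D.code σ ha).corePos c + 1 = 2 * (D.code σ ha).corePos c' + 1 ∧ 0 < 0 →
      D.coreMark σ c < D.coreMark σ c' := fun c c' h =>
    hD.coreMark_lt_of_corePos (by omega)
  have core_end : ∀ c x, (D.code σ ha).corePos c < D.coreBefore x →
      D.coreMark σ c < D.marking x := fun c x h => (hD.corePos_lt_coreBefore c x).mp h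
  have end_core : ∀ c x, ¬ (D.code σ ha).corePos c < D.coreBefore x →
      D.marking x ≠ D.coreMark σ c → D.marking x < D.coreMark σ c := fun c x h h' =>
    lt_of_le_of_ne (not_lt.mp ((hD.corePos_lt_coreBefore c x).not.mp h)) h'
  have snk : ∀ s, 2 * Δ.height - (D.code σ ha).sink.1 s =
      D.coreBefore (.sink (D.sinkNumbering s)) := fun s => by
    have := D.coreBefore_le (.sink (D.sinkNumbering s))
    simp only [code]; omega
  have ends : ∀ x y, D.coreBefore x < D.coreBefore y → D.marking x < D.marking y := by
    intro x y hxy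
    by_contra hn
    exact (D.coreBefore_mono (not_lt.mp hn)).not_gt hxy
  have hsnk : ∀ s, (D.code σ ha).source.1 s = D.coreBefore (.source (D.sourceNumbering s)) :=
    fun s => rfl
  rcases x with v | e | s | s <;> rcases y with v' | e' | s' | s' <;>
    simp only [Code.key, Prod.Lex.toLex_lt_toLex, snk, hsnk] at h
  · exact core_core (.inl v) (.inl v') h
  · exact core_core (.inl v) (.inr e') h
  · exact core_end (.inl v) (.sink (D.sinkNumbering s')) (by omega)
  · exact core_end (.inl v) (.source (D.sourceNumbering s')) (by omega)
  · exact core_core (.inr e) (.inl v') h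
  · exact core_core (.inr e) (.inr e') h
  · exact core_end (.inr e) (.sink (D.sinkNumbering s')) (by change _ ∨ _ ∧ _ at h; omega)
  · exact core_end (.inr e) (.source (D.sourceNumbering s')) (by omega)
  · exact end_core (.inl v') (.sink (D.sinkNumbering s)) (by omega)
      fun h => by cases D.marking.injective h
  · exact end_core (.inr e') (.sink (D.sinkNumbering s)) (by omega)
      fun h => by cases D.marking.injective h
  · rcases h with h | ⟨_, h⟩
    · exact ends (.sink _) (.sink _) (by omega)
    · exact D.sinkNumbering_lt (Fin.lt_def.mpr (by omega))
  · exfalso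
    have := D.coreBefore_mono (hD.marking_source_lt_sink (D.sourceNumbering s')
      (D.sinkNumbering s)).le
    omega
  · exact end_core (.inl v') (.source (D.sourceNumbering s)) (by omega)
      fun h => by cases D.marking.injective h
  · exact end_core (.inr e') (.source (D.sourceNumbering s)) (by omega)
      fun h => by cases D.marking.injective h
  · exact hD.marking_source_lt_sink _ _
  · rcases h with h | ⟨_, h⟩
    · exact ends (.source _) (.source _) (by omega)
    · exact D.sourceNumbering_lt (Fin.lt_def.mpr h)

theorem codeElements_marking (x : ((D.code σ ha).toMarked hD.code_valid code_sum).Element) :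
    (D.marking (hD.codeElements x) : ℕ) =
      ((D.code σ ha).toMarked hD.code_valid code_sum).marking x :=
  val_eq_of_lt_imp hD.codeElements _ _ (fun _ _ h =>
    hD.codeElements_lt ((Code.toMarked_marking_lt _ _).mp h)) x

/-- A chain-like diagram is isomorphic to the one with the same code. -/
noncomputable def codeIso : Iso ((D.code σ ha).toMarked hD.code_valid code_sum) D where
  onFloors := D.floorRank.symm
  onBounded := σ
  onSinks := D.sinkNumbering
  onSources := D.sourceNumbering
  tail_comm e := by
    refine D.floorRank.injective (Fin.ext ?_)
    rw [Equiv.apply_symm_apply]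
    have he : (e : ℕ) < Δ.height := e.2
    by_cases h : (e : ℕ) + 1 < Δ.height
    · exact (hD.chain e h).1.trans (congrArg Fin.val (if_pos h)).symm
    · have he' : e = ⟨Δ.height - 1, by omega⟩ := Fin.ext (by simp; omega)
      refine Eq.trans ?_ (congrArg Fin.val (if_neg h)).symm
      rw [he']; rfl
  head_comm e := by
    refine D.floorRank.injective (Fin.ext ?_)
    rw [Equiv.apply_symm_apply]
    have he : (e : ℕ) < Δ.height := e.2
    by_cases h : (e : ℕ) + 1 < Δ.height
    · refine (hD.chain e h).2.trans ?_
      change _ = Fin.val (dite ((e : ℕ) + 1 < Δ.height) _ _)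
      rw [dif_pos h]
    · have he' : e = ⟨Δ.height - 1, by omega⟩ := Fin.ext (by simp; omega)
      change _ = Fin.val (dite ((e : ℕ) + 1 < Δ.height) _ _)
      rw [dif_neg h, he']; rfl
  sink_comm s := by
    refine D.floorRank.injective (Fin.ext ?_)
    rw [Equiv.apply_symm_apply]
    change D.sinkRank (D.sinkNumbering s) =
      Δ.height - 1 - (Δ.height - 1 - D.sinkRank (D.sinkNumbering s))
    have := D.sinkRank_lt (D.sinkNumbering s)
    omega
  source_comm s := by
    refine D.floorRank.injective (Fin.ext ?_)
    rw [Equiv.apply_symm_apply]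
    rfl
  weight_comm e := by
    have he : (e : ℕ) < Δ.height := e.2
    by_cases h : (e : ℕ) + 1 < Δ.height
    · refine Eq.trans ?_ (if_pos h).symm
      rw [hD.code_chainWeight (by omega) h]; rfl
    · have he' : e = ⟨Δ.height - 1, by omega⟩ := Fin.ext (by simp; omega)
      refine Eq.trans ?_ (if_neg h).symm
      rw [he']; rfl
  L_comm v := rfl
  R_comm v := rfl
  marking_floor v := hD.codeElements_marking (.floor v)
  marking_bounded v := hD.codeElements_marking (.bounded v)
  marking_sink v := hD.codeElements_marking (.sink v)
  marking_source v := hD.codeElements_marking (.source v)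

end IsChain

/-- The defect bounds the rank of every source and the distance of every sink to the last floor.
With at least 2 N floors, this places all sources below all sinks. -/
theorem exists_isChain (D : MarkedFloorDiagram Δ 1) {N : ℕ} (hN : D.defect < N)
    (ha : 2 * N ≤ Δ.height) (hflow : ∀ t, 1 ≤ t → t < Δ.height →
      (N : ℤ) ≤ levelFlow Δ.bottomLength D.leftSeq D.rightSeq t) : ∃ σ, D.IsChain σ := by
  obtain ⟨σ, h1, h2⟩ := D.exists_chain hN (by omega) hflow
  refine ⟨σ, by omega, h1, h2, fun s s' => ?_⟩
  have e1 : D.sourceRank s ≤ ∑ s, D.sourceRank s :=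
    single_le_sum (f := D.sourceRank) (fun _ _ => Nat.zero_le _) (mem_univ s)
  have e2 : Δ.height - 1 - D.sinkRank s' ≤ ∑ s, (Δ.height - 1 - D.sinkRank s) :=
    single_le_sum (f := fun s => Δ.height - 1 - D.sinkRank s) (fun _ _ => Nat.zero_le _)
      (mem_univ s')
  unfold defect at hN
  omega

end MarkedFloorDiagram

end ToricRefined

namespace ToricRefined

open Finset
open scoped LaurentPolynomial PowerSeries

/-! ### From Laurent polynomials in q to power series in x -/

section Laurent

/-- The substitution `X ↦ T (-2)`, that is `X ↦ q⁻¹`. -/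
noncomputable def toInverseSquare : Polynomial ℤ →+* ℤ[T;T⁻¹] :=
  Polynomial.eval₂RingHom (Int.castRingHom _) (LaurentPolynomial.T (-2))

theorem toInverseSquare_X_pow (k : ℕ) :
    toInverseSquare (Polynomial.X ^ k) = LaurentPolynomial.T (-(2 * k : ℤ)) := by
  simp [toInverseSquare, LaurentPolynomial.T_pow, mul_comm]

theorem coeff_T_mul_toInverseSquare (m : ℤ) (p : Polynomial ℤ) (i : ℕ) :
    (LaurentPolynomial.T m * toInverseSquare p : ℤ[T;T⁻¹]).coeff (m - 2 * i) = p.coeff i := by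
  induction p using Polynomial.induction_on' with
  | add p q hp hq => rw [map_add, mul_add, AddMonoidAlgebra.coeff_add, Finsupp.add_apply, hp, hq,
      Polynomial.coeff_add]
  | monomial k c =>
    rw [← Polynomial.C_mul_X_pow_eq_monomial, map_mul, toInverseSquare_X_pow, mul_left_comm,
      ← LaurentPolynomial.T_add]
    have : toInverseSquare (Polynomial.C c) = (c : ℤ[T;T⁻¹]) := by
      simp [toInverseSquare]
    rw [this, Polynomial.coeff_C_mul_X_pow, ← zsmul_eq_mul, AddMonoidAlgebra.coeff_smul_apply,
      LaurentPolynomial.T_apply]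
    by_cases hik : i = k
    · rw [if_pos (by omega), if_pos hik]; simp
    · rw [if_neg (by omega), if_neg hik]; simp

theorem T_sub_T_neg (w : ℕ) : (LaurentPolynomial.T (w : ℤ) - LaurentPolynomial.T (-(w : ℤ)) :
    ℤ[T;T⁻¹]) = LaurentPolynomial.T (w : ℤ) * toInverseSquare (1 - Polynomial.X ^ w) := by
  rw [map_sub, map_one, toInverseSquare_X_pow, mul_sub, mul_one, ← LaurentPolynomial.T_add]
  congr 2
  ring

end Laurent

namespace MarkedFloorDiagram

variable {n : ℕ} [NeZero n] {Δ : LatticePolygon n} {g : ℕ} (D : MarkedFloorDiagram Δ g)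

/-- The contribution of a marked floor diagram to the reversed invariant, at an element of a
ring. -/
noncomputable def term {R : Type*} [CommRing R] (x : R) : R :=
  x ^ D.defect * ((∏ e, (1 - x ^ D.weight e) ^ 2) * (1 - x) ^ (Δ.topLength + Δ.bottomLength))

theorem map_term {R S : Type*} [CommRing R] [CommRing S] (f : R →+* S) (x : R) :
    f (D.term x) = D.term (f x) := by
  simp [term, map_prod]

/-- The leading power of q is taken out of every factor. The defect is added to the exponent and
compensated by x^defect in `term`, so that the prefactor can be the same for all diagrams. -/
theorem multiplicity_eq_T_mul : D.multiplicity =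
    LaurentPolynomial.T (Δ.topLength + Δ.bottomLength + 2 * ((∑ e, D.weight e : ℤ) + D.defect)) *
      toInverseSquare (D.term Polynomial.X) := by
  have h1 := T_sub_T_neg 1
  rw [Nat.cast_one, pow_one] at h1
  rw [FloorDiagram.multiplicity, h1, term, map_mul, toInverseSquare_X_pow, map_mul, map_pow,
    map_prod, mul_pow, LaurentPolynomial.T_pow]
  simp only [T_sub_T_neg, mul_pow, map_pow, LaurentPolynomial.T_pow, prod_mul_distrib]
  have h2 : ∀ s : Finset (Fin D.numBounded), ∏ e ∈ s, (LaurentPolynomial.T (((2 : ℕ) : ℤ) *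
      (D.weight e : ℤ)) : ℤ[T;T⁻¹]) = LaurentPolynomial.T (2 * ∑ e ∈ s, (D.weight e : ℤ)) := by
    intro s
    induction s using Finset.induction_on with
    | empty => simp
    | insert a s ha ih => rw [prod_insert ha, sum_insert ha, ih, ← LaurentPolynomial.T_add, mul_add,
        Nat.cast_ofNat]
  rw [h2]
  have h3 : (LaurentPolynomial.T (Δ.topLength + Δ.bottomLength +
      2 * ((∑ e, D.weight e : ℤ) + D.defect)) : ℤ[T;T⁻¹]) =
      LaurentPolynomial.T (2 * ∑ e, (D.weight e : ℤ)) *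
        LaurentPolynomial.T (((Δ.topLength + Δ.bottomLength : ℕ) : ℤ) * 1) *
        LaurentPolynomial.T (2 * D.defect) := by
    rw [← LaurentPolynomial.T_add, ← LaurentPolynomial.T_add]
    congr 1
    push_cast
    ring
  rw [h3]
  have h4 : (LaurentPolynomial.T (2 * D.defect) * LaurentPolynomial.T (-(2 * D.defect)) :
      ℤ[T;T⁻¹]) = 1 := by
    rw [← LaurentPolynomial.T_add]; simp
  linear_combination (-LaurentPolynomial.T (2 * ∑ e, (D.weight e : ℤ)) *
    LaurentPolynomial.T (((Δ.topLength + Δ.bottomLength : ℕ) : ℤ) * 1) *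
    (∏ e, toInverseSquare (1 - Polynomial.X ^ D.weight e) ^ 2) *
    toInverseSquare (1 - Polynomial.X) ^ (Δ.topLength + Δ.bottomLength)) * h4

theorem mk_coeff_multiplicity {A : ℤ} (hA : A = Δ.topLength + Δ.bottomLength +
    2 * ((∑ e, D.weight e : ℤ) + D.defect)) :
    PowerSeries.mk (fun i => D.multiplicity.coeff (A - 2 * (i : ℤ))) =
      D.term (PowerSeries.X : ℤ⟦X⟧) := by
  have h : D.term (PowerSeries.X : ℤ⟦X⟧) = (D.term Polynomial.X : Polynomial ℤ) := by
    rw [← Polynomial.coe_X]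
    exact (D.map_term (R := Polynomial ℤ) (S := ℤ⟦X⟧)
      (Polynomial.coeToPowerSeries.ringHom (R := ℤ)) Polynomial.X).symm
  ext i
  rw [h, PowerSeries.coeff_mk, Polynomial.coeff_coe, multiplicity_eq_T_mul, ← hA,
    coeff_T_mul_toInverseSquare]

end MarkedFloorDiagram

/-! ### Finiteness of the set of classes -/

section Finite

variable {n : ℕ} [NeZero n] {Δ : LatticePolygon n}

namespace MarkedFloorDiagram

variable {g : ℕ}

/-- Marked floor diagrams with the same data are isomorphic. -/
theorem iso_of_data_eq {D D' : MarkedFloorDiagram Δ g} (hn : D.numBounded = D'.numBounded)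
    (htail : ∀ e, D'.tail (finCongr hn e) = D.tail e)
    (hhead : ∀ e, D'.head (finCongr hn e) = D.head e)
    (hweight : ∀ e, D'.weight (finCongr hn e) = D.weight e)
    (hsink : D'.sinkFloor = D.sinkFloor) (hsource : D'.sourceFloor = D.sourceFloor)
    (hL : D'.L = D.L) (hR : D'.R = D.R)
    (h1 : ∀ v, (D'.marking (.floor v) : ℕ) = D.marking (.floor v))
    (h2 : ∀ e, (D'.marking (.bounded (finCongr hn e)) : ℕ) = D.marking (.bounded e))
    (h3 : ∀ s, (D'.marking (.sink s) : ℕ) = D.marking (.sink s))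
    (h4 : ∀ s, (D'.marking (.source s) : ℕ) = D.marking (.source s)) : Nonempty (Iso D D') :=
  ⟨{ onFloors := Equiv.refl _
     onBounded := finCongr hn
     onSinks := Equiv.refl _
     onSources := Equiv.refl _
     tail_comm := htail
     head_comm := hhead
     sink_comm := fun s => by rw [hsink]; rfl
     source_comm := fun s => by rw [hsource]; rfl
     weight_comm := hweight
     L_comm := fun s => by rw [hL]; rfl
     R_comm := fun s => by rw [hR]; rfl
     marking_floor := h1
     marking_bounded := h2
     marking_sink := h3
     marking_source := h4 }⟩

end MarkedFloorDiagram

/-- There are finitely many classes of marked floor diagrams of genus `1`, since the total weight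
of the bounded edges is bounded. -/
theorem finite_markedFloorDiagramClass {B : ℕ}
    (hB : ∀ (D : MarkedFloorDiagram Δ 1) (e : Fin D.numBounded), D.weight e < B) :
    Finite (MarkedFloorDiagramClass Δ 1) := by
  have hslope : ∀ (M : Multiset ℤ) (f : Fin Δ.height → ℤ), univ.val.map f = M →
      ∀ v, f v ∈ M.toFinset := by
    rintro M f rfl v
    rw [Multiset.mem_toFinset]
    exact Multiset.mem_map_of_mem f (mem_univ_val v)
  have hel : ∀ (D : MarkedFloorDiagram Δ 1), D.numElements =
      Δ.height + Δ.height + Δ.topLength + Δ.bottomLength := fun D => by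
    rw [FloorDiagram.numElements, D.numBounded_eq]
  let T : Type := (Fin Δ.height → Fin Δ.height) × (Fin Δ.height → Fin Δ.height) ×
    (Fin Δ.height → Fin B) × (Fin Δ.topLength → Fin Δ.height) ×
    (Fin Δ.bottomLength → Fin Δ.height) × (Fin Δ.height → Δ.leftSlopes.toFinset) ×
    (Fin Δ.height → Δ.rightSlopes.toFinset) ×
    ((Fin Δ.height ⊕ Fin Δ.height) ⊕ (Fin Δ.topLength ⊕ Fin Δ.bottomLength) →
      Fin (Δ.height + Δ.height + Δ.topLength + Δ.bottomLength))
  let data : MarkedFloorDiagram Δ 1 → T := fun D =>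
    (fun e => D.tail (finCongr D.numBounded_eq.symm e),
      fun e => D.head (finCongr D.numBounded_eq.symm e),
      fun e => ⟨D.weight (finCongr D.numBounded_eq.symm e), hB D _⟩, D.sinkFloor, D.sourceFloor,
      fun v => ⟨D.L v, hslope _ _ D.map_L v⟩, fun v => ⟨D.R v, hslope _ _ D.map_R v⟩,
      Sum.elim (Sum.elim (fun v => finCongr (hel D) (D.marking (.floor v)))
        fun e => finCongr (hel D) (D.marking (.bounded (finCongr D.numBounded_eq.symm e))))
        (Sum.elim (fun v => finCongr (hel D) (D.marking (.sink v)))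
          fun v => finCongr (hel D) (D.marking (.source v))))
  have key : ∀ D D' : MarkedFloorDiagram Δ 1, data D = data D' →
      Nonempty (MarkedFloorDiagram.Iso D D') := by
    intro D D' h
    have h1 := congrArg (fun p : T => p.1) h
    have h2 := congrArg (fun p : T => p.2.1) h
    have h3 := congrArg (fun p : T => p.2.2.1) h
    have h4 := congrArg (fun p : T => p.2.2.2.1) h
    have h5 := congrArg (fun p : T => p.2.2.2.2.1) h
    have h6 := congrArg (fun p : T => p.2.2.2.2.2.1) h
    have h7 := congrArg (fun p : T => p.2.2.2.2.2.2.1) h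
    have h8 := congrArg (fun p : T => p.2.2.2.2.2.2.2) h
    have hn : D.numBounded = D'.numBounded := by rw [D.numBounded_eq, D'.numBounded_eq]
    refine MarkedFloorDiagram.iso_of_data_eq hn ?_ ?_ ?_ h4.symm h5.symm ?_ ?_ ?_ ?_ ?_ ?_
    · intro e; exact (congrFun h1 (finCongr D.numBounded_eq e)).symm
    · intro e; exact (congrFun h2 (finCongr D.numBounded_eq e)).symm
    · intro e; exact (congrArg Fin.val (congrFun h3 (finCongr D.numBounded_eq e))).symm
    · funext v; exact (congrArg Subtype.val (congrFun h6 v)).symm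
    · funext v; exact (congrArg Subtype.val (congrFun h7 v)).symm
    · intro v; exact (congrArg Fin.val (congrFun h8 (.inl (.inl v)))).symm
    · intro e
      exact (congrArg Fin.val (congrFun h8 (.inl (.inr (finCongr D.numBounded_eq e))))).symm
    · intro v; exact (congrArg Fin.val (congrFun h8 (.inr (.inl v)))).symm
    · intro v; exact (congrArg Fin.val (congrFun h8 (.inr (.inr v)))).symm
  have hT : Finite T := by infer_instance
  refine Finite.of_injective (fun c : MarkedFloorDiagramClass Δ 1 => data c.out) fun c c' h => ?_
  rw [← Quotient.out_eq c, ← Quotient.out_eq c']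
  exact Quotient.sound (key _ _ h)

end Finite

section Toric

variable {n : ℕ} [NeZero n] {Δ : LatticePolygon n}

/-- The reversed invariant as a sum over classes. -/
theorem reversedInvariant_eq_sum [Fintype (MarkedFloorDiagramClass Δ 1)] :
    reversedInvariant Δ 1 = ∑ c : MarkedFloorDiagramClass Δ 1,
      PowerSeries.mk fun i => c.multiplicity.coeff (Δ.twiceArea - 2 * (i : ℤ)) := by
  rw [reversedInvariant, clearedInvariant, finsum_eq_sum_of_fintype]
  ext i
  simp [PowerSeries.coeff_mk, AddMonoidAlgebra.coeff_sum, Finsupp.finsetSum_apply]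

end Toric

namespace Code

variable {n : ℕ} [NeZero n] {Δ : LatticePolygon n} {κ : Code Δ.height Δ.topLength Δ.bottomLength}
  (h : κ.Valid Δ.leftSlopes Δ.rightSlopes)
  (hbal : ∑ u, κ.L u + ∑ u, κ.R u = (Δ.bottomLength : ℤ) - Δ.topLength)

theorem floorRank_toMarked (v : Fin Δ.height) : (toMarked h hbal).floorRank v = v :=
  Fin.equiv_eq_of_lt _ (fun _ _ hv =>
    (MarkedFloorDiagram.floorRank_lt _).mpr (marking_floor_lt h hbal hv)) v

/-- The contribution of a code. -/
def term {a b b' : ℕ} (κ : Code a b b') {R : Type*} [CommRing R] (x : R) : R :=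
  x ^ (slopeInv κ.L + slopeInv κ.R) * (x ^ (κ.w * (κ.j - κ.i - 1)) *
    (∏ t ∈ Ico 1 a, (1 - x ^ (κ.chainWeight t).toNat) ^ 2) * (1 - x ^ κ.w) ^ 2 *
      (((1 - x) ^ b * x ^ ∑ s, κ.sink.2 s) * ((1 - x) ^ b' * x ^ ∑ s, κ.source.2 s)))

/-- Chain edges skip no floor, so among the bounded edges only the additional one contributes to the
defect. -/
theorem term_toMarked {R : Type*} [CommRing R] (x : R) : (toMarked h hbal).term x = κ.term x := by
  have hl : (toMarked h hbal).leftSeq = κ.L := by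
    funext v
    have : (toMarked h hbal).floorRank.symm v = v := by
      rw [Equiv.symm_apply_eq, floorRank_toMarked]
    simp only [MarkedFloorDiagram.leftSeq, Function.comp_apply, this]
    rfl
  have hr : (toMarked h hbal).rightSeq = κ.R := by
    funext v
    have : (toMarked h hbal).floorRank.symm v = v := by
      rw [Equiv.symm_apply_eq, floorRank_toMarked]
    simp only [MarkedFloorDiagram.rightSeq, Function.comp_apply, this]
    rfl
  have hpos : 0 < Δ.height := by have := h.j_lt; omega
  have hw : ∀ e : Fin Δ.height, (toMarked h hbal).weight e *
      ((toMarked h hbal).headRank e - (toMarked h hbal).tailRank e - 1) =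
        if (e : ℕ) + 1 < Δ.height then 0 else κ.w * (κ.j - κ.i - 1) := by
    intro e
    have h1 : (toMarked h hbal).headRank e =
        if (e : ℕ) + 1 < Δ.height then (e : ℕ) + 1 else κ.j := by
      change ((toMarked h hbal).floorRank ((toMarked h hbal).head e) : ℕ) = _
      rw [floorRank_toMarked]
      exact apply_dite Fin.val _ _ _
    have h2 : (toMarked h hbal).tailRank e =
        if (e : ℕ) + 1 < Δ.height then (e : ℕ) else κ.i := by
      change ((toMarked h hbal).floorRank ((toMarked h hbal).tail e) : ℕ) = _
      rw [floorRank_toMarked]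
      exact apply_ite Fin.val _ _ _
    have h3 : (toMarked h hbal).weight e =
      if (e : ℕ) + 1 < Δ.height then (κ.chainWeight (e + 1)).toNat else κ.w := rfl
    rw [h1, h2, h3]
    split_ifs <;> simp
  have hdef : (toMarked h hbal).defect = slopeInv κ.L + slopeInv κ.R +
      (κ.w * (κ.j - κ.i - 1) + ∑ s, κ.sink.2 s + ∑ s, κ.source.2 s) := by
    rw [MarkedFloorDiagram.defect, hl, hr]
    congr 3
    · refine (sum_congr rfl fun e _ => hw e).trans ?_
      exact (sum_chain hpos (fun _ => 0) _).trans (by simp)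
    · refine sum_congr rfl fun s _ => ?_
      have := (mem_endSet.mp h.sink_mem).2.1 s
      have h1 : (toMarked h hbal).sinkRank s = Δ.height - 1 - κ.sink.2 s := by
        rw [MarkedFloorDiagram.sinkRank, floorRank_toMarked]; rfl
      omega
    · funext s
      rw [MarkedFloorDiagram.sourceRank, floorRank_toMarked]; rfl
  have hprod : ∏ e, (1 - x ^ (toMarked h hbal).weight e) ^ 2 =
      (∏ t ∈ Ico 1 Δ.height, (1 - x ^ (κ.chainWeight t).toNat) ^ 2) * (1 - x ^ κ.w) ^ 2 := by
    rw [prod_Ico_eq_prod_range]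
    have := prod_chain hpos (fun k => (1 - x ^ (κ.chainWeight (1 + k)).toNat) ^ 2)
      ((1 - x ^ κ.w) ^ 2)
    rw [← this]
    refine prod_congr rfl fun e _ => ?_
    have e1 : (toMarked h hbal).weight e =
      if (e : ℕ) + 1 < Δ.height then (κ.chainWeight (e + 1)).toNat else κ.w := rfl
    rw [e1]
    have e2 : ((e : Fin Δ.height) : ℕ) + 1 = 1 + e := add_comm _ _
    split_ifs <;> first | rfl | simp only [e2]
  rw [MarkedFloorDiagram.term, hdef, hprod, term]
  ring

end Code

end ToricRefined

/-! ### The reversed invariant as a sum over codes -/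

namespace ToricRefined

open Finset
open scoped LaurentPolynomial PowerSeries

/-- A box that contains all the sets `endSet b a φ`. -/
def endBox (b a : ℕ) : Finset ((Fin b → ℕ) × (Fin b → ℕ)) :=
  monotoneSeqs b (2 * a) ×ˢ Fintype.piFinset fun _ : Fin b => range a

theorem endSet_subset (b a φ : ℕ) : endSet b a φ ⊆ endBox b a := filter_subset _ _

namespace Code

/-- Codes as tuples. -/
def equivTuple (a b b' : ℕ) : ((Fin a → ℤ) × (Fin a → ℤ) × ℕ × ℕ × ℕ × ℕ ×
    ((Fin b → ℕ) × (Fin b → ℕ)) × ((Fin b' → ℕ) × (Fin b' → ℕ))) ≃ Code a b b' where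
  toFun t := ⟨t.1, t.2.1, t.2.2.1, t.2.2.2.1, t.2.2.2.2.1, t.2.2.2.2.2.1, t.2.2.2.2.2.2.1,
    t.2.2.2.2.2.2.2⟩
  invFun κ := (κ.L, κ.R, κ.i, κ.j, κ.g, κ.w, κ.sink, κ.source)
  left_inv _ := rfl
  right_inv _ := rfl

variable {a b b' : ℕ}

/-- A box of codes. -/
def box (b b' : ℕ) (AL AR : Finset (Fin a → ℤ)) (B : ℕ) : Finset (Code a b b') :=
  (AL ×ˢ AR ×ˢ range a ×ˢ range a ×ˢ range (2 * a) ×ˢ range B ×ˢ endBox b a ×ˢ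
    endBox b' a).map (equivTuple a b b').toEmbedding

theorem mem_box {AL AR : Finset (Fin a → ℤ)} {B : ℕ} {κ : Code a b b'} :
    κ ∈ box b b' AL AR B ↔ κ.L ∈ AL ∧ κ.R ∈ AR ∧ κ.i < a ∧ κ.j < a ∧ κ.g < 2 * a ∧ κ.w < B ∧
      κ.sink ∈ endBox b a ∧ κ.source ∈ endBox b' a := by
  rw [box, mem_map_equiv]
  simp [equivTuple]

theorem sum_box {M : Type*} [AddCommMonoid M] (AL AR : Finset (Fin a → ℤ)) (B : ℕ)
    (F : Code a b b' → M) : ∑ κ ∈ box b b' AL AR B, F κ =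
      ∑ L ∈ AL, ∑ R ∈ AR, ∑ i ∈ range a, ∑ j ∈ range a, ∑ g ∈ range (2 * a), ∑ w ∈ range B,
        ∑ p ∈ endBox b a, ∑ q ∈ endBox b' a, F ⟨L, R, i, j, g, w, p, q⟩ := by
  rw [box, sum_map]
  simp only [sum_product]
  rfl

end Code

open Classical in
/-- The reversed invariant, modulo `X ^ N`, as a sum over codes. -/
theorem map_reversedInvariant {n : ℕ} [NeZero n] {Δ : LatticePolygon n} {R : Type*} [CommRing R]
    (f : ℤ⟦X⟧ →+* R) {N : ℕ} (hx : f PowerSeries.X ^ N = 0) {W : ℤ} {B : ℕ}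
    {AL AR : Finset (Fin Δ.height → ℤ)} (hAL : ∀ L, L ∈ AL ↔ univ.val.map L = Δ.leftSlopes)
    (hAR : ∀ L, L ∈ AR ↔ univ.val.map L = Δ.rightSlopes) (ha : 2 * N ≤ Δ.height)
    (hsum : ∀ L ∈ AL, ∀ R ∈ AR, ∑ u, L u + ∑ u, R u = (Δ.bottomLength : ℤ) - Δ.topLength)
    (hW : ∀ L ∈ AL, ∀ R ∈ AR, ∑ t ∈ Ico 1 Δ.height, levelFlow Δ.bottomLength L R t +
      slopeInv L + slopeInv R = W) (hA : Δ.twiceArea = Δ.topLength + Δ.bottomLength + 2 * W)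
    (hflow : ∀ L ∈ AL, ∀ R ∈ AR, slopeInv L + slopeInv R < N → ∀ t, 1 ≤ t → t < Δ.height →
      (N : ℤ) ≤ levelFlow Δ.bottomLength L R t)
    (hB : ∀ L ∈ AL, ∀ R ∈ AR, ∀ t, 1 ≤ t → t < Δ.height →
      levelFlow Δ.bottomLength L R t ≤ B) :
    f (reversedInvariant Δ 1) = ∑ κ ∈ Code.box Δ.topLength Δ.bottomLength AL AR B,
      if κ.Valid Δ.leftSlopes Δ.rightSlopes then κ.term (f PowerSeries.X) else 0 := by
  have hDW : ∀ D : MarkedFloorDiagram Δ 1, (∑ e, (D.weight e : ℤ)) + D.defect = W := fun D => by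
    rw [D.sum_weight_add_defect]
    exact hW _ ((hAL _).mpr D.map_leftSeq) _ ((hAR _).mpr D.map_rightSeq)
  -- A `finsum` with infinite support would be 0 by default, so finiteness is needed. It follows
  -- from the bound W on the total weight.
  have hfin : Finite (MarkedFloorDiagramClass Δ 1) := by
    refine finite_markedFloorDiagramClass (B := W.toNat + 1) fun D e => ?_
    have h1 : D.weight e ≤ ∑ e, D.weight e :=
      single_le_sum (f := D.weight) (fun _ _ => Nat.zero_le _) (mem_univ e)
    have h2 := hDW D
    have h3 : ((∑ e, D.weight e : ℕ) : ℤ) = ∑ e, (D.weight e : ℤ) := by push_cast; rfl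
    omega
  have := Fintype.ofFinite (MarkedFloorDiagramClass Δ 1)
  have hterm : ∀ D : MarkedFloorDiagram Δ 1, f (PowerSeries.mk fun i =>
      (MarkedFloorDiagramClass.multiplicity (⟦D⟧ : MarkedFloorDiagramClass Δ 1)).coeff
        (Δ.twiceArea - 2 * (i : ℤ))) = D.term (f PowerSeries.X) := by
    intro D
    rw [← D.map_term f]
    congr 1
    refine D.mk_coeff_multiplicity ?_
    rw [hA, hDW D]
  rw [reversedInvariant_eq_sum, map_sum]
  symm
  have hv : ∀ {κ : Code Δ.height Δ.topLength Δ.bottomLength}, (if κ.Valid Δ.leftSlopes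
      Δ.rightSlopes then κ.term (f PowerSeries.X) else 0) ≠ 0 →
        κ.Valid Δ.leftSlopes Δ.rightSlopes := fun h => by
    by_contra hn
    exact h (if_neg hn)
  have hs : ∀ {κ : Code Δ.height Δ.topLength Δ.bottomLength}, κ ∈ Code.box Δ.topLength
      Δ.bottomLength AL AR B → ∑ u, κ.L u + ∑ u, κ.R u = (Δ.bottomLength : ℤ) - Δ.topLength :=
    fun h => hsum _ (Code.mem_box.mp h).1 _ (Code.mem_box.mp h).2.1
  -- Only nonzero terms have to correspond: a diagram of defect at least N contributes 0, and any
  -- other is a chain and isomorphic to the diagram of its code.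
  refine sum_bij_ne_zero (fun κ hκ hne => (⟦Code.toMarked (hv hne) (hs hκ)⟧ :
    MarkedFloorDiagramClass Δ 1)) (fun _ _ _ => mem_univ _) ?_ ?_ ?_
  · intro κ h1 h2 κ' h1' h2' h
    exact (Quotient.exact h).elim fun φ => Code.eq_of_iso _ _ _ _ φ
  · intro c _ hc
    obtain ⟨D, rfl⟩ := Quotient.exists_rep c
    rw [hterm] at hc
    have hdef : D.defect < N := by
      by_contra hn
      apply hc
      rw [MarkedFloorDiagram.term, pow_eq_zero_of_ge hx (not_lt.mp hn), zero_mul]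
    have hL := (hAL _).mpr D.map_leftSeq
    have hR := (hAR _).mpr D.map_rightSeq
    obtain ⟨σ, hD⟩ := D.exists_isChain hdef ha
      (hflow _ hL _ hR (by unfold MarkedFloorDiagram.defect at hdef; omega))
    have hpos := hD.pos
    have hval := hD.code_valid (ha := hpos)
    have hmem : D.code σ hpos ∈ Code.box Δ.topLength Δ.bottomLength AL AR B := by
      rw [Code.mem_box]
      refine ⟨hL, hR, hval.lt.trans hval.j_lt, hval.j_lt, by have := hval.g_lt; omega, ?_,
        endSet_subset _ _ _ hval.sink_mem, endSet_subset _ _ _ hval.source_mem⟩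
      have h1 := hval.lt
      -- The additional edge crosses the level j together with a chain edge of positive weight, so
      -- its weight is less than the flow there.
      have h2 := hval.chainWeight_pos _ (by omega) hval.j_lt
      have h3 := hB _ hL _ hR (D.code σ hpos).j (by omega) hval.j_lt
      change levelFlow _ (D.code σ hpos).L (D.code σ hpos).R _ ≤ _ at h3
      rw [Code.chainWeight, if_pos ⟨h1, le_rfl⟩] at h2
      omega
    have hiso : (⟦Code.toMarked hval MarkedFloorDiagram.IsChain.code_sum⟧ :
        MarkedFloorDiagramClass Δ 1) = ⟦D⟧ := Quotient.sound ⟨hD.codeIso⟩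
    refine ⟨_, hmem, ?_, hiso⟩
    rw [if_pos hval, ← Code.term_toMarked hval MarkedFloorDiagram.IsChain.code_sum, ← hterm,
      hiso, hterm]
    exact hc
  · intro κ h1 h2
    rw [if_pos (hv h2), hterm, Code.term_toMarked]

end ToricRefined

namespace ToricRefined

open Finset

/-! ### Summation over the codes with given slopes -/

section Sums

variable {M : Type*} [AddCommMonoid M]

/-- Edges parallel to the chain have the single place g = 2 j by the normal form. They are separated
from the edges that skip floors because their weights are unbounded modulo x^N, whereas a skipping
edge of weight w costs at least x^w. -/
theorem sum_edge_positions {a : ℕ} (G : ℕ → ℕ → ℕ → M)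
    (h0 : ∀ i j g, i < a → j < a → ¬ (i < j ∧ 2 * i < g ∧ g ≤ 2 * j ∧ (j = i + 1 → g = 2 * j)) →
      G i j g = 0) :
    ∑ i ∈ range a, ∑ j ∈ range a, ∑ g ∈ range (2 * a), G i j g =
      ∑ t ∈ Ico 1 a, G (t - 1) t (2 * t) +
        ∑ i ∈ range a, ∑ j ∈ Ico (i + 2) a, ∑ g ∈ Ioc (2 * i) (2 * j), G i j g := by
  have h1 : ∀ i ∈ range a, ∑ j ∈ range a, ∑ g ∈ range (2 * a), G i j g =
      (if i + 1 < a then G i (i + 1) (2 * (i + 1)) else 0) +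
        ∑ j ∈ Ico (i + 2) a, ∑ g ∈ Ioc (2 * i) (2 * j), G i j g := by
    intro i hi
    rw [mem_range] at hi
    have e1 : ∑ j ∈ Ico (i + 2) a, ∑ g ∈ Ioc (2 * i) (2 * j), G i j g =
        ∑ j ∈ Ico (i + 2) a, ∑ g ∈ range (2 * a), G i j g := by
      refine sum_congr rfl fun j hj => sum_subset (fun g hg => ?_) fun g _ hg => ?_
      · simp only [mem_Ico, mem_Ioc, mem_range] at hj hg ⊢; omega
      · simp only [mem_Ico, mem_Ioc] at hj hg
        exact h0 _ _ _ hi hj.2 (by omega)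
    have e2 : (if i + 1 < a then G i (i + 1) (2 * (i + 1)) else 0) =
        ∑ j ∈ Ico (i + 1) (min (i + 2) a), ∑ g ∈ range (2 * a), G i j g := by
      split_ifs with h
      · rw [min_eq_left (by omega), Nat.Ico_succ_singleton, sum_singleton,
          sum_eq_single (2 * (i + 1))]
        · intro g _ hg; exact h0 _ _ _ hi h (by omega)
        · intro hg; simp at hg; omega
      · rw [Ico_eq_empty (by omega), sum_empty]
    rw [e1, e2]
    have e3 : Disjoint (Ico (i + 1) (min (i + 2) a)) (Ico (i + 2) a) := by
      rw [disjoint_left]; intro j hj hj'; simp only [mem_Ico, lt_min_iff] at hj hj'; omega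
    rw [← sum_union e3]
    refine (sum_subset (fun j hj => ?_) fun j hj hj' => sum_eq_zero fun g _ => ?_).symm
    · simp only [mem_union, mem_Ico, lt_min_iff, mem_range] at hj ⊢; omega
    · simp only [mem_union, mem_Ico, lt_min_iff, mem_range] at hj hj'
      exact h0 _ _ _ hi hj (by omega)
  rw [sum_congr rfl h1, sum_add_distrib]
  congr 1
  rw [← sum_filter, sum_Ico_eq_sum_range]
  have : (range a).filter (fun i => i + 1 < a) = range (a - 1) := by
    ext i; simp only [mem_filter, mem_range]; omega
  rw [this]
  refine sum_congr rfl fun i _ => ?_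
  rw [Nat.add_sub_cancel_left, add_comm 1 i]

end Sums

variable {R : Type*} [CommRing R]

/-- The product of x^w and x^(W - w) is x^W = 0, so each term is 1 plus a correction in x^w and one
in x^(W - w). Both corrections have the same sum by the symmetry w ↦ W - w. -/
theorem sum_parallel {x : R} {N : ℕ} (hx : x ^ N = 0) {W : ℕ} (hW : 2 * N ≤ W) (hN : 1 ≤ N) :
    ∑ w ∈ Ico 1 W, (1 - x ^ (W - w)) ^ 2 * (1 - x ^ w) ^ 2 = (W : R) - 1 + parallelTerm x N := by
  have h1 : ∀ w ∈ Ico 1 W, (1 - x ^ (W - w)) ^ 2 * (1 - x ^ w) ^ 2 =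
      1 + (((1 - x ^ w) ^ 2 - 1) + ((1 - x ^ (W - w)) ^ 2 - 1)) := by
    intro w hw
    rw [mem_Ico] at hw
    have : x ^ w * x ^ (W - w) = 0 := by
      rw [← pow_add]; exact pow_eq_zero_of_ge hx (by omega)
    linear_combination (4 - 2 * x ^ w - 2 * x ^ (W - w) + x ^ w * x ^ (W - w)) * this
  have h2 : ∑ w ∈ Ico 1 W, ((1 - x ^ w) ^ 2 - 1) = ∑ w ∈ Ico 1 N, ((1 - x ^ w) ^ 2 - 1) := by
    refine (sum_subset (Ico_subset_Ico_right (by omega)) fun w hw hw' => ?_).symm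
    rw [mem_Ico] at hw hw'
    rw [pow_eq_zero_of_ge hx (by omega)]; ring
  have h3 : ∑ w ∈ Ico 1 W, ((1 - x ^ (W - w)) ^ 2 - 1) = ∑ w ∈ Ico 1 W, ((1 - x ^ w) ^ 2 - 1) := by
    refine sum_nbij' (fun w => W - w) (fun w => W - w) ?_ ?_ ?_ ?_ ?_
    · intro w hw; rw [mem_Ico] at hw ⊢; omega
    · intro w hw; rw [mem_Ico] at hw ⊢; omega
    · intro w hw; rw [mem_Ico] at hw; omega
    · intro w hw; rw [mem_Ico] at hw; omega
    · intro w _; rfl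
  rw [sum_congr rfl h1, sum_add_distrib, sum_add_distrib, h3, h2, ← sum_add_distrib, parallelTerm]
  rw [sum_const, Nat.card_Ico, nsmul_eq_mul, mul_one, Nat.cast_sub (by omega), Nat.cast_one]
  congr 1
  exact sum_congr rfl fun w _ => by ring

theorem crossing_le_sum {b : ℕ} (d : Fin b → ℕ) {c : ℕ} (hc : 1 ≤ c) : crossing d c ≤ ∑ s, d s :=
  sum_le_sum fun s _ => by split_ifs <;> omega

namespace Code

variable {a b b' : ℕ}

theorem term_eq_zero {κ : Code a b b'} {x : R} {N : ℕ} (hx : x ^ N = 0)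
    (h : N ≤ slopeInv κ.L + slopeInv κ.R + (κ.w * (κ.j - κ.i - 1) + ∑ s, κ.sink.2 s +
      ∑ s, κ.source.2 s)) : κ.term x = 0 := by
  have : κ.term x = x ^ (slopeInv κ.L + slopeInv κ.R + (κ.w * (κ.j - κ.i - 1) + ∑ s, κ.sink.2 s +
      ∑ s, κ.source.2 s)) * ((∏ t ∈ Ico 1 a, (1 - x ^ (κ.chainWeight t).toNat) ^ 2) *
        (1 - x ^ κ.w) ^ 2 * ((1 - x) ^ b * (1 - x) ^ b')) := by
    rw [term]; ring
  rw [this, pow_eq_zero_of_ge hx h, zero_mul]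

variable {ML MR : Multiset ℤ} {L R' : Fin a → ℤ} {x : R} {N : ℕ}

open Classical in
/-- The sum over the possible ends of floor diagrams. -/
theorem sum_ends_eq {F : (Fin b → ℕ) × (Fin b → ℕ) → (Fin b' → ℕ) × (Fin b' → ℕ) → R} {i j g w : ℕ} :
    ∑ p ∈ endBox b a, ∑ q ∈ endBox b' a,
      (if (⟨L, R', i, j, g, w, p, q⟩ : Code a b b').Valid ML MR then F p q else 0) =
    ∑ p ∈ endSet b a (2 * a - 1 - g), ∑ q ∈ endSet b' a g,
      (if (⟨L, R', i, j, g, w, p, q⟩ : Code a b b').Valid ML MR then F p q else 0) := by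
  rw [← sum_subset (endSet_subset b a (2 * a - 1 - g)) fun p _ hp => ?_]
  · refine sum_congr rfl fun p _ => ?_
    exact (sum_subset (endSet_subset b' a g) fun q _ hq => if_neg fun h => hq h.source_mem).symm
  · exact sum_eq_zero fun q _ => if_neg fun h => hp h.sink_mem

/-- The contribution of a pair of families of ends. -/
def endTerm (x : R) (p : (Fin b → ℕ) × (Fin b → ℕ)) (q : (Fin b' → ℕ) × (Fin b' → ℕ)) : R :=
  ((1 - x) ^ b * x ^ ∑ s, p.2 s) * ((1 - x) ^ b' * x ^ ∑ s, q.2 s)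

theorem endTerm_eq_zero (hx : x ^ N = 0) {p : (Fin b → ℕ) × (Fin b → ℕ)}
    {q : (Fin b' → ℕ) × (Fin b' → ℕ)} (h : N ≤ ∑ s, p.2 s + ∑ s, q.2 s) : endTerm x p q = 0 := by
  have : endTerm x p q = (1 - x) ^ b * (1 - x) ^ b' * x ^ (∑ s, p.2 s + ∑ s, q.2 s) := by
    rw [endTerm]; ring
  rw [this, pow_eq_zero_of_ge hx h, mul_zero]

/-- From a flow of at least 4 N, the ends and the additional edge take fewer than N each. A chain
edge of weight at least N contributes the factor 1. -/
theorem chainWeight_lower (hflow : ∀ t, 1 ≤ t → t < a → 4 * (N : ℤ) ≤ levelFlow b' L R' t)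
    {i j g w : ℕ} {p : (Fin b → ℕ) × (Fin b → ℕ)} {q : (Fin b' → ℕ) × (Fin b' → ℕ)}
    (hpq : ∑ s, p.2 s + ∑ s, q.2 s < N) {t : ℕ} (h1 : 1 ≤ t) (h2 : t < a)
    (hw : i < t ∧ t ≤ j → w < N) :
    (N : ℤ) ≤ (⟨L, R', i, j, g, w, p, q⟩ : Code a b b').chainWeight t := by
  have h3 := crossing_le_sum p.2 (c := a - t) (by omega)
  have h4 := crossing_le_sum q.2 (c := t) h1
  have h5 := hflow t h1 h2
  simp only [chainWeight]
  split_ifs with h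
  · have := hw h; omega
  · omega

open Classical in
/-- The contribution of an edge that skips floors. -/
theorem sum_ends_long (hx : x ^ N = 0)
    (hflow : ∀ t, 1 ≤ t → t < a → 4 * (N : ℤ) ≤ levelFlow b' L R' t)
    (hL : univ.val.map L = ML) (hR : univ.val.map R' = MR) {i j g w : ℕ} (hij : i + 2 ≤ j)
    (hj : j < a) (hg : 2 * i < g) (hg' : g ≤ 2 * j) (hw : 1 ≤ w) (hwN : w < N) :
    ∑ p ∈ endBox b a, ∑ q ∈ endBox b' a,
      (if (⟨L, R', i, j, g, w, p, q⟩ : Code a b b').Valid ML MR then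
        (⟨L, R', i, j, g, w, p, q⟩ : Code a b b').term x else 0) =
    x ^ (slopeInv L + slopeInv R') * (x ^ (w * (j - i - 1)) * (1 - x ^ w) ^ 2 *
      ((∑ p ∈ endSet b a (2 * a - 1 - g), (1 - x) ^ b * x ^ ∑ s, p.2 s) *
        ∑ q ∈ endSet b' a g, (1 - x) ^ b' * x ^ ∑ s, q.2 s)) := by
  rw [sum_ends_eq (F := fun p q => (⟨L, R', i, j, g, w, p, q⟩ : Code a b b').term x)]
  rw [sum_mul_sum, mul_sum, mul_sum]
  refine sum_congr rfl fun p hp => ?_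
  rw [mul_sum, mul_sum]
  refine sum_congr rfl fun q hq => ?_
  change _ = x ^ (slopeInv L + slopeInv R') * (x ^ (w * (j - i - 1)) * (1 - x ^ w) ^ 2 *
    endTerm x p q)
  -- If the ends are displaced by fewer than N floors in all, every chain edge is heavy and
  -- contributes 1. Otherwise both sides vanish.
  by_cases hpq : ∑ s, p.2 s + ∑ s, q.2 s < N
  · have hch := fun t h1 h2 => chainWeight_lower (g := g) (i := i) (j := j) (w := w) hflow hpq
      (t := t) h1 h2 fun _ => hwN
    rw [if_pos]
    · rw [term, prod_congr rfl fun t ht => ?_, prod_const_one]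
      · simp only [endTerm]; ring
      · have := hch t (mem_Ico.mp ht).1 (mem_Ico.mp ht).2
        rw [pow_eq_zero_of_ge hx (by omega)]; ring
    · exact ⟨hL, hR, by simp only; omega, hj, hg, hg', by simp only; omega, hw, hp, hq,
        fun t h1 h2 => lt_of_lt_of_le (by omega) (hch t h1 h2)⟩
  · rw [endTerm_eq_zero hx (not_lt.mp hpq), mul_zero, mul_zero]
    split_ifs with h
    · exact term_eq_zero hx (by simp only; omega)
    · rfl

open Classical in
/-- The contribution of an edge that is parallel to an edge of the chain. -/
theorem sum_ends_parallel (hx : x ^ N = 0) (hN : 1 ≤ N)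
    (hflow : ∀ t, 1 ≤ t → t < a → 4 * (N : ℤ) ≤ levelFlow b' L R' t)
    (hL : univ.val.map L = ML) (hR : univ.val.map R' = MR) {t B : ℕ} (h1 : 1 ≤ t) (h2 : t < a)
    (hB : levelFlow b' L R' t ≤ B) :
    ∑ w ∈ range B, ∑ p ∈ endBox b a, ∑ q ∈ endBox b' a,
      (if (⟨L, R', t - 1, t, 2 * t, w, p, q⟩ : Code a b b').Valid ML MR then
        (⟨L, R', t - 1, t, 2 * t, w, p, q⟩ : Code a b b').term x else 0) =
    x ^ (slopeInv L + slopeInv R') *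
      ∑ p ∈ endSet b a (2 * a - 1 - 2 * t), ∑ q ∈ endSet b' a (2 * t), endTerm x p q *
        ((levelFlow b' L R' t : R) - crossing p.2 (a - t) - crossing q.2 t - 1 +
          parallelTerm x N) := by
  simp only [sum_ends_eq (F := fun p q => (⟨L, R', t - 1, t, 2 * t, _, p, q⟩ : Code a b b').term x)]
  rw [sum_comm, mul_sum]
  refine sum_congr rfl fun p hp => ?_
  rw [sum_comm, mul_sum]
  refine sum_congr rfl fun q hq => ?_
  by_cases hpq : ∑ s, p.2 s + ∑ s, q.2 s < N
  · have hc1 := crossing_le_sum p.2 (c := a - t) (by omega)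
    have hc2 := crossing_le_sum q.2 (c := t) h1
    have hf := hflow t h1 h2
    -- W is the total weight of the two parallel edges. Positivity of the chain weight W - w
    -- restricts w to the range from 1 to W - 1, where the chain edge and the additional edge share
    -- W.
    obtain ⟨W, hW⟩ : ∃ W : ℕ, (W : ℤ) = levelFlow b' L R' t - crossing p.2 (a - t) -
        crossing q.2 t := ⟨(levelFlow b' L R' t - crossing p.2 (a - t) - crossing q.2 t).toNat,
          Int.toNat_of_nonneg (by omega)⟩
    have hWR : (W : R) = (levelFlow b' L R' t : R) - crossing p.2 (a - t) - crossing q.2 t := by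
      have := congrArg (Int.cast : ℤ → R) hW
      push_cast at this
      exact this
    rw [← hWR, ← sum_parallel hx (by omega) hN, mul_sum, mul_sum]
    have hcw : ∀ w : ℕ, (⟨L, R', t - 1, t, 2 * t, w, p, q⟩ : Code a b b').chainWeight t =
        (W : ℤ) - w := by
      intro w
      simp only [chainWeight]
      rw [if_pos ⟨by omega, le_rfl⟩, hW]
    have hother : ∀ w t', 1 ≤ t' → t' < a → t' ≠ t →
        (N : ℤ) ≤ (⟨L, R', t - 1, t, 2 * t, w, p, q⟩ : Code a b b').chainWeight t' :=
      fun w t' h1' h2' hne => chainWeight_lower hflow hpq h1' h2' (fun h => by omega)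
    rw [← sum_subset (s₁ := Ico 1 W) (s₂ := range B)]
    · refine sum_congr rfl fun w hw => ?_
      rw [mem_Ico] at hw
      rw [if_pos]
      · rw [term, prod_eq_single t]
        · rw [hcw, show ((W : ℤ) - w).toNat = W - w by omega]
          simp only [endTerm]
          rw [show t - (t - 1) - 1 = 0 by omega]
          ring
        · intro t' ht' hne
          rw [mem_Ico] at ht'
          have := hother w t' ht'.1 ht'.2 hne
          rw [pow_eq_zero_of_ge hx (by omega)]; ring
        · intro h; exact absurd (mem_Ico.mpr ⟨h1, h2⟩) h
      · refine ⟨hL, hR, by simp only; omega, h2, by simp only; omega, le_rfl,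
          fun _ => rfl, hw.1, hp, hq, fun t' h1' h2' => ?_⟩
        by_cases hne : t' = t
        · rw [hne, hcw]; omega
        · exact lt_of_lt_of_le (by omega) (hother w t' h1' h2' hne)
    · intro w hw
      rw [mem_Ico] at hw
      rw [mem_range]; omega
    · intro w _ hw
      rw [if_neg]
      intro h
      have h3 := h.w_pos
      have h4 := h.chainWeight_pos t h1 h2
      rw [hcw] at h4
      simp only at h3
      exact hw (mem_Ico.mpr ⟨h3, by omega⟩)
  · rw [endTerm_eq_zero hx (not_lt.mp hpq), zero_mul, mul_zero]
    refine sum_eq_zero fun w _ => ?_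
    split_ifs with h
    · exact term_eq_zero hx (by simp only; omega)
    · rfl

open Classical in
/-- The sum over all codes with given sequences of slopes. -/
theorem sum_codes (hx : x ^ N = 0) (hN : 1 ≤ N) (ha : 2 * N + 1 ≤ a) (hb : N ≤ b) (hb' : N ≤ b')
    (hflow : ∀ t, 1 ≤ t → t < a → 4 * (N : ℤ) ≤ levelFlow b' L R' t)
    (hL : univ.val.map L = ML) (hR : univ.val.map R' = MR) {B : ℕ} (hNB : N ≤ B)
    (hB : ∀ t, 1 ≤ t → t < a → levelFlow b' L R' t ≤ B) (st sb : R)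
    (hbot : ∀ t, 1 ≤ t → t < N → (levelFlow b' L R' t : R) = b' + t * sb)
    (htop : ∀ c, 1 ≤ c → c < N → (levelFlow b' L R' (a - c) : R) = b + c * st) :
    ∑ i ∈ range a, ∑ j ∈ range a, ∑ g ∈ range (2 * a), ∑ w ∈ range B,
      ∑ p ∈ endBox b a, ∑ q ∈ endBox b' a,
        (if (⟨L, R', i, j, g, w, p, q⟩ : Code a b b').Valid ML MR then
          (⟨L, R', i, j, g, w, p, q⟩ : Code a b b').term x else 0) =
    x ^ (slopeInv L + slopeInv R') * (geomProd x N a ^ 4 *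
      (∑ t ∈ Ico 1 a, (levelFlow b' L R' t : R) - (a - 1) -
        12 * ∑ t ∈ Ico 1 a, (t : R) * geomTail x N t +
          (st + sb) * ∑ t ∈ Ico 1 a, (t : R) * geomTail x N t)) := by
  rw [sum_edge_positions]
  swap
  · intro i j g hi hj h
    refine sum_eq_zero fun w _ => sum_eq_zero fun p _ => sum_eq_zero fun q _ => if_neg fun hv => h
      ⟨hv.lt, hv.lt_g, hv.g_le, hv.parallel⟩
  -- The two sums on the left of `sum_levels` are the contributions of the edges parallel to the
  -- chain and of those that skip floors.
  rw [← sum_levels hx ha b b' st sb _ hbot htop, mul_add, mul_add]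
  congr 1
  · rw [mul_sum, mul_sum]
    refine sum_congr rfl fun t ht => ?_
    rw [mem_Ico] at ht
    rw [sum_ends_parallel hx hN hflow hL hR ht.1 ht.2 (hB t ht.1 ht.2)]
    congr 1
    have s1 := sum_endSet_eq hx (φ := 2 * a - 1 - 2 * t) hb (by omega : N ≤ a) (by omega) (by omega)
    have s2 := sum_endSet_eq hx (φ := 2 * t) hb' (by omega : N ≤ a) (by omega) (by omega)
    have s3 := sum_endSet_card hx (φ := 2 * a - 1 - 2 * t) (c := a - t) hb (by omega : N ≤ a)
      (by omega) (by omega) (by omega)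
    have s4 := sum_endSet_card hx (φ := 2 * t) (c := t) hb' (by omega : N ≤ a)
      (by omega) (by omega) (by omega)
    rw [show (2 * a - 1 - 2 * t + 1) / 2 = a - t by omega] at s1
    rw [show (2 * t + 1) / 2 = t by omega] at s2
    have e1 : ∀ (p : (Fin b → ℕ) × (Fin b → ℕ)) (q : (Fin b' → ℕ) × (Fin b' → ℕ)),
        endTerm x p q * ((levelFlow b' L R' t : R) - crossing p.2 (a - t) - crossing q.2 t - 1 +
          parallelTerm x N) =
        ((1 - x) ^ b * x ^ ∑ s, p.2 s) * (((1 - x) ^ b' * x ^ ∑ s, q.2 s) *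
          ((levelFlow b' L R' t : R) - 1 + parallelTerm x N)) -
        ((1 - x) ^ b * (x ^ ∑ s, p.2 s) * ∑ s, (if a - t ≤ p.2 s then 1 else 0)) *
          ((1 - x) ^ b' * x ^ ∑ s, q.2 s) -
        ((1 - x) ^ b * x ^ ∑ s, p.2 s) *
          ((1 - x) ^ b' * (x ^ ∑ s, q.2 s) * ∑ s, (if t ≤ q.2 s then 1 else 0)) := by
      intro p q
      simp only [endTerm, crossing]
      push_cast
      ring
    simp only [e1, sum_sub_distrib]
    simp only [← mul_sum, ← sum_mul, s1, s2, s3, s4]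
    ring
  · have e1 : ∀ i ∈ range a, ∀ j ∈ Ico (i + 2) a, ∀ g ∈ Ioc (2 * i) (2 * j),
        ∑ w ∈ range B, ∑ p ∈ endBox b a, ∑ q ∈ endBox b' a,
        (if (⟨L, R', i, j, g, w, p, q⟩ : Code a b b').Valid ML MR then
          (⟨L, R', i, j, g, w, p, q⟩ : Code a b b').term x else 0) =
        ∑ w ∈ Ico 1 N, x ^ (slopeInv L + slopeInv R') * (geomProd x N a ^ 4 *
          (x ^ (w * (j - i - 1)) * (1 - x ^ w) ^ 2 *
            ((1 + geomTail x N (a - (g + 1) / 2)) * (1 + geomTail x N ((g + 1) / 2))))) := by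
      intro i hi j hj g hg
      simp only [mem_range, mem_Ico, mem_Ioc] at hi hj hg
      rw [← sum_subset (s₁ := Ico 1 N) (s₂ := range B)]
      · refine sum_congr rfl fun w hw => ?_
        rw [mem_Ico] at hw
        rw [sum_ends_long hx hflow hL hR hj.1 hj.2 hg.1 hg.2 hw.1 hw.2]
        rw [sum_endSet_eq hx hb (by omega : N ≤ a) (by omega) (by omega),
          sum_endSet_eq hx hb' (by omega : N ≤ a) (by omega) (by omega),
          show (2 * a - 1 - g + 1) / 2 = a - (g + 1) / 2 by omega]
        ring
      · intro w hw
        rw [mem_Ico] at hw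
        rw [mem_range]; omega
      -- Weight 0 is not valid, and a weight w ≥ N costs at least x^w because the edge skips a
      -- floor.
      · intro w _ hw
        rw [mem_Ico] at hw
        refine sum_eq_zero fun p _ => sum_eq_zero fun q _ => ?_
        split_ifs with h
        · have := h.w_pos
          simp only at this
          refine term_eq_zero hx ?_
          simp only
          have h3 : w * 1 ≤ w * (j - i - 1) := Nat.mul_le_mul_left _ (by omega)
          omega
        · rfl
    refine (sum_congr rfl fun i hi => sum_congr rfl fun j hj => sum_congr rfl fun g hg =>
      e1 i hi j hj g hg).trans ?_
    have e2 := sum_long_edges x N a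
      (fun t => (1 + geomTail x N (a - t)) * (1 + geomTail x N t))
    rw [← e2]
    simp only [mul_sum]
    rw [sum_comm (s := Ico 1 N)]
    refine sum_congr rfl fun i _ => ?_
    rw [sum_comm (s := Ico 1 N)]
    refine sum_congr rfl fun j _ => ?_
    rw [sum_comm (s := Ico 1 N)]

end Code

end ToricRefined

namespace ToricRefined

open Finset
open scoped LaurentPolynomial PowerSeries

/-! ### The invariant of a polygon with long sides -/

section Flow

variable {a b' : ℕ} {L R : Fin a → ℤ}

/-- The slopes of the floor u are subtracted at each of the a - 1 - u levels above it. -/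
theorem sum_Ico_levelFlow (ha : 1 ≤ a) : ∑ t ∈ Ico 1 a, levelFlow b' L R t =
    ((a : ℤ) - 1) * b' - ∑ u : Fin a, ((a : ℤ) - 1 - u) * L u -
      ∑ u : Fin a, ((a : ℤ) - 1 - u) * R u := by
  simp only [levelFlow, sum_sub_distrib]
  rw [sum_comm, sub_sub, ← sum_add_distrib, sum_const, Nat.card_Ico, nsmul_eq_mul,
    Nat.cast_sub ha, Nat.cast_one]
  congr 1
  refine sum_congr rfl fun u _ => ?_
  rw [← sum_filter, sum_const]
  have : (Ico 1 a).filter (fun t => (u : ℕ) < t) = Ioo (u : ℕ) a := by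
    ext t; simp only [mem_filter, mem_Ico, mem_Ioo]; omega
  rw [this, Nat.card_Ioo, nsmul_eq_mul, Nat.cast_sub (by omega), Nat.cast_sub (by omega)]
  push_cast
  ring

theorem levelFlow_bottom {s : ℤ} {N : ℕ} (h : ∀ u : Fin a, (u : ℕ) < N → L u + R u = s) (t : ℕ)
    (ht : t ≤ N) (ha : t ≤ a) : levelFlow b' L R t = b' - t * s := by
  induction t with
  | zero => simp [levelFlow_zero]
  | succ t ih =>
    have h1 := levelFlow_succ b' L R ⟨t, by omega⟩
    simp only at h1
    rw [h1, ih (by omega) (by omega), h ⟨t, by omega⟩ (by simp only; omega)]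
    push_cast
    ring

theorem levelFlow_sub {s : ℤ} {N : ℕ} (h : ∀ u : Fin a, a ≤ u + N → L u + R u = s) (c : ℕ)
    (hc : c ≤ N) (ha : c ≤ a) : levelFlow b' L R (a - c) = levelFlow b' L R a + c * s := by
  induction c with
  | zero => simp
  | succ c ih =>
    have h1 := levelFlow_succ b' L R ⟨a - (c + 1), by omega⟩
    simp only at h1
    rw [show a - (c + 1) + 1 = a - c by omega, ih (by omega) (by omega),
      h ⟨a - (c + 1), by omega⟩ (by simp only; omega)] at h1
    push_cast
    linarith

/-- Partial sums of the slopes lie below the chord up to inversions (`mul_sum_le_of_slopeInv`), so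
the flow lies above the linear interpolation between its values at the levels 0 and a, up to the
same error. -/
theorem levelFlow_lower {t : ℕ} (ht : t ≤ a) :
    (a : ℤ) * b' - t * (∑ u, L u + ∑ u, R u) - (slopeInv L + slopeInv R) ≤
      a * levelFlow b' L R t := by
  have h1 := mul_sum_le_of_slopeInv L t ht
  have h2 := mul_sum_le_of_slopeInv R t ht
  have h3 : ∑ u : Fin a, (if (u : ℕ) < t then L u + R u else 0) =
      ∑ u : Fin a, (if (u : ℕ) < t then L u else 0) +
        ∑ u : Fin a, (if (u : ℕ) < t then R u else 0) := by
    rw [← sum_add_distrib]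
    refine sum_congr rfl fun u _ => ?_
    split_ifs <;> simp
  rw [levelFlow, h3]
  nlinarith

end Flow

open Classical in
/-- The reversed invariant of a polygon with long sides, modulo `X ^ N`. -/
theorem map_reversedInvariant_eq {n : ℕ} [NeZero n] {Δ : LatticePolygon n} {S : Type*}
    [CommRing S] (f : ℤ⟦X⟧ →+* S) {N : ℕ} (hx : f PowerSeries.X ^ N = 0) (hN : 1 ≤ N)
    {kL kR : ℤ} {rL rR : ℕ} {mL mR : ℕ → ℕ} {W : ℤ}
    (hL : ∀ L, L ∈ arrangements Δ.height kL rL mL ↔ univ.val.map L = Δ.leftSlopes)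
    (hR : ∀ L, L ∈ arrangements Δ.height kR rR mR ↔ univ.val.map L = Δ.rightSlopes)
    (hbal : Δ.height * kL + ∑ t ∈ range rL, (mL (t + 1) : ℤ) +
      (Δ.height * kR + ∑ t ∈ range rR, (mR (t + 1) : ℤ)) = (Δ.bottomLength : ℤ) - Δ.topLength)
    (hW : 2 * W = 2 * ((Δ.height - 1) * Δ.bottomLength) -
      (kL * (Δ.height * (Δ.height - 1)) + ∑ t ∈ range rL, (mL (t + 1) : ℤ) * (mL (t + 1) - 1)) -
      (kR * (Δ.height * (Δ.height - 1)) + ∑ t ∈ range rR, (mR (t + 1) : ℤ) * (mR (t + 1) - 1)))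
    (hA : Δ.twiceArea = Δ.topLength + Δ.bottomLength + 2 * W)
    (ha : 2 * N + 1 ≤ Δ.height) (hb : 4 * N + 1 ≤ Δ.topLength) (hb' : 4 * N + 1 ≤ Δ.bottomLength)
    (hmL : ∀ t, 1 ≤ t → t < rL → mL (t + 1) + 2 * N ≤ mL t)
    (hmL1 : 1 ≤ rL → mL 1 + 2 * N ≤ Δ.height) (hmLr : 1 ≤ rL → 2 * N ≤ mL rL)
    (hmR : ∀ t, 1 ≤ t → t < rR → mR (t + 1) + 2 * N ≤ mR t)
    (hmR1 : 1 ≤ rR → mR 1 + 2 * N ≤ Δ.height) (hmRr : 1 ≤ rR → 2 * N ≤ mR rR) :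
    f (reversedInvariant Δ 1) = geomProd (f PowerSeries.X) N Δ.height ^ (rL + rR + 4) *
      ((W - (Δ.height - 1) : ℤ) -
        12 * ∑ t ∈ Ico 1 Δ.height, (t : S) * geomTail (f PowerSeries.X) N t) := by
  set a := Δ.height with hadef
  set x := f PowerSeries.X with hxdef
  set b := Δ.topLength with hbdef
  set b' := Δ.bottomLength with hbdef'
  set AL := arrangements a kL rL mL with hAL
  set AR := arrangements a kR rR mR with hAR
  have hsum : ∀ L ∈ AL, ∀ R ∈ AR, ∑ u, L u + ∑ u, R u = (b' : ℤ) - b := by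
    intro L h1 R h2
    rw [sum_arrangement h1, sum_arrangement h2, hbal]
  have hWsum : ∀ L ∈ AL, ∀ R ∈ AR, ∑ t ∈ Ico 1 a, levelFlow b' L R t +
      slopeInv L + slopeInv R = W := by
    intro L h1 R h2
    rw [sum_Ico_levelFlow (by omega)]
    have e1 := two_mul_sum_arrangement h1
    have e2 := two_mul_sum_arrangement h2
    linarith
  have hflow : ∀ L ∈ AL, ∀ R ∈ AR, slopeInv L + slopeInv R < N → ∀ t, 1 ≤ t → t < a →
      4 * (N : ℤ) ≤ levelFlow b' L R t := by
    intro L h1 R h2 hinv t ht1 ht2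
    have e1 := levelFlow_lower (b' := b') (L := L) (R := R) ht2.le
    rw [hsum L h1 R h2] at e1
    by_contra hlt
    have hlt' : levelFlow b' L R t ≤ 4 * N - 1 := by omega
    have e3 : (a : ℤ) * levelFlow b' L R t ≤ a * (4 * N - 1) :=
      mul_le_mul_of_nonneg_left hlt' (by positivity)
    have e4 : (t : ℤ) * (4 * N + 1) ≤ t * b :=
      mul_le_mul_of_nonneg_left (by exact_mod_cast hb) (by positivity)
    have e5 : ((a : ℤ) - t) * (4 * N + 1) ≤ (a - t) * b' :=
      mul_le_mul_of_nonneg_left (by exact_mod_cast hb') (by omega)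
    have e6 : ((slopeInv L : ℤ) + slopeInv R) < N := by exact_mod_cast hinv
    have e7 : (2 * (N : ℤ) + 1) ≤ a := by exact_mod_cast ha
    nlinarith
  obtain ⟨B, hNB, hB⟩ : ∃ B : ℕ, N ≤ B ∧ ∀ L ∈ AL, ∀ R ∈ AR, ∀ t, 1 ≤ t → t < a →
      levelFlow b' L R t ≤ B := by
    refine ⟨N + ∑ L ∈ AL, ∑ R ∈ AR, ∑ t ∈ range a, (levelFlow b' L R t).toNat, by omega, ?_⟩
    intro L h1 R h2 t ht1 ht2
    have e1 : (levelFlow b' L R t).toNat ≤ ∑ t ∈ range a, (levelFlow b' L R t).toNat :=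
      single_le_sum (f := fun t => (levelFlow b' L R t).toNat) (fun _ _ => Nat.zero_le _)
        (mem_range.mpr ht2)
    have e2 : ∑ t ∈ range a, (levelFlow b' L R t).toNat ≤
        ∑ R ∈ AR, ∑ t ∈ range a, (levelFlow b' L R t).toNat :=
      single_le_sum (f := fun R => ∑ t ∈ range a, (levelFlow b' L R t).toNat)
        (fun _ _ => Nat.zero_le _) h2
    have e3 : ∑ R ∈ AR, ∑ t ∈ range a, (levelFlow b' L R t).toNat ≤
        ∑ L ∈ AL, ∑ R ∈ AR, ∑ t ∈ range a, (levelFlow b' L R t).toNat :=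
      single_le_sum (f := fun L => ∑ R ∈ AR, ∑ t ∈ range a, (levelFlow b' L R t).toNat)
        (fun _ _ => Nat.zero_le _) h1
    omega
  have hfl' : ∀ L ∈ AL, ∀ R ∈ AR, slopeInv L + slopeInv R < N → ∀ t, 1 ≤ t → t < a →
      (N : ℤ) ≤ levelFlow b' L R t := fun L h1 R h2 h t ht1 ht2 => by
    have := hflow L h1 R h2 h t ht1 ht2
    omega
  rw [map_reversedInvariant f hx hL hR (by omega) hsum hWsum hA hfl' hB, Code.sum_box]
  set E := ∑ t ∈ Ico 1 a, (t : S) * geomTail x N t with hE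
  -- For given slopes the flows add up to W minus the inversions. The flow varies with slope -(kL +
  -- kR) near the bottom and kL + rL + kR + rR near the top, and these add up to rL + rR.
  have hfix : ∀ L ∈ AL, ∀ R ∈ AR, (∑ i ∈ range a, ∑ j ∈ range a, ∑ g ∈ range (2 * a),
      ∑ w ∈ range B, ∑ p ∈ endBox b a, ∑ q ∈ endBox b' a,
        (if (⟨L, R, i, j, g, w, p, q⟩ : Code a b b').Valid Δ.leftSlopes Δ.rightSlopes then
          (⟨L, R, i, j, g, w, p, q⟩ : Code a b b').term x else 0)) =
      geomProd x N a ^ 4 * (((W - (a - 1) : ℤ) - 12 * E + (rL + rR) * E) *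
        (x ^ slopeInv L * x ^ slopeInv R) - (x ^ slopeInv L * slopeInv L) * x ^ slopeInv R -
          x ^ slopeInv L * (x ^ slopeInv R * slopeInv R)) := by
    intro L h1 R h2
    by_cases hinv : slopeInv L + slopeInv R < N
    · have hbL : ∀ u : Fin a, (u : ℕ) < N → L u + R u = kL + kR := fun u hu => by
        rw [eq_bot_of_slopeInv_lt h1 hmL1 (by omega) hu,
          eq_bot_of_slopeInv_lt h2 hmR1 (by omega) hu]
      have htL : ∀ u : Fin a, a ≤ u + N → L u + R u = (kL + rL) + (kR + rR) := fun u hu => by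
        rw [eq_top_of_slopeInv_lt h1 hmLr (by omega) hu,
          eq_top_of_slopeInv_lt h2 hmRr (by omega) hu]
      have hbot : ∀ t, 1 ≤ t → t < N → (levelFlow b' L R t : S) =
          b' + t * (-(kL + kR : ℤ) : S) := by
        intro t _ ht
        rw [levelFlow_bottom hbL t ht.le (by omega)]
        push_cast; ring
      have htop : ∀ c, 1 ≤ c → c < N → (levelFlow b' L R (a - c) : S) =
          b + c * (((kL + rL) + (kR + rR) : ℤ) : S) := by
        intro c _ hc
        rw [levelFlow_sub htL c hc.le (by omega), levelFlow_top, hsum L h1 R h2]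
        push_cast; ring
      rw [Code.sum_codes hx hN ha (by omega) (by omega) (hflow L h1 R h2 hinv) ((hL L).mp h1)
        ((hR R).mp h2) hNB (hB L h1 R h2) _ _ hbot htop]
      have e1 := congrArg (Int.cast : ℤ → S) (hWsum L h1 R h2)
      push_cast at e1
      rw [← hE, pow_add]
      push_cast
      linear_combination geomProd x N a ^ 4 * x ^ slopeInv L * x ^ slopeInv R * e1
    · have hz : x ^ slopeInv L * x ^ slopeInv R = 0 := by
        rw [← pow_add]; exact pow_eq_zero_of_ge hx (not_lt.mp hinv)
      have hcost : ∀ i j g w p q, (⟨L, R, i, j, g, w, p, q⟩ : Code a b b').term x = 0 :=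
        fun i j g w p q => Code.term_eq_zero hx (by simp only; omega)
      simp only [hcost, ite_self, sum_const_zero]
      linear_combination -geomProd x N a ^ 4 * (((W - (a - 1) : ℤ) - 12 * E + (rL + rR) * E) -
        slopeInv L - slopeInv R) * hz
  rw [sum_congr rfl fun L h1 => sum_congr rfl fun R h2 => hfix L h1 R h2]
  have s1 := sum_arrangements (a := a) (k₀ := kL) hx (A := a) (by omega) hmL (fun h => by have := hmL1 h; omega)
    (fun h => by have := hmLr h; omega)
  have s2 := sum_arrangements (a := a) (k₀ := kR) hx (A := a) (by omega) hmR (fun h => by have := hmR1 h; omega)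
    (fun h => by have := hmRr h; omega)
  have s3 := sum_arrangements_inv (a := a) (k₀ := kL) hx (A := a) (by omega) hmL
    (fun h => by have := hmL1 h; omega) (fun h => by have := hmLr h; omega)
  have s4 := sum_arrangements_inv (a := a) (k₀ := kR) hx (A := a) (by omega) hmR
    (fun h => by have := hmR1 h; omega) (fun h => by have := hmRr h; omega)
  simp only [← mul_sum, sum_sub_distrib, ← sum_mul]
  rw [← hAL] at s1 s3
  rw [← hAR] at s2 s4
  rw [← hE] at s3 s4
  -- The inversions of L and R have weighted sums rL E and rR E times the product of the series,
  -- which cancels (rL + rR) E and leaves -12 E.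
  rw [s1, s2, s3, s4]
  ring

end ToricRefined

/-! ### Reduction modulo a power of the variable -/

namespace ToricRefined

open Finset
open scoped PowerSeries PowerSeries.WithPiTopology

/-- Reduction modulo `X ^ N`. -/
noncomputable abbrev truncHom (N : ℕ) : ℤ⟦X⟧ →+* ℤ⟦X⟧ ⧸ Ideal.span {(PowerSeries.X : ℤ⟦X⟧) ^ N} :=
  Ideal.Quotient.mk _

theorem truncHom_eq_iff {N : ℕ} {φ ψ : ℤ⟦X⟧} :
    truncHom N φ = truncHom N ψ ↔ PowerSeries.X ^ N ∣ φ - ψ := by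
  rw [Ideal.Quotient.eq, Ideal.mem_span_singleton]

theorem truncHom_X_pow (N : ℕ) : truncHom N PowerSeries.X ^ N = 0 := by
  rw [← map_pow, Ideal.Quotient.eq_zero_iff_mem, Ideal.mem_span_singleton]

theorem truncHom_invOfUnit {N j : ℕ} (hj : 1 ≤ j) :
    truncHom N (PowerSeries.invOfUnit (1 - (PowerSeries.X : ℤ⟦X⟧) ^ j) 1) =
      1 + geomTail (truncHom N PowerSeries.X) N j := by
  have h1 := PowerSeries.mul_invOfUnit (1 - (PowerSeries.X : ℤ⟦X⟧) ^ j) 1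
    (by simp [show j ≠ 0 by omega])
  have h2 := congrArg (truncHom N) h1
  rw [map_mul, map_sub, map_one, map_pow] at h2
  have h3 := one_sub_mul_one_add_geomTail (truncHom_X_pow N) hj
  linear_combination (1 + geomTail (truncHom N PowerSeries.X) N j) * h2 -
    truncHom N (PowerSeries.invOfUnit (1 - (PowerSeries.X : ℤ⟦X⟧) ^ j) 1) * h3

/-- By coefficientwise convergence, some finite partial product containing the first a - 1 factors
agrees with the series below degree N. Its other factors are 1 modulo X^N. -/
theorem truncHom_partitionSeries {N a : ℕ} (ha : N ≤ a) :
    truncHom N partitionSeries = geomProd (truncHom N PowerSeries.X) N a := by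
  have hp := hasProd_partitionSeries
  rw [← partitionSeries_eq] at hp
  have hev : ∀ i, ∀ᶠ s : Finset ℕ in Filter.atTop, PowerSeries.coeff i
      (∏ j ∈ s, PowerSeries.invOfUnit (1 - (PowerSeries.X : ℤ⟦X⟧) ^ (j + 1)) 1) =
        PowerSeries.coeff i partitionSeries := by
    intro i
    have h1 := ((PowerSeries.WithPiTopology.continuous_coeff ℤ i).tendsto _).comp hp
    rw [nhds_discrete, Filter.tendsto_pure] at h1
    exact h1
  have hev' : ∀ᶠ s : Finset ℕ in Filter.atTop, ∀ i ∈ range N, PowerSeries.coeff i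
      (∏ j ∈ s, PowerSeries.invOfUnit (1 - (PowerSeries.X : ℤ⟦X⟧) ^ (j + 1)) 1) =
        PowerSeries.coeff i partitionSeries :=
    (Filter.eventually_all_finset _).mpr fun i _ => hev i
  obtain ⟨s, hs1, hs2⟩ := (hev'.and (Filter.eventually_ge_atTop (range (a - 1)))).exists
  have h1 : truncHom N partitionSeries = truncHom N
      (∏ j ∈ s, PowerSeries.invOfUnit (1 - (PowerSeries.X : ℤ⟦X⟧) ^ (j + 1)) 1) := by
    rw [truncHom_eq_iff, PowerSeries.X_pow_dvd_iff]
    intro m hm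
    rw [map_sub, hs1 m (mem_range.mpr hm), sub_self]
  rw [h1, map_prod, geomProd, prod_Ico_eq_prod_range, prod_congr rfl fun j _ =>
    truncHom_invOfUnit (N := N) (j := j + 1) (by omega)]
  rw [← prod_subset hs2 fun j _ hj => ?_]
  · exact prod_congr rfl fun j _ => by rw [add_comm 1 j]
  · rw [mem_range] at hj
    rw [geomTail_eq_zero (truncHom_X_pow N) (by omega), add_zero]

/-- The Lambert expansion ∑ t x^t / (1 - x^t) of the divisor sums. -/
theorem truncHom_eisensteinSeries {N a : ℕ} (ha : N ≤ a) :
    truncHom N eisensteinSeries =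
      ∑ t ∈ Ico 1 a, (t : ℤ⟦X⟧ ⧸ Ideal.span {(PowerSeries.X : ℤ⟦X⟧) ^ N}) *
        geomTail (truncHom N PowerSeries.X) N t := by
  have h1 : ∑ t ∈ Ico 1 a, (t : ℤ⟦X⟧ ⧸ Ideal.span {(PowerSeries.X : ℤ⟦X⟧) ^ N}) *
        geomTail (truncHom N PowerSeries.X) N t = truncHom N
      (∑ t ∈ Ico 1 a, (t : ℤ⟦X⟧) * ∑ k ∈ range N, PowerSeries.X ^ (t * (k + 1))) := by
    simp [geomTail, map_sum]
  rw [h1, truncHom_eq_iff, PowerSeries.X_pow_dvd_iff]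
  intro m hm
  rw [map_sub, sub_eq_zero, eisensteinSeries, PowerSeries.coeff_mk, map_sum,
    ArithmeticFunction.sigma_one_apply]
  have h2 : ∀ t ∈ Ico 1 a, PowerSeries.coeff m ((t : ℤ⟦X⟧) * ∑ k ∈ range N,
      PowerSeries.X ^ (t * (k + 1))) = if t ∈ m.divisors then (t : ℤ) else 0 := by
    intro t ht
    rw [mem_Ico] at ht
    rw [← nsmul_eq_mul, map_nsmul, map_sum, nsmul_eq_mul]
    simp only [PowerSeries.coeff_X_pow]
    split_ifs with hd
    · rw [Nat.mem_divisors] at hd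
      obtain ⟨⟨c, hc⟩, hm0⟩ := hd
      have hc0 : c ≠ 0 := by rintro rfl; simp at hc; exact hm0 hc
      rw [sum_eq_single (c - 1), if_pos, mul_one]
      · rw [hc, Nat.sub_add_cancel (by omega)]
      · intro k _ hk
        rw [if_neg]
        rw [hc]
        intro h
        have := Nat.eq_of_mul_eq_mul_left (by omega) h
        omega
      · intro h
        have : c ≤ m := by rw [hc]; exact Nat.le_mul_of_pos_left _ (by omega)
        rw [mem_range] at h
        omega
    · rw [sum_eq_zero, mul_zero]
      intro k _
      rw [if_neg]
      rintro rfl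
      exact hd (Nat.mem_divisors.mpr ⟨Dvd.intro _ rfl, Nat.mul_ne_zero (by omega) (by omega)⟩)
  rw [sum_congr rfl h2, ← sum_filter]
  push_cast
  refine sum_congr ?_ fun _ _ => rfl
  ext t
  simp only [mem_filter, mem_Ico, Nat.mem_divisors]
  constructor
  · rintro ⟨h3, h4⟩
    refine ⟨⟨Nat.pos_of_dvd_of_pos h3 (by omega), ?_⟩, h3, h4⟩
    have := Nat.le_of_dvd (by omega) h3
    omega
  · exact fun h => h.2

end ToricRefined

namespace ToricRefined

open Finset
open scoped PowerSeries

/-! ### Polynomial functions on the homology, and uniqueness -/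

namespace ToricSurface

variable {n : ℕ} [NeZero n] (X : ToricSurface n)

/-- The polynomial functions with coefficients in `ℚ⟦X⟧`. -/
noncomputable abbrev polynomialFunctions : Subalgebra ℚ⟦X⟧ (X.H2 → ℚ⟦X⟧) :=
  Algebra.adjoin ℚ⟦X⟧ (Set.range fun (φ : X.H2 →+ ℤ) (β : X.H2) => ((φ β : ℤ) : ℚ⟦X⟧))

variable {X}

theorem addHom_mem (φ : X.H2 →+ ℤ) : (fun β => ((φ β : ℤ) : ℚ⟦X⟧)) ∈ X.polynomialFunctions :=
  Algebra.subset_adjoin ⟨φ, rfl⟩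

theorem const_mem (c : ℚ⟦X⟧) : (fun _ => c) ∈ X.polynomialFunctions :=
  X.polynomialFunctions.algebraMap_mem c

/-- A polynomial function restricts to polynomials on lines. -/
theorem exists_polynomial {h : X.H2 → ℚ⟦X⟧} (hh : h ∈ X.polynomialFunctions) (β β₀ : X.H2) :
    ∃ q : Polynomial ℚ⟦X⟧, ∀ k : ℕ, h (β + k • β₀) = q.eval (k : ℚ⟦X⟧) := by
  induction hh using Algebra.adjoin_induction with
  | mem f hf =>
    obtain ⟨φ, rfl⟩ := hf
    refine ⟨Polynomial.C ((φ β : ℤ) : ℚ⟦X⟧) + Polynomial.C ((φ β₀ : ℤ) : ℚ⟦X⟧) * Polynomial.X,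
      fun k => ?_⟩
    simp only [map_add, map_nsmul, Polynomial.eval_add, Polynomial.eval_mul, Polynomial.eval_C,
      Polynomial.eval_X]
    push_cast [nsmul_eq_mul]
    ring
  | algebraMap c => exact ⟨Polynomial.C c, fun k => by simp⟩
  | add f g _ _ hf hg =>
    obtain ⟨q, hq⟩ := hf
    obtain ⟨q', hq'⟩ := hg
    exact ⟨q + q', fun k => by simp [hq, hq']⟩
  | mul f g _ _ hf hg =>
    obtain ⟨q, hq⟩ := hf
    obtain ⟨q', hq'⟩ := hg
    exact ⟨q * q', fun k => by simp [hq, hq']⟩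

/-- A polynomial over power series whose values at large integers tend to zero vanishes at
integers. -/
theorem eval_eq_zero_of_dvd {q : Polynomial ℚ⟦X⟧}
    (hq : ∀ N : ℕ, ∃ K : ℕ, ∀ k : ℕ, K ≤ k → (PowerSeries.X : ℚ⟦X⟧) ^ N ∣ q.eval (k : ℚ⟦X⟧))
    (k : ℕ) : q.eval (k : ℚ⟦X⟧) = 0 := by
  ext m
  -- An integer k is a constant power series, so the coefficient of degree m of the value at k is a
  -- rational polynomial in k. It vanishes for all large k, hence identically.
  set Q : Polynomial ℚ := ∑ i ∈ range (q.natDegree + 1),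
    Polynomial.monomial i (PowerSeries.coeff m (q.coeff i)) with hQ
  have hval : ∀ k : ℕ, PowerSeries.coeff m (q.eval (k : ℚ⟦X⟧)) = Q.eval (k : ℚ) := by
    intro k
    rw [Polynomial.eval_eq_sum_range, map_sum, hQ, Polynomial.eval_finsetSum]
    refine sum_congr rfl fun i _ => ?_
    rw [Polynomial.eval_monomial, ← Nat.cast_pow, ← Nat.cast_pow, mul_comm, ← nsmul_eq_mul,
      map_nsmul, nsmul_eq_mul, mul_comm]
  obtain ⟨K, hK⟩ := hq (m + 1)
  have hroot : Q = 0 := by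
    refine Polynomial.eq_zero_of_infinite_isRoot Q ?_
    refine Set.Infinite.mono (s := (fun k : ℕ => (k : ℚ)) '' Set.Ici K) ?_
      ((Set.Ici_infinite K).image (Nat.cast_injective.injOn))
    rintro _ ⟨k, hk, rfl⟩
    have h1 := PowerSeries.X_pow_dvd_iff.mp (hK k hk) m (by omega)
    rw [hval] at h1
    exact h1
  rw [hval, hroot]
  simp

/-- There is at most one asymptotic refined invariant. -/
theorem IsAsymptoticRefinedInvariant.unique {β₀ : X.H2} (hβ₀ : X.IsAmple β₀) {g : ℕ}
    {F G : X.H2 → ℤ⟦X⟧} (hF : X.IsAsymptoticRefinedInvariant g F)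
    (hG : X.IsAsymptoticRefinedInvariant g G) : F = G := by
  funext β
  have hmem := X.polynomialFunctions.sub_mem hF.1 hG.1
  obtain ⟨q, hq⟩ := exists_polynomial hmem β β₀
  have h0 : q.eval ((0 : ℕ) : ℚ⟦X⟧) = 0 := by
    refine eval_eq_zero_of_dvd (fun N => ?_) 0
    obtain ⟨C₁, h1⟩ := hF.2 N
    obtain ⟨C₂, h2⟩ := hG.2 N
    -- Since β₀ · D_i ≥ 1 for every i, from this k on all intersection numbers of β + k β₀ are
    -- positive and exceed both bounds; the sum serves all i simultaneously.
    refine ⟨∑ i, (1 + C₁ + C₂ + (X.dotDivisor i β).natAbs), fun k hk => ?_⟩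
    have hbig : ∀ i, (1 : ℤ) + C₁ + C₂ ≤ X.dotDivisor i (β + k • β₀) := by
      intro i
      have e1 : 1 + C₁ + C₂ + (X.dotDivisor i β).natAbs ≤
          ∑ i, (1 + C₁ + C₂ + (X.dotDivisor i β).natAbs) :=
        single_le_sum (f := fun i => 1 + C₁ + C₂ + (X.dotDivisor i β).natAbs)
          (fun _ _ => Nat.zero_le _) (mem_univ i)
      rw [map_add, map_nsmul, nsmul_eq_mul]
      have e2 : (k : ℤ) * 1 ≤ k * X.dotDivisor i β₀ :=
        mul_le_mul_of_nonneg_left (hβ₀ i) (by positivity)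
      omega
    have hample : X.IsAmple (β + k • β₀) := fun i => by have := hbig i; omega
    have e1 := h1 _ hample fun i => by have := hbig i; omega
    have e2 := h2 _ hample fun i => by have := hbig i; omega
    have e3 := dvd_sub e2 e1
    rw [sub_sub_sub_cancel_left] at e3
    rw [← hq]
    have e4 := map_dvd (PowerSeries.map (Int.castRingHom ℚ)) e3
    rw [map_pow, PowerSeries.map_X, map_sub] at e4
    exact e4
  have h1 := hq 0
  rw [h0] at h1
  simp only [zero_smul, add_zero, Pi.sub_apply] at h1
  have hinj : Function.Injective (PowerSeries.map (Int.castRingHom ℚ)) :=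
    PowerSeries.map_injective _ Int.cast_injective
  exact hinj (sub_eq_zero.mp h1)

variable (X)

/-- The exponent of the character with prescribed values at the rays `ray 0` and `ray 1`. -/
def interpolate : (ZMod n → ℤ) →ₗ[ℤ] ℤ × ℤ where
  toFun d := ((X.ray 1).2 * d 0 - (X.ray 0).2 * d 1, (X.ray 0).1 * d 1 - (X.ray 1).1 * d 0)
  map_add' a b := by ext <;> simp <;> ring
  map_smul' a b := by ext <;> simp <;> ring

theorem interpolate_characterDivisor (m : ℤ × ℤ) : X.interpolate (X.characterDivisor m) = m := by
  have h := X.smooth 0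
  rw [zero_add, det] at h
  ext <;> simp only [interpolate, characterDivisor, pairing, LinearMap.coe_mk, AddHom.coe_mk]
  · linear_combination m.1 * h
  · linear_combination m.2 * h

/-- A linear choice of a divisor in each class. -/
def representative : X.H2 →ₗ[ℤ] (ZMod n → ℤ) :=
  Submodule.liftQ _ (LinearMap.id - X.characterDivisor ∘ₗ X.interpolate) (by
    rintro _ ⟨m, rfl⟩
    simp [interpolate_characterDivisor])

theorem classOf_representative (β : X.H2) : X.classOf (X.representative β) = β := by
  obtain ⟨c, rfl⟩ := Submodule.mkQ_surjective _ β
  change X.classOf (c - X.characterDivisor (X.interpolate c)) = X.classOf c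
  rw [map_sub, sub_eq_self]
  exact (Submodule.Quotient.mk_eq_zero _).mpr ⟨_, rfl⟩

/-- The choice of a representative is linear in β, so the self-intersection is visibly a sum of
products of two additive functions. -/
theorem intersection_self_eq (β : X.H2) :
    X.intersection β β = ∑ i, X.representative β i * X.dotDivisor i β := by
  conv_lhs => rw [← X.classOf_representative β]
  rw [intersection_classOf, classOf_representative]

theorem intersection_self_mem :
    (fun β => ((X.intersection β β : ℤ) : ℚ⟦X⟧)) ∈ X.polynomialFunctions := by
  have h : (fun β => ((X.intersection β β : ℤ) : ℚ⟦X⟧)) = ∑ i : ZMod n,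
      (fun β => (((LinearMap.proj i ∘ₗ X.representative).toAddMonoidHom β : ℤ) : ℚ⟦X⟧)) *
        fun β => (((X.dotDivisor i).toAddMonoidHom β : ℤ) : ℚ⟦X⟧) := by
    funext β
    rw [intersection_self_eq]
    simp
  rw [h]
  exact Subalgebra.sum_mem _ fun i _ => Subalgebra.mul_mem _ (addHom_mem _) (addHom_mem _)

theorem maxGenus_mem : (fun β => ((X.maxGenus β : ℤ) : ℚ⟦X⟧)) ∈ X.polynomialFunctions := by
  have h : (fun β => ((X.maxGenus β : ℤ) : ℚ⟦X⟧)) = (fun _ => PowerSeries.C (1 / 2 : ℚ)) *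
      (((fun _ => 2) + fun β => ((X.intersection β β : ℤ) : ℚ⟦X⟧)) +
        fun β => (((X.intersection X.canonicalClass).toAddMonoidHom β : ℤ) : ℚ⟦X⟧)) := by
    funext β
    have h1 := congrArg (Int.cast : ℤ → ℚ⟦X⟧) (X.two_mul_maxGenus β)
    have h2 : (PowerSeries.C (1 / 2 : ℚ)) * 2 = (1 : ℚ⟦X⟧) := by
      rw [show (2 : ℚ⟦X⟧) = PowerSeries.C 2 from (map_ofNat _ 2).symm, ← map_mul]; norm_num
    push_cast at h1
    change ((X.maxGenus β : ℤ) : ℚ⟦X⟧) = PowerSeries.C (1 / 2 : ℚ) *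
      ((2 + ((X.intersection β β : ℤ) : ℚ⟦X⟧)) + ((X.intersection X.canonicalClass β : ℤ) : ℚ⟦X⟧))
    linear_combination (-(X.maxGenus β : ℚ⟦X⟧)) * h2 + PowerSeries.C (1 / 2 : ℚ) * h1
  rw [h]
  exact Subalgebra.mul_mem _ (const_mem _) (Subalgebra.add_mem _ (Subalgebra.add_mem _
    (const_mem _) X.intersection_self_mem) (addHom_mem _))

/-- The function `β ↦ φ (maxGenus β - ψ)` is polynomial. -/
theorem isPolynomialMap_maxGenus (φ ψ : ℤ⟦X⟧) :
    X.IsPolynomialMap fun β => φ * (PowerSeries.C (X.maxGenus β) - ψ) := by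
  have h : (fun β => PowerSeries.map (Int.castRingHom ℚ)
      (φ * (PowerSeries.C (X.maxGenus β) - ψ))) =
      (fun _ => PowerSeries.map (Int.castRingHom ℚ) φ) *
        ((fun β => ((X.maxGenus β : ℤ) : ℚ⟦X⟧)) -
          fun _ => PowerSeries.map (Int.castRingHom ℚ) ψ) := by
    funext β
    simp
  rw [IsPolynomialMap, h]
  exact Subalgebra.mul_mem _ (const_mem _)
    (Subalgebra.sub_mem _ X.maxGenus_mem (const_mem _))

end ToricSurface

end ToricRefined

/-! ### The fan of the polygon -/

namespace ToricRefined

open Finset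

theorem sum_zmod_eq_sum_range {n : ℕ} [NeZero n] {M : Type*} [AddCommMonoid M] (G : ZMod n → M)
    (i₀ : ZMod n) : ∑ i, G i = ∑ v ∈ range n, G (i₀ + v) := by
  refine sum_nbij' (fun i => (i - i₀).val) (fun v => i₀ + v) ?_ ?_ ?_ ?_ ?_
  · intro i _; exact mem_range.mpr (ZMod.val_lt _)
  · intro v _; exact mem_univ _
  · intro i _; simp
  · intro v hv; rw [add_sub_cancel_left, ZMod.val_cast_of_lt (mem_range.mp hv)]
  · intro i _; simp

namespace CompleteFan

variable {n : ℕ} [NeZero n] (F : CompleteFan n)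

/-- The fan has vertical rays, rays `(1, k)` for `k = kR, …, kR + rR` and rays `(-1, k)` for
`k = kL, …, kL + rL`. -/
structure IsStrip (i₀ : ZMod n) (kL : ℤ) (rL : ℕ) (kR : ℤ) (rR : ℕ) : Prop where
  card : n = rL + rR + 4
  bottom : F.ray i₀ = (0, -1)
  right : ∀ s ≤ rR, F.ray (i₀ + 1 + s) = (1, kR + s)
  top : F.ray (i₀ + 1 + (rR + 1 : ℕ)) = (0, 1)
  left : ∀ s ≤ rL, F.ray (i₀ - 1 - s) = (-1, kL + s)

variable {F}

theorem ray_injective : Function.Injective F.ray := by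
  intro i j h
  have h1 := F.turn i
  rcases F.once i j (by rw [h]; simp [det, mul_comm]) (by rw [← h]; exact h1.le) with h2 | h2
  · exact h2.symm
  · rw [← h2, ← h] at h1
    simp [det, mul_comm] at h1

theorem not_between {i j : ZMod n} (h1 : 0 < det (F.ray i) (F.ray j))
    (h2 : 0 < det (F.ray j) (F.ray (i + 1))) : False := by
  rcases F.once i j h1.le h2.le with rfl | rfl <;> simp [det, mul_comm] at h1 h2

variable (hray : ∀ i, F.ray i = (0, 1) ∨ F.ray i = (0, -1) ∨ (∃ k : ℤ, F.ray i = (1, k)) ∨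
  ∃ k : ℤ, F.ray i = (-1, k)) (hF : F.IsSmooth)

include hray hF

theorem next_of_bottom {i : ZMod n} (h : F.ray i = (0, -1)) : ∃ k, F.ray (i + 1) = (1, k) := by
  have h1 := hF i
  rw [h] at h1
  rcases hray (i + 1) with h2 | h2 | ⟨k, h2⟩ | ⟨k, h2⟩ <;> rw [h2] at h1 <;>
    simp only [det] at h1
  · omega
  · omega
  · exact ⟨k, h2⟩
  · omega

theorem next_of_top {i : ZMod n} (h : F.ray i = (0, 1)) : ∃ k, F.ray (i + 1) = (-1, k) := by
  have h1 := hF i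
  rw [h] at h1
  rcases hray (i + 1) with h2 | h2 | ⟨k, h2⟩ | ⟨k, h2⟩ <;> rw [h2] at h1 <;>
    simp only [det] at h1
  · omega
  · omega
  · omega
  · exact ⟨k, h2⟩

/-- Smoothness makes the second coordinate increase by exactly one. A direct passage to a ray (-1,
l) is excluded because the ray (0, 1) would lie strictly between. -/
theorem next_of_right {i j : ZMod n} (hj : F.ray j = (0, 1)) {k : ℤ} (h : F.ray i = (1, k)) :
    F.ray (i + 1) = (1, k + 1) ∨ F.ray (i + 1) = (0, 1) := by
  have h1 := hF i
  rw [h] at h1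
  rcases hray (i + 1) with h2 | h2 | ⟨l, h2⟩ | ⟨l, h2⟩ <;> rw [h2] at h1 <;>
    simp only [det] at h1
  · exact Or.inr h2
  · omega
  · left; rw [h2, show l = k + 1 by omega]
  · exact (not_between (F := F) (i := i) (j := j) (by rw [h, hj]; simp [det])
      (by rw [h2, hj]; simp [det])).elim

theorem next_of_left {i j : ZMod n} (hj : F.ray j = (0, -1)) {k : ℤ} (h : F.ray i = (-1, k)) :
    F.ray (i + 1) = (-1, k - 1) ∨ F.ray (i + 1) = (0, -1) := by
  have h1 := hF i
  rw [h] at h1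
  rcases hray (i + 1) with h2 | h2 | ⟨l, h2⟩ | ⟨l, h2⟩ <;> rw [h2] at h1 <;>
    simp only [det] at h1
  · omega
  · exact Or.inr h2
  · exact (not_between (F := F) (i := i) (j := j) (by rw [h, hj]; simp [det])
      (by rw [h2, hj]; simp [det])).elim
  · left; rw [h2, show l = k - 1 by omega]

/-- Counterclockwise from the bottom ray, the slopes increase by one on the right until the top ray,
then decrease by one on the left until the bottom ray. The walk closes up after rL + rR + 4 steps,
so n divides this number; a smaller n would make the bottom ray reappear on the way. -/
theorem exists_isStrip {j i₀ : ZMod n} (hj : F.ray j = (0, 1)) (h₀ : F.ray i₀ = (0, -1)) :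
    ∃ kL rL kR rR, F.IsStrip i₀ kL rL kR rR := by
  have ext : ∃ t : ℕ, F.ray (i₀ + 1 + t) = (0, 1) :=
    ⟨(j - i₀ - 1).val, by rw [ZMod.natCast_zmod_val, ← hj]; congr 1; ring⟩
  obtain ⟨kR, hkR⟩ := next_of_bottom hray hF h₀
  obtain ⟨rR, hrR⟩ : ∃ rR, Nat.find ext = rR + 1 := by
    refine Nat.exists_eq_succ_of_ne_zero fun h => ?_
    have := Nat.find_spec ext
    rw [h, Nat.cast_zero, add_zero, hkR] at this
    simp at this
  have right : ∀ s : ℕ, s ≤ rR → F.ray (i₀ + 1 + s) = (1, kR + s) := by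
    intro s hs
    induction s with
    | zero => simp [hkR]
    | succ s ih =>
      have h1 := next_of_right hray hF hj (ih (by omega))
      rw [add_assoc (i₀ + 1), ← Nat.cast_succ] at h1
      rcases h1 with h1 | h1
      · rw [h1]; push_cast; rw [add_assoc]
      · exact absurd h1 (Nat.find_min ext (by omega))
  have top : F.ray (i₀ + 1 + (rR + 1 : ℕ)) = (0, 1) := by
    rw [← hrR]; exact Nat.find_spec ext
  set i₁ : ZMod n := i₀ + 1 + (rR + 1 : ℕ) with hi₁
  have exb : ∃ t : ℕ, F.ray (i₁ + 1 + t) = (0, -1) :=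
    ⟨(i₀ - i₁ - 1).val, by rw [ZMod.natCast_zmod_val, ← h₀]; congr 1; ring⟩
  obtain ⟨q, hq⟩ := next_of_top hray hF top
  obtain ⟨rL, hrL⟩ : ∃ rL, Nat.find exb = rL + 1 := by
    refine Nat.exists_eq_succ_of_ne_zero fun h => ?_
    have := Nat.find_spec exb
    rw [h, Nat.cast_zero, add_zero, hq] at this
    simp at this
  have left : ∀ s : ℕ, s ≤ rL → F.ray (i₁ + 1 + s) = (-1, q - s) := by
    intro s hs
    induction s with
    | zero => simp [hq]
    | succ s ih =>
      have h1 := next_of_left hray hF h₀ (ih (by omega))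
      rw [add_assoc (i₁ + 1), ← Nat.cast_succ] at h1
      rcases h1 with h1 | h1
      · rw [h1]; push_cast; rw [sub_sub]
      · exact absurd h1 (Nat.find_min exb (by omega))
  have back : i₁ + 1 + (rL + 1 : ℕ) = i₀ := by
    apply ray_injective
    rw [h₀, ← hrL]; exact Nat.find_spec exb
  have hz : ((rL + rR + 4 : ℕ) : ZMod n) = 0 := by
    rw [hi₁] at back
    push_cast at back ⊢
    linear_combination back
  have card : n = rL + rR + 4 := by
    have hdvd := (ZMod.natCast_eq_zero_iff _ _).mp hz
    refine le_antisymm (Nat.le_of_dvd (by omega) hdvd) (not_lt.mp fun hlt => ?_)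
    have hn : 0 < n := Nat.pos_of_ne_zero (NeZero.ne n)
    have hself : F.ray (i₀ + (n : ℕ)) = (0, -1) := by
      rw [ZMod.natCast_self, add_zero, h₀]
    rcases Nat.lt_or_ge n (rR + 2) with h1 | h1
    · have h2 := right (n - 1) (by omega)
      rw [Nat.cast_sub hn, Nat.cast_one, show i₀ + 1 + ((n : ZMod n) - 1) = i₀ + (n : ℕ) by ring,
        hself] at h2
      simp at h2
    · rcases h1.eq_or_lt with h1 | h1
      · have hc := congrArg (Nat.cast : ℕ → ZMod n) h1
        push_cast at hc
        rw [hi₁, show i₀ + 1 + ((rR + 1 : ℕ) : ZMod n) = i₀ + (n : ℕ) by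
          push_cast; linear_combination hc, hself] at top
        simp at top
      · have h2 := left (n - (rR + 3)) (by omega)
        rw [Nat.cast_sub (by omega), hi₁, show i₀ + 1 + ((rR + 1 : ℕ) : ZMod n) + 1 +
          ((n : ZMod n) - (rR + 3 : ℕ)) = i₀ + (n : ℕ) by push_cast; ring, hself] at h2
        simp at h2
  -- The left rays were met from top to bottom, beginning with slope q; their lowest slope is q -
  -- rL.
  refine ⟨q - rL, rL, kR, rR, card, h₀, right, top, fun s hs => ?_⟩
  have h1 := left (rL - s) (by omega)
  rw [Nat.cast_sub hs, hi₁] at h1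
  have h2 : i₀ - 1 - (s : ZMod n) = i₀ + 1 + (rR + 1 : ℕ) + 1 + (rL - s) := by
    push_cast at hz ⊢
    linear_combination -hz
  rw [h2, h1, Nat.cast_sub hs]
  congr 1
  ring

omit hray hF in
theorem IsStrip.sum_eq {i₀ : ZMod n} {kL : ℤ} {rL : ℕ} {kR : ℤ} {rR : ℕ}
    (h : F.IsStrip i₀ kL rL kR rR) {M : Type*} [AddCommMonoid M] (G : ZMod n → M) :
    ∑ i, G i = G i₀ + ∑ s ∈ range (rR + 1), G (i₀ + 1 + s) + G (i₀ + 1 + (rR + 1 : ℕ)) +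
      ∑ s ∈ range (rL + 1), G (i₀ - 1 - s) := by
  have hz : ((rL + rR + 4 : ℕ) : ZMod n) = 0 := by
    rw [← h.card]; exact ZMod.natCast_self n
  rw [sum_zmod_eq_sum_range G i₀]
  have : range n = range (1 + (rR + 1) + 1 + (rL + 1)) := by
    congr 1; have := h.card; omega
  rw [this, sum_range_add, sum_range_add, sum_range_add, sum_range_one, sum_range_one]
  congr 1
  · congr 1
    · congr 1
      · simp
      · refine sum_congr rfl fun s _ => ?_
        congr 1; push_cast; ring
    · congr 1; push_cast; ring
  · rw [← sum_range_reflect]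
    refine sum_congr rfl fun s hs => ?_
    rw [mem_range] at hs
    congr 1
    rw [Nat.add_sub_cancel, Nat.cast_add, Nat.cast_sub (show s ≤ rL by omega)]
    push_cast at hz ⊢
    linear_combination hz

end CompleteFan

end ToricRefined

namespace ToricRefined

open Finset

/-! ### The sides of the polygon and the sequences of slopes -/

section Side

/-- The number of slopes that are at least the slope number `t`. -/
def tailSum (r : ℕ) (ℓ : ℕ → ℕ) (t : ℕ) : ℕ := ∑ s ∈ Ico t (r + 1), ℓ s

theorem tailSum_zero (r : ℕ) (ℓ : ℕ → ℕ) : tailSum r ℓ 0 = ∑ s ∈ range (r + 1), ℓ s := by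
  rw [tailSum, range_eq_Ico]

theorem tailSum_succ {r t : ℕ} (ℓ : ℕ → ℕ) (h : t ≤ r) :
    tailSum r ℓ t = ℓ t + tailSum r ℓ (t + 1) := by
  rw [tailSum, sum_eq_sum_Ico_succ_bot (by omega), tailSum]

theorem tailSum_self (r : ℕ) (ℓ : ℕ → ℕ) : tailSum r ℓ (r + 1) = 0 := by simp [tailSum]

theorem sum_range_add_tailSum (r : ℕ) (ℓ : ℕ → ℕ) {t : ℕ} (ht : t ≤ r + 1) :
    ∑ s ∈ range t, ℓ s + tailSum r ℓ t = ∑ s ∈ range (r + 1), ℓ s :=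
  sum_range_add_sum_Ico _ ht

/-- Summation by parts. -/
theorem sum_mul_sum_range (r : ℕ) (ℓ : ℕ → ℕ) (Y : ℕ → ℤ) :
    ∑ s ∈ range (r + 1), (ℓ s : ℤ) * ∑ t ∈ range s, Y t =
      ∑ t ∈ range r, Y t * tailSum r ℓ (t + 1) := by
  simp only [tailSum, mul_sum, Nat.cast_sum]
  rw [sum_sigma', sum_sigma']
  refine sum_nbij' (fun p => ⟨p.2, p.1⟩) (fun p => ⟨p.2, p.1⟩) ?_ ?_ ?_ ?_ ?_
  · rintro ⟨s, t⟩ h; simp only [mem_sigma, mem_range, mem_Ico] at h ⊢; omega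
  · rintro ⟨s, t⟩ h; simp only [mem_sigma, mem_range, mem_Ico] at h ⊢; omega
  · intro _ _; rfl
  · intro _ _; rfl
  · rintro ⟨s, t⟩ _; exact mul_comm _ _

theorem sum_mul_slope (r : ℕ) (ℓ : ℕ → ℕ) (k : ℤ) :
    ∑ s ∈ range (r + 1), (ℓ s : ℤ) * (k + s) =
      (∑ s ∈ range (r + 1), ℓ s : ℕ) * k + ∑ t ∈ range r, (tailSum r ℓ (t + 1) : ℤ) := by
  have h := sum_mul_sum_range r ℓ fun _ => 1
  simp only [sum_const, card_range, nsmul_eq_mul, mul_one, one_mul] at h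
  rw [← h]
  push_cast
  rw [sum_mul, ← sum_add_distrib]
  exact sum_congr rfl fun s _ => by ring

theorem wordCount_threshold {a : ℕ} (L : Fin a → ℤ) (c : ℤ) :
    wordCount (threshold c L) = (univ.val.map L).countP (c ≤ ·) := by
  rw [Multiset.countP_map, wordCount, ← card_filter]
  simp only [threshold, decide_eq_true_eq]
  rfl

theorem count_eq_sub {a : ℕ} (L : Fin a → ℤ) (c : ℤ) :
    (univ.val.map L).count c + wordCount (threshold (c + 1) L) = wordCount (threshold c L) := by
  rw [Multiset.count_map, wordCount, wordCount, ← card_filter, ← card_filter]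
  change #(univ.filter fun u => c = L u) + _ = _
  rw [← card_union_of_disjoint]
  · congr 1
    ext u
    simp only [mem_union, mem_filter, mem_univ, true_and, threshold, decide_eq_true_eq]
    omega
  · rw [disjoint_left]
    intro u hu hu'
    simp only [mem_filter, mem_univ, true_and, threshold, decide_eq_true_eq] at hu hu'
    omega

/-- Multiplicities are differences of consecutive threshold counts, and threshold counts are tail
sums of multiplicities. This identifies `arrangements` with the orderings of the slopes of a
polygon. -/
theorem mem_arrangements_iff_map {a r : ℕ} {ℓ : ℕ → ℕ} {k : ℤ}
    (ha : a = ∑ s ∈ range (r + 1), ℓ s) (L : Fin a → ℤ) :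
    L ∈ arrangements a k r (tailSum r ℓ) ↔
      univ.val.map L = ∑ s ∈ range (r + 1), Multiset.replicate (ℓ s) (k + (s : ℤ)) := by
  rw [mem_arrangements]
  constructor
  · rintro ⟨h1, h2⟩
    have h3 : ∀ s ≤ r + 1, wordCount (threshold (k + s) L) = tailSum r ℓ s := by
      intro s hs
      rcases Nat.eq_zero_or_pos s with rfl | hs0
      · rw [tailSum_zero, ← ha, wordCount, ← card_filter, filter_true_of_mem, card_univ,
          Fintype.card_fin]
        intro u _
        simpa [threshold] using (h1 u).1
      · rcases Nat.lt_or_ge r s with hsr | hsr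
        · obtain rfl : s = r + 1 := by omega
          rw [tailSum_self, wordCount, ← card_filter, filter_false_of_mem, card_empty]
          intro u _
          have := (h1 u).2
          simp only [threshold, decide_eq_true_eq]
          push_cast; omega
        · have := h2 (s - 1) (by omega)
          rwa [Nat.sub_add_cancel hs0] at this
    ext c
    rw [Multiset.count_sum']
    simp only [Multiset.count_replicate]
    by_cases hc : k ≤ c ∧ c ≤ k + r
    · obtain ⟨s, rfl⟩ : ∃ s : ℕ, c = k + s := ⟨(c - k).toNat, by omega⟩
      have hs : s ≤ r := by omega
      rw [sum_eq_single s]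
      · have e1 := count_eq_sub L (k + s)
        have e2 := h3 s (by omega)
        have e3 := h3 (s + 1) (by omega)
        have e4 := tailSum_succ ℓ hs
        push_cast at e3
        rw [← add_assoc] at e3
        rw [if_pos rfl]
        omega
      · intro s' _ hs'; rw [if_neg (by omega)]
      · intro h; exact absurd (mem_range.mpr (by omega)) h
    · rw [sum_eq_zero, Multiset.count_eq_zero]
      · intro h
        obtain ⟨u, _, rfl⟩ := Multiset.mem_map.mp h
        exact hc (h1 u)
      · intro s hs
        rw [mem_range] at hs
        rw [if_neg]; rintro rfl; omega
  · intro h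
    constructor
    · intro u
      have : L u ∈ univ.val.map L := Multiset.mem_map_of_mem L (mem_univ_val u)
      rw [h, Multiset.mem_sum] at this
      obtain ⟨s, hs, h4⟩ := this
      rw [mem_range] at hs
      rw [Multiset.eq_of_mem_replicate h4]
      omega
    · intro t ht
      rw [wordCount_threshold, h]
      have : ∀ S : Finset ℕ, Multiset.countP (k + ((t + 1 : ℕ) : ℤ) ≤ ·)
          (∑ s ∈ S, Multiset.replicate (ℓ s) (k + (s : ℤ))) =
            ∑ s ∈ S, if t + 1 ≤ s then ℓ s else 0 := by
        intro S
        induction S using Finset.induction_on with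
        | empty => simp
        | insert s S hs ih =>
          rw [sum_insert hs, sum_insert hs, Multiset.countP_add, ih, ← Multiset.coe_replicate,
            Multiset.coe_countP, List.countP_replicate]
          congr 1
          simp only [decide_eq_true_eq]
          exact if_congr (by omega) rfl rfl
      rw [this, ← sum_filter, tailSum]
      congr 1
      ext s
      simp only [mem_filter, mem_range, mem_Ico]
      omega

end Side

namespace LatticePolygon

variable {n : ℕ} [NeZero n] (Δ : LatticePolygon n) (i₀ : ZMod n)

/-- The lengths of the right sides, from bottom to top. -/
def rightLength (s : ℕ) : ℕ := Δ.length (i₀ + 1 + s)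

/-- The lengths of the left sides, from bottom to top. -/
def leftLength (s : ℕ) : ℕ := Δ.length (i₀ - 1 - s)

variable {Δ i₀} {kL kR : ℤ} {rL rR : ℕ} (h : Δ.toCompleteFan.IsStrip i₀ kL rL kR rR)

include h

theorem bottomLength_eq : Δ.bottomLength = Δ.length i₀ := by
  rw [bottomLength, h.sum_eq, h.bottom, if_pos rfl, h.top, if_neg (by simp), sum_eq_zero,
    sum_eq_zero]
  · simp
  · intro s hs; rw [h.left s (by simpa [Nat.lt_succ_iff] using hs)]; simp
  · intro s hs; rw [h.right s (by simpa [Nat.lt_succ_iff] using hs)]; simp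

theorem topLength_eq : Δ.topLength = Δ.length (i₀ + 1 + (rR + 1 : ℕ)) := by
  rw [topLength, h.sum_eq, h.bottom, if_neg (by simp), h.top, if_pos rfl, sum_eq_zero,
    sum_eq_zero]
  · simp
  · intro s hs; rw [h.left s (by simpa [Nat.lt_succ_iff] using hs)]; simp
  · intro s hs; rw [h.right s (by simpa [Nat.lt_succ_iff] using hs)]; simp

theorem height_eq_right : Δ.height = ∑ s ∈ range (rR + 1), Δ.rightLength i₀ s := by
  rw [height, h.sum_eq]
  simp only [direction]
  rw [h.bottom, h.top, sum_eq_zero (s := range (rL + 1))]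
  · simp only [Int.toNat_zero, mul_zero, zero_add, add_zero]
    refine sum_congr rfl fun s hs => ?_
    rw [h.right s (by simpa [Nat.lt_succ_iff] using hs)]
    simp [rightLength]
  · intro s hs; rw [h.left s (by simpa [Nat.lt_succ_iff] using hs)]; simp

theorem sum_left_eq_sum_right : ∑ s ∈ range (rL + 1), Δ.leftLength i₀ s =
    ∑ s ∈ range (rR + 1), Δ.rightLength i₀ s := by
  have h1 := congrArg Prod.fst Δ.closed
  rw [Prod.fst_sum, h.sum_eq, h.bottom, h.top] at h1
  have e1 : ∑ s ∈ range (rR + 1), ((Δ.length (i₀ + 1 + s) : ℤ) • Δ.ray (i₀ + 1 + s)).1 =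
      ∑ s ∈ range (rR + 1), (Δ.rightLength i₀ s : ℤ) :=
    sum_congr rfl fun s hs => by
      rw [h.right s (by simpa [Nat.lt_succ_iff] using hs)]; simp [rightLength]
  have e2 : ∑ s ∈ range (rL + 1), ((Δ.length (i₀ - 1 - s) : ℤ) • Δ.ray (i₀ - 1 - s)).1 =
      -∑ s ∈ range (rL + 1), (Δ.leftLength i₀ s : ℤ) := by
    rw [← sum_neg_distrib]
    exact sum_congr rfl fun s hs => by
      rw [h.left s (by simpa [Nat.lt_succ_iff] using hs)]; simp [leftLength]
  rw [e1, e2] at h1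
  simp at h1
  zify
  linarith

theorem height_eq_left : Δ.height = ∑ s ∈ range (rL + 1), Δ.leftLength i₀ s := by
  rw [sum_left_eq_sum_right h, height_eq_right h]

/-- The second coordinate of the closing relation between the normal vectors. -/
theorem balance : Δ.height * kL + ∑ t ∈ range rL, (tailSum rL (Δ.leftLength i₀) (t + 1) : ℤ) +
      (Δ.height * kR + ∑ t ∈ range rR, (tailSum rR (Δ.rightLength i₀) (t + 1) : ℤ)) =
        (Δ.bottomLength : ℤ) - Δ.topLength := by
  have e0 := sum_mul_slope rL (Δ.leftLength i₀) kL
  have e0' := sum_mul_slope rR (Δ.rightLength i₀) kR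
  rw [← height_eq_left h] at e0
  rw [← height_eq_right h] at e0'
  rw [← e0, ← e0', bottomLength_eq h, topLength_eq h]
  have h1 := congrArg Prod.snd Δ.closed
  rw [Prod.snd_sum, h.sum_eq, h.bottom, h.top] at h1
  have e1 : ∑ s ∈ range (rR + 1), ((Δ.length (i₀ + 1 + s) : ℤ) • Δ.ray (i₀ + 1 + s)).2 =
      ∑ s ∈ range (rR + 1), (Δ.rightLength i₀ s : ℤ) * (kR + s) :=
    sum_congr rfl fun s hs => by
      rw [h.right s (by simpa [Nat.lt_succ_iff] using hs)]; simp [rightLength]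
  have e2 : ∑ s ∈ range (rL + 1), ((Δ.length (i₀ - 1 - s) : ℤ) • Δ.ray (i₀ - 1 - s)).2 =
      ∑ s ∈ range (rL + 1), (Δ.leftLength i₀ s : ℤ) * (kL + s) := by
    exact sum_congr rfl fun s hs => by
      rw [h.left s (by simpa [Nat.lt_succ_iff] using hs)]; simp [leftLength]
  rw [e1, e2] at h1
  simp only [Prod.smul_snd, smul_eq_mul, mul_neg, mul_one, Prod.snd_zero] at h1
  linarith

theorem leftSlopes_eq : Δ.leftSlopes =
    ∑ s ∈ range (rL + 1), Multiset.replicate (Δ.leftLength i₀ s) (kL + (s : ℤ)) := by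
  rw [leftSlopes, h.sum_eq, h.bottom, h.top, if_neg (by simp), if_neg (by simp),
    sum_eq_zero (s := range (rR + 1))]
  · rw [zero_add, zero_add, zero_add]
    refine sum_congr rfl fun s hs => ?_
    rw [h.left s (by simpa [Nat.lt_succ_iff] using hs), if_pos rfl]; rfl
  · intro s hs; rw [h.right s (by simpa [Nat.lt_succ_iff] using hs)]; simp

theorem rightSlopes_eq : Δ.rightSlopes =
    ∑ s ∈ range (rR + 1), Multiset.replicate (Δ.rightLength i₀ s) (kR + (s : ℤ)) := by
  rw [rightSlopes, h.sum_eq, h.bottom, h.top, if_neg (by simp), if_neg (by simp),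
    sum_eq_zero (s := range (rL + 1))]
  · rw [zero_add, add_zero, add_zero]
    refine sum_congr rfl fun s hs => ?_
    rw [h.right s (by simpa [Nat.lt_succ_iff] using hs), if_pos rfl]; rfl
  · intro s hs; rw [h.left s (by simpa [Nat.lt_succ_iff] using hs)]; simp

theorem mem_arrangements_left (L : Fin Δ.height → ℤ) :
    L ∈ arrangements Δ.height kL rL (tailSum rL (Δ.leftLength i₀)) ↔
      univ.val.map L = Δ.leftSlopes := by
  rw [leftSlopes_eq h]
  exact mem_arrangements_iff_map (height_eq_left h) L

theorem mem_arrangements_right (L : Fin Δ.height → ℤ) :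
    L ∈ arrangements Δ.height kR rR (tailSum rR (Δ.rightLength i₀)) ↔
      univ.val.map L = Δ.rightSlopes := by
  rw [rightSlopes_eq h]
  exact mem_arrangements_iff_map (height_eq_right h) L

end LatticePolygon

end ToricRefined

namespace ToricRefined

open Finset

/-! ### Support numbers and intersection numbers -/

namespace LatticePolygon

variable {n : ℕ} [NeZero n] (Δ : LatticePolygon n)

/-- The vertices, indexed cyclically. -/
def corner (i : ZMod n) : ℤ × ℤ := Δ.vertex i.val

theorem vertex_card : Δ.vertex n = 0 := by
  have h := Δ.closed
  rw [sum_zmod_eq_sum_range _ 0] at h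
  simp only [zero_add] at h
  have h1 := congrArg Prod.fst h
  have h2 := congrArg Prod.snd h
  rw [Prod.fst_sum] at h1
  rw [Prod.snd_sum] at h2
  simp only [Prod.smul_fst, Prod.smul_snd, smul_eq_mul, Prod.fst_zero, Prod.snd_zero] at h1 h2
  ext
  · rw [vertex, Prod.fst_sum]
    simp only [direction, Prod.smul_mk, smul_eq_mul, mul_neg, sum_neg_distrib, h2, neg_zero,
      Prod.fst_zero]
  · rw [vertex, Prod.snd_sum]
    simp only [direction, Prod.smul_mk, smul_eq_mul, h1, Prod.snd_zero]

theorem corner_succ (i : ZMod n) :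
    Δ.corner (i + 1) = Δ.corner i + (Δ.length i : ℤ) • Δ.direction i := by
  have hstep : Δ.vertex (i.val + 1) = Δ.corner i + (Δ.length i : ℤ) • Δ.direction i := by
    rw [vertex, sum_range_succ, ZMod.natCast_zmod_val]
    rfl
  rw [← hstep]
  have hi : i + 1 = ((i.val + 1 : ℕ) : ZMod n) := by push_cast; rw [ZMod.natCast_zmod_val]
  rw [corner, hi, ZMod.val_natCast]
  rcases (Nat.succ_le_of_lt (ZMod.val_lt i)).eq_or_lt with h | h
  · rw [← Nat.succ_eq_add_one, h, Nat.mod_self, vertex_card]; simp [vertex]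
  · rw [Nat.mod_eq_of_lt h]

theorem vertex_eq_corner (k : ℕ) : Δ.vertex k = Δ.corner k := by
  induction k with
  | zero => simp [corner]
  | succ k ih =>
    rw [vertex, sum_range_succ, ← vertex, ih, Nat.cast_succ, corner_succ]

/-- The constants in the inequalities that define the polygon. -/
def support (i : ZMod n) : ℤ := pairing (Δ.ray i) (Δ.corner i)

theorem pairing_corner_succ (i : ZMod n) : pairing (Δ.ray i) (Δ.corner (i + 1)) = Δ.support i := by
  rw [corner_succ, support]
  simp only [pairing, direction, Prod.fst_add, Prod.snd_add, Prod.smul_fst, Prod.smul_snd,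
    smul_eq_mul]
  ring

theorem mem_region {x : ℝ × ℝ} : x ∈ Δ.region ↔
    ∀ i, ((Δ.ray i).1 : ℝ) * x.1 + ((Δ.ray i).2 : ℝ) * x.2 ≤ Δ.support i := by
  have key : ∀ k : ℕ, ((Δ.ray (k : ZMod n)).1 : ℝ) * (x.1 - (Δ.vertex k).1) +
      ((Δ.ray (k : ZMod n)).2 : ℝ) * (x.2 - (Δ.vertex k).2) ≤ 0 ↔
      ((Δ.ray (k : ZMod n)).1 : ℝ) * x.1 + ((Δ.ray (k : ZMod n)).2 : ℝ) * x.2 ≤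
        Δ.support (k : ZMod n) := by
    intro k
    rw [vertex_eq_corner, support, pairing]
    push_cast
    constructor <;> intro h <;> linarith
  constructor
  · intro h i
    have := (key i.val).mp (h i.val)
    rwa [ZMod.natCast_zmod_val] at this
  · intro h k
    exact (key k).mpr (h _)

/-- The support numbers are the coefficients of the divisor that the polygon represents. Evaluating
the relation between three consecutive rays at a vertex of the side leaves only the length of that
side. -/
theorem divisorDot_support (X : ToricSurface n) (hX : Δ.toCompleteFan = X.toCompleteFan)
    (i : ZMod n) : X.divisorDot i Δ.support = Δ.length i := by
  have hrel := X.ray_relation i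
  have hdet := X.smooth i
  rw [← hX] at hrel hdet
  have h1 := Δ.pairing_corner_succ (i - 1)
  rw [sub_add_cancel] at h1
  have h2 : Δ.support (i + 1) = pairing (Δ.ray (i + 1)) (Δ.corner i) + Δ.length i := by
    rw [support, corner_succ]
    simp only [pairing, direction, det, Prod.fst_add, Prod.snd_add, Prod.smul_fst, Prod.smul_snd,
      smul_eq_mul] at hdet ⊢
    linear_combination (Δ.length i : ℤ) * hdet
  simp only [ToricSurface.divisorDot, LinearMap.coe_mk, AddHom.coe_mk]
  rw [← h1, h2, support]
  have e1 := congrArg Prod.fst hrel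
  have e2 := congrArg Prod.snd hrel
  simp only [Prod.fst_add, Prod.snd_add, Prod.smul_fst, Prod.smul_snd, smul_eq_mul, Prod.fst_zero,
    Prod.snd_zero] at e1 e2
  simp only [pairing]
  linear_combination (Δ.corner i).1 * e1 + (Δ.corner i).2 * e2

section Strip

variable {Δ} {i₀ : ZMod n} {kL kR : ℤ} {rL rR : ℕ} (h : Δ.toCompleteFan.IsStrip i₀ kL rL kR rR)

include h

theorem corner_bottom : Δ.corner (i₀ + 1) =
    ((Δ.corner i₀).1 + Δ.bottomLength, (Δ.corner i₀).2) := by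
  rw [corner_succ, direction, h.bottom, bottomLength_eq h]
  ext <;> simp

theorem corner_right (s : ℕ) (hs : s ≤ rR + 1) : (Δ.corner (i₀ + 1 + s)).2 =
    (Δ.corner i₀).2 + (∑ t ∈ range s, Δ.rightLength i₀ t : ℕ) := by
  induction s with
  | zero => simp [corner_bottom h]
  | succ s ih =>
    rw [Nat.cast_succ, ← add_assoc, corner_succ, Prod.snd_add, ih (by omega), direction,
      h.right s (by omega), sum_range_succ]
    simp [rightLength, add_assoc]

theorem corner_left (s : ℕ) (hs : s ≤ rL + 1) : (Δ.corner (i₀ - s)).2 =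
    (Δ.corner i₀).2 + (∑ t ∈ range s, Δ.leftLength i₀ t : ℕ) := by
  induction s with
  | zero => simp
  | succ s ih =>
    have e1 := Δ.corner_succ (i₀ - 1 - s)
    rw [show i₀ - 1 - (s : ZMod n) + 1 = i₀ - s by ring] at e1
    have e2 := congrArg Prod.snd e1
    rw [ih (by omega), Prod.snd_add, direction, h.left s (by omega)] at e2
    rw [Nat.cast_succ, show i₀ - ((s : ZMod n) + 1) = i₀ - 1 - s by ring, sum_range_succ]
    simp only [Prod.smul_mk, smul_eq_mul, mul_neg, mul_one] at e2
    push_cast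
    push_cast at e2
    simp only [leftLength] at e2 ⊢
    linarith

theorem support_bottom : Δ.support i₀ = -(Δ.corner i₀).2 := by
  rw [support, h.bottom, pairing]; simp

theorem support_top : Δ.support (i₀ + 1 + (rR + 1 : ℕ)) = (Δ.corner i₀).2 + Δ.height := by
  rw [support, h.top, pairing, corner_right h _ le_rfl, height_eq_right h]; simp

/-- Consecutive normal vectors on this side differ by (0, 1), so the support numbers differ by the
ordinate of the common vertex. -/
theorem support_right (s : ℕ) (hs : s ≤ rR) : Δ.support (i₀ + 1 + s) =
    (Δ.corner i₀).1 + Δ.bottomLength + kR * (Δ.corner i₀).2 + ∑ t ∈ range s,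
      ((Δ.corner i₀).2 + Δ.height - tailSum rR (Δ.rightLength i₀) (t + 1)) := by
  induction s with
  | zero =>
    have := h.right 0 (by omega)
    simp only [Nat.cast_zero, add_zero] at this ⊢
    rw [support, this, corner_bottom h, pairing]
    simp
  | succ s ih =>
    have e1 := Δ.pairing_corner_succ (i₀ + 1 + s)
    rw [ih (by omega), h.right s (by omega)] at e1
    rw [sum_range_succ, support, h.right (s + 1) hs]
    have e2 := corner_right h (s + 1) (by omega)
    have e3 := sum_range_add_tailSum rR (Δ.rightLength i₀) (t := s + 1) (by omega)
    rw [← height_eq_right h] at e3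
    rw [show i₀ + 1 + (s : ZMod n) + 1 = i₀ + 1 + (s + 1 : ℕ) by push_cast; ring] at e1
    generalize Δ.corner (i₀ + 1 + (s + 1 : ℕ)) = v at e1 e2 ⊢
    simp only [pairing] at e1 ⊢
    have e4 := congrArg (Nat.cast : ℕ → ℤ) e3
    push_cast at e2 e4 ⊢
    linear_combination e1 + e2 + e4

theorem support_left (s : ℕ) (hs : s ≤ rL) : Δ.support (i₀ - 1 - s) =
    -(Δ.corner i₀).1 + kL * (Δ.corner i₀).2 + ∑ t ∈ range s,
      ((Δ.corner i₀).2 + Δ.height - tailSum rL (Δ.leftLength i₀) (t + 1)) := by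
  induction s with
  | zero =>
    have := h.left 0 (by omega)
    have e1 := Δ.pairing_corner_succ (i₀ - 1)
    simp only [Nat.cast_zero, add_zero, sub_zero] at this ⊢
    rw [← e1, this, sub_add_cancel, pairing]
    simp
  | succ s ih =>
    have e1 := Δ.pairing_corner_succ (i₀ - 1 - (s + 1 : ℕ))
    rw [show i₀ - 1 - ((s + 1 : ℕ) : ZMod n) + 1 = i₀ - 1 - s by push_cast; ring,
      h.left (s + 1) hs] at e1
    have e0 := ih (by omega)
    rw [support, h.left s (by omega)] at e0
    rw [sum_range_succ, ← e1]
    have e2 := corner_left h (s + 1) (by omega)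
    rw [show i₀ - ((s + 1 : ℕ) : ZMod n) = i₀ - 1 - s by push_cast; ring] at e2
    have e3 := sum_range_add_tailSum rL (Δ.leftLength i₀) (t := s + 1) (by omega)
    rw [← height_eq_left h] at e3
    simp only [pairing] at e0 ⊢
    have e4 := congrArg (Nat.cast : ℕ → ℤ) e3
    push_cast at e2 e4 ⊢
    linear_combination e0 + e2 + e4

/-- The coordinates of the starting corner drop out by `balance`, and the rest is summation by
parts. The result is the expression found for twice the area in `twiceArea_eq`. -/
theorem sum_support_mul_length : ∑ i, Δ.support i * Δ.length i =
    2 * (Δ.height * Δ.bottomLength) - (kL + kR) * Δ.height ^ 2 -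
      ∑ t ∈ range rL, (tailSum rL (Δ.leftLength i₀) (t + 1) : ℤ) ^ 2 -
      ∑ t ∈ range rR, (tailSum rR (Δ.rightLength i₀) (t + 1) : ℤ) ^ 2 := by
  rw [h.sum_eq, support_bottom h, support_top h, ← bottomLength_eq h, ← topLength_eq h]
  have e1 : ∀ s ∈ range (rR + 1), Δ.support (i₀ + 1 + s) * Δ.length (i₀ + 1 + s) =
      (Δ.rightLength i₀ s : ℤ) * ((Δ.corner i₀).1 + Δ.bottomLength + kR * (Δ.corner i₀).2) +
      (Δ.rightLength i₀ s : ℤ) * ∑ t ∈ range s,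
        ((Δ.corner i₀).2 + Δ.height - tailSum rR (Δ.rightLength i₀) (t + 1)) := fun s hs => by
    rw [support_right h s (by simpa [Nat.lt_succ_iff] using hs), rightLength]; ring
  have e2 : ∀ s ∈ range (rL + 1), Δ.support (i₀ - 1 - s) * Δ.length (i₀ - 1 - s) =
      (Δ.leftLength i₀ s : ℤ) * (-(Δ.corner i₀).1 + kL * (Δ.corner i₀).2) +
      (Δ.leftLength i₀ s : ℤ) * ∑ t ∈ range s,
        ((Δ.corner i₀).2 + Δ.height - tailSum rL (Δ.leftLength i₀) (t + 1)) := fun s hs => by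
    rw [support_left h s (by simpa [Nat.lt_succ_iff] using hs), leftLength]; ring
  rw [sum_congr rfl e1, sum_congr rfl e2, sum_add_distrib, sum_add_distrib,
    sum_mul_sum_range rR (Δ.rightLength i₀)
      (fun t => (Δ.corner i₀).2 + Δ.height - tailSum rR (Δ.rightLength i₀) (t + 1)),
    sum_mul_sum_range rL (Δ.leftLength i₀)
      (fun t => (Δ.corner i₀).2 + Δ.height - tailSum rL (Δ.leftLength i₀) (t + 1)),
    ← sum_mul, ← sum_mul]
  have a1 := congrArg (Nat.cast : ℕ → ℤ) (height_eq_right h)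
  have a2 := congrArg (Nat.cast : ℕ → ℤ) (height_eq_left h)
  push_cast at a1 a2
  rw [← a1, ← a2]
  simp only [sub_mul, sum_sub_distrib, ← mul_sum, ← sq]
  have hb := balance h
  linear_combination ((Δ.corner i₀).2 + (Δ.height : ℤ)) * hb

end Strip

end LatticePolygon

namespace ToricSurface

variable {n : ℕ} [NeZero n] (X : ToricSurface n)

/-- The class β and the divisor given by the support numbers have the same intersection number with
every D_i. By symmetry of the form the coefficients of a representative of β may be replaced by the
support numbers. -/
theorem intersection_self_eq_sum_support (β : X.H2) (hβ : X.IsAmple β) :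
    X.intersection β β = ∑ i, (X.polygon β hβ).support i * (X.polygon β hβ).length i := by
  have hlen : ∀ i, ((X.polygon β hβ).length i : ℤ) = X.dotDivisor i β := fun i =>
    Int.toNat_of_nonneg (hβ i).le
  have hsup : ∀ i, X.divisorDot i (X.polygon β hβ).support = X.dotDivisor i β := fun i => by
    rw [(X.polygon β hβ).divisorDot_support X rfl, hlen]
  simp only [hlen]
  obtain ⟨d, hd⟩ := Submodule.mkQ_surjective _ β
  have h1 : X.intersection β β = ∑ i, d i * X.dotDivisor i β := by
    conv_lhs => rw [← hd]
    exact (X.intersection_classOf d _).trans (by rw [hd])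
  have h2 : ∀ i, X.dotDivisor i β = X.divisorDot i d := fun i => by rw [← hd]; rfl
  rw [h1]
  have h3 := X.sum_mul_divisorDot_comm d (X.polygon β hβ).support
  simp only [hsup] at h3
  rw [h3]
  exact sum_congr rfl fun i _ => by rw [h2]

theorem intersection_canonicalClass (β : X.H2) (hβ : X.IsAmple β) :
    X.intersection X.canonicalClass β = -∑ i, ((X.polygon β hβ).length i : ℤ) := by
  have hlen : ∀ i, ((X.polygon β hβ).length i : ℤ) = X.dotDivisor i β := fun i =>
    Int.toNat_of_nonneg (hβ i).le
  rw [canonicalClass, intersection_classOf]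
  simp [hlen]

end ToricSurface

end ToricRefined

/-! ### The area of the polygon -/

namespace ToricRefined

open Finset MeasureTheory

theorem exists_sum_max_zero (r : ℕ) {u : ℕ → ℝ} (hu : Antitone u) :
    ∃ s ≤ r, ∑ t ∈ range r, max (u t) 0 = ∑ t ∈ range s, u t := by
  induction r with
  | zero => exact ⟨0, le_rfl, by simp⟩
  | succ r ih =>
    rcases le_total 0 (u r) with h | h
    · refine ⟨r + 1, le_rfl, sum_congr rfl fun t ht => max_eq_left (h.trans (hu ?_))⟩
      have := mem_range.mp ht
      omega
    · obtain ⟨s, hs, e⟩ := ih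
      exact ⟨s, by omega, by rw [sum_range_succ, e, max_eq_right h, add_zero]⟩

/-- The non-negative terms of an antitone sequence come first, so its largest partial sum is the sum
of the positive parts. This merges the half-planes of all sides on the left, or on the right, into a
single inequality. -/
theorem forall_sum_range_le_iff (r : ℕ) {u : ℕ → ℝ} (hu : Antitone u) (z : ℝ) :
    (∀ s ≤ r, ∑ t ∈ range s, u t ≤ z) ↔ ∑ t ∈ range r, max (u t) 0 ≤ z := by
  constructor
  · intro h
    obtain ⟨s, hs, e⟩ := exists_sum_max_zero r hu
    exact e ▸ h s hs
  · intro h s hs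
    refine le_trans ?_ h
    calc ∑ t ∈ range s, u t ≤ ∑ t ∈ range s, max (u t) 0 :=
          sum_le_sum fun t _ => le_max_left _ _
      _ ≤ _ := sum_le_sum_of_subset_of_nonneg (range_subset_range.mpr hs)
          fun t _ _ => le_max_right _ _

theorem integral_max_sub_zero {c d Y : ℝ} (h₁ : c ≤ Y) (h₂ : Y ≤ d) :
    ∫ y in c..d, max (y - Y) 0 = (d - Y) ^ 2 / 2 := by
  have hc : Continuous fun y : ℝ => max (y - Y) 0 := by fun_prop
  rw [← intervalIntegral.integral_add_adjacent_intervals (b := Y) (hc.intervalIntegrable _ _)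
    (hc.intervalIntegrable _ _)]
  have e1 : ∫ y in c..Y, max (y - Y) 0 = ∫ y in c..Y, (0 : ℝ) :=
    intervalIntegral.integral_congr fun y hy => by
      rw [Set.uIcc_of_le h₁] at hy
      exact max_eq_right (sub_nonpos.mpr hy.2)
  have e2 : ∫ y in Y..d, max (y - Y) 0 = ∫ y in Y..d, (y - Y) :=
    intervalIntegral.integral_congr fun y hy => by
      rw [Set.uIcc_of_le h₂] at hy
      exact max_eq_left (sub_nonneg.mpr hy.1)
  rw [e1, e2, intervalIntegral.integral_sub (by simp) (by simp), integral_id]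
  simp
  ring

theorem tailSum_antitone (r : ℕ) (ℓ : ℕ → ℕ) : Antitone (tailSum r ℓ) := fun _ _ h =>
  sum_le_sum_of_subset (Ico_subset_Ico_left h)

/-- The area of a region that is bounded by two horizontal lines and two graphs. -/
theorem volume_between_graphs {c d : ℝ} (hcd : c ≤ d) {lo hi : ℝ → ℝ} (hlo : Continuous lo)
    (hhi : Continuous hi) (hle : ∀ y ∈ Set.Icc c d, lo y ≤ hi y) {s : Set (ℝ × ℝ)}
    (hs : ∀ x y, (x, y) ∈ s ↔ y ∈ Set.Icc c d ∧ x ∈ Set.Icc (lo y) (hi y)) :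
    (volume s).toReal = ∫ y in c..d, (hi y - lo y) := by
  have hmeas : MeasurableSet s := by
    have : s = (Prod.snd ⁻¹' Set.Icc c d) ∩ {p : ℝ × ℝ | lo p.2 ≤ p.1} ∩
        {p : ℝ × ℝ | p.1 ≤ hi p.2} := by
      ext ⟨x, y⟩
      rw [hs]
      simp [and_assoc]
    rw [this]
    exact ((isClosed_Icc.preimage continuous_snd).inter
      (isClosed_le (by fun_prop) (by fun_prop))).inter
        (isClosed_le (by fun_prop) (by fun_prop)) |>.measurableSet
  have hvol : volume s = ∫⁻ y in Set.Icc c d, ENNReal.ofReal (hi y - lo y) := by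
    rw [Measure.volume_eq_prod, Measure.prod_apply_symm hmeas,
      ← lintegral_indicator measurableSet_Icc]
    refine lintegral_congr fun y => ?_
    by_cases hy : y ∈ Set.Icc c d
    · rw [Set.indicator_of_mem hy, ← Real.volume_Icc]
      congr 1
      ext x
      simp only [Set.mem_preimage, hs, hy, true_and]
    · rw [Set.indicator_of_notMem hy]
      convert measure_empty (μ := (volume : Measure ℝ))
      ext x
      simp [hs, hy]
  have hnn : 0 ≤ᵐ[volume.restrict (Set.Icc c d)] fun y => hi y - lo y :=
    (ae_restrict_iff' measurableSet_Icc).mpr (ae_of_all _ fun y hy => sub_nonneg.mpr (hle y hy))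
  have hint : IntegrableOn (fun y => hi y - lo y) (Set.Icc c d) :=
    (by fun_prop : Continuous fun y => hi y - lo y).continuousOn.integrableOn_Icc
  rw [hvol, ← ofReal_integral_eq_lintegral_ofReal hint hnn,
    ENNReal.toReal_ofReal (integral_nonneg_of_ae hnn), integral_Icc_eq_integral_Ioc,
    intervalIntegral.integral_of_le hcd]

namespace LatticePolygon

variable {n : ℕ} [NeZero n] {Δ : LatticePolygon n} {i₀ : ZMod n} {kL kR : ℤ} {rL rR : ℕ}
  (h : Δ.toCompleteFan.IsStrip i₀ kL rL kR rR)

include h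

theorem _root_.ToricRefined.CompleteFan.IsStrip.forall_iff {P : ZMod n → Prop} : (∀ i, P i) ↔
    (P i₀ ∧ P (i₀ + 1 + (rR + 1 : ℕ))) ∧ (∀ s ≤ rR, P (i₀ + 1 + s)) ∧
      ∀ s ≤ rL, P (i₀ - 1 - s) := by
  refine ⟨fun H => ⟨⟨H _, H _⟩, fun _ _ => H _, fun _ _ => H _⟩, fun ⟨⟨h1, h2⟩, h3, h4⟩ => ?_⟩
  classical
  have key := h.sum_eq fun i => if P i then 0 else 1
  have e1 : ∀ s ∈ range (rR + 1), (if P (i₀ + 1 + s) then 0 else 1) = 0 := fun s hs =>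
    if_pos (h3 s (by simpa [Nat.lt_succ_iff] using hs))
  have e2 : ∀ s ∈ range (rL + 1), (if P (i₀ - 1 - s) then 0 else 1) = 0 := fun s hs =>
    if_pos (h4 s (by simpa [Nat.lt_succ_iff] using hs))
  rw [if_pos h1, if_pos h2, sum_eq_zero e1, sum_eq_zero e2] at key
  intro i
  simpa using sum_eq_zero_iff.mp key i (mem_univ i)

theorem height_pos : 0 < Δ.height := by
  rw [height_eq_right h]
  exact sum_pos (fun s _ => Δ.length_pos _) ⟨0, by simp⟩

theorem tailSum_left_le (t : ℕ) : tailSum rL (Δ.leftLength i₀) t ≤ Δ.height := by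
  rw [height_eq_left h, ← tailSum_zero]; exact tailSum_antitone _ _ (Nat.zero_le t)

theorem tailSum_right_le (t : ℕ) : tailSum rR (Δ.rightLength i₀) t ≤ Δ.height := by
  rw [height_eq_right h, ← tailSum_zero]; exact tailSum_antitone _ _ (Nat.zero_le t)

/-- On each side the boundary is one piecewise linear graph over the ordinate, with a kink of size
one at every vertex between two consecutive sides. -/
theorem mem_region_iff (x y : ℝ) : (x, y) ∈ Δ.region ↔
    y ∈ Set.Icc ((Δ.corner i₀).2 : ℝ) ((Δ.corner i₀).2 + Δ.height) ∧
    x ∈ Set.Icc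
      ((Δ.corner i₀).1 + kL * (y - (Δ.corner i₀).2) + ∑ t ∈ range rL, max (y -
        ((Δ.corner i₀).2 + Δ.height - tailSum rL (Δ.leftLength i₀) (t + 1))) 0)
      ((Δ.corner i₀).1 + Δ.bottomLength - kR * (y - (Δ.corner i₀).2) - ∑ t ∈ range rR, max (y -
        ((Δ.corner i₀).2 + Δ.height - tailSum rR (Δ.rightLength i₀) (t + 1))) 0) := by
  have anti : ∀ (r : ℕ) (ℓ : ℕ → ℕ), Antitone fun t =>
      y - (((Δ.corner i₀).2 : ℝ) + Δ.height - tailSum r ℓ (t + 1)) := fun r ℓ t t' htt' => by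
    have := tailSum_antitone r ℓ (Nat.succ_le_succ htt')
    have : (tailSum r ℓ (t' + 1) : ℝ) ≤ tailSum r ℓ (t + 1) := by exact_mod_cast this
    simp only
    linarith
  rw [mem_region, h.forall_iff, h.bottom, h.top, support_bottom h, support_top h]
  simp only [Set.mem_Icc]
  refine and_congr ?_ ?_
  · push_cast
    constructor <;> rintro ⟨h1, h2⟩ <;> constructor <;> linarith
  · rw [and_comm]
    refine and_congr ?_ ?_
    · rw [← le_sub_iff_add_le', ← forall_sum_range_le_iff rL (anti _ _)]
      refine forall₂_congr fun s hs => ?_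
      rw [h.left s hs, support_left h s hs]
      push_cast
      simp only [sum_sub_distrib, sum_add_distrib, sum_const, card_range, nsmul_eq_mul]
      constructor <;> intro <;> linarith
    · rw [le_sub_comm, ← forall_sum_range_le_iff rR (anti _ _)]
      refine forall₂_congr fun s hs => ?_
      rw [h.right s hs, support_right h s hs]
      push_cast
      simp only [sum_sub_distrib, sum_add_distrib, sum_const, card_range, nsmul_eq_mul]
      constructor <;> intro <;> linarith

/-- The area is the integral of the horizontal width. A kink at distance m below the top reduces it
by m² / 2. -/
theorem twiceArea_eq : Δ.twiceArea =
    2 * (Δ.height * Δ.bottomLength) - (kL + kR) * Δ.height ^ 2 -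
      ∑ t ∈ range rL, (tailSum rL (Δ.leftLength i₀) (t + 1) : ℤ) ^ 2 -
      ∑ t ∈ range rR, (tailSum rR (Δ.rightLength i₀) (t + 1) : ℤ) ^ 2 := by
  have hpos : (0 : ℝ) < Δ.height := by exact_mod_cast height_pos h
  have hL : ∀ t, (tailSum rL (Δ.leftLength i₀) t : ℝ) ≤ Δ.height := fun t => by
    exact_mod_cast tailSum_left_le h t
  have hR : ∀ t, (tailSum rR (Δ.rightLength i₀) t : ℝ) ≤ Δ.height := fun t => by
    exact_mod_cast tailSum_right_le h t
  have hbal : (Δ.height : ℝ) * kL + ∑ t ∈ range rL, (tailSum rL (Δ.leftLength i₀) (t + 1) : ℝ) +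
      (Δ.height * kR + ∑ t ∈ range rR, (tailSum rR (Δ.rightLength i₀) (t + 1) : ℝ)) =
        (Δ.bottomLength : ℝ) - Δ.topLength := by exact_mod_cast balance h
  have hb : (0 : ℝ) ≤ Δ.bottomLength := Nat.cast_nonneg _
  have ht : (0 : ℝ) ≤ Δ.topLength := Nat.cast_nonneg _
  have hmem := mem_region_iff h
  rw [twiceArea, area]
  generalize ((Δ.corner i₀).2 : ℝ) = y₀ at hmem
  generalize ((Δ.corner i₀).1 : ℝ) = x₀ at hmem
  rw [volume_between_graphs (le_add_of_nonneg_right hpos.le) ?_ ?_ ?_ hmem]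
  · have e : ∀ y : ℝ, (x₀ + Δ.bottomLength - kR * (y - y₀) - ∑ t ∈ range rR, max (y -
          (y₀ + Δ.height - tailSum rR (Δ.rightLength i₀) (t + 1))) 0) -
        (x₀ + kL * (y - y₀) + ∑ t ∈ range rL, max (y -
          (y₀ + Δ.height - tailSum rL (Δ.leftLength i₀) (t + 1))) 0) =
        (Δ.bottomLength - (kL + kR) * (y - y₀)) -
        (∑ t ∈ range rL, max (y - (y₀ + Δ.height - tailSum rL (Δ.leftLength i₀) (t + 1))) 0 +
          ∑ t ∈ range rR, max (y - (y₀ + Δ.height - tailSum rR (Δ.rightLength i₀) (t + 1))) 0) :=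
      fun y => by ring
    have c : ∀ (r : ℕ) (m : ℕ → ℝ), Continuous fun y : ℝ =>
      ∑ t ∈ range r, max (y - (y₀ + Δ.height - m (t + 1))) 0 := fun r m => by fun_prop
    have i : ∀ (r : ℕ) (m : ℕ → ℝ), (∀ t, m t ≤ Δ.height) → (∀ t, 0 ≤ m t) →
        ∫ y in y₀..y₀ + Δ.height, ∑ t ∈ range r, max (y - (y₀ + Δ.height - m (t + 1))) 0 =
          (∑ t ∈ range r, m (t + 1) ^ 2) / 2 := fun r m hm hm0 => by
      rw [intervalIntegral.integral_finsetSum fun t _ =>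
        (by fun_prop : Continuous fun y : ℝ => max (y - (y₀ + Δ.height - m (t + 1))) 0
          ).intervalIntegrable _ _, sum_div]
      refine sum_congr rfl fun t _ => ?_
      rw [integral_max_sub_zero (by linarith [hm (t + 1)]) (by linarith [hm0 (t + 1)])]
      ring
    have i₁ : ∫ y in y₀..y₀ + Δ.height, ((Δ.bottomLength : ℝ) - (kL + kR) * (y - y₀)) =
        Δ.height * Δ.bottomLength - (kL + kR) * Δ.height ^ 2 / 2 := by
      rw [intervalIntegral.integral_sub (by simp) (Continuous.intervalIntegrable (by fun_prop) _ _),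
        intervalIntegral.integral_const_mul,
        intervalIntegral.integral_sub (by simp) (by simp), integral_id]
      simp
      ring
    simp only [e]
    rw [intervalIntegral.integral_sub (Continuous.intervalIntegrable (by fun_prop) _ _)
      (Continuous.intervalIntegrable (by fun_prop) _ _), i₁,
      intervalIntegral.integral_add ((c rL fun t => tailSum rL (Δ.leftLength i₀) t).intervalIntegrable _ _)
        ((c rR fun t => tailSum rR (Δ.rightLength i₀) t).intervalIntegrable _ _),
      i rL (fun t => tailSum rL (Δ.leftLength i₀) t) hL fun t => Nat.cast_nonneg _,
      i rR (fun t => tailSum rR (Δ.rightLength i₀) t) hR fun t => Nat.cast_nonneg _]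
    refine Eq.trans (congrArg round ?_) (round_intCast (α := ℝ) _)
    push_cast
    ring
  · fun_prop
  · fun_prop
  · intro y hy
    rw [Set.mem_Icc] at hy
    -- Each kink function lies below its chord. Together with `balance` this bounds the width from
    -- below by the interpolation between the bottom and the top length, which is non-negative.
    have b : ∀ (r : ℕ) (m : ℕ → ℝ), (∀ t, m t ≤ Δ.height) → (∀ t, 0 ≤ m t) →
        Δ.height * ∑ t ∈ range r, max (y - (y₀ + Δ.height - m (t + 1))) 0 ≤
          (y - y₀) * ∑ t ∈ range r, m (t + 1) := fun r m hm hm0 => by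
      rw [mul_sum, mul_sum]
      refine sum_le_sum fun t _ => ?_
      rw [mul_max_of_nonneg _ _ hpos.le, max_le_iff, mul_zero]
      constructor
      · nlinarith [mul_nonneg (sub_nonneg.mpr hy.2) (sub_nonneg.mpr (hm (t + 1)))]
      · exact mul_nonneg (sub_nonneg.mpr hy.1) (hm0 _)
    have b₁ := b rL (fun t => tailSum rL (Δ.leftLength i₀) t) hL fun t => Nat.cast_nonneg _
    have b₂ := b rR (fun t => tailSum rR (Δ.rightLength i₀) t) hR fun t => Nat.cast_nonneg _
    rw [← sub_nonneg]
    refine nonneg_of_mul_nonneg_right ?_ hpos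
    have q₁ := mul_nonneg (sub_nonneg.mpr hy.2) hb
    have q₂ := mul_nonneg (sub_nonneg.mpr hy.1) ht
    have q₃ := congrArg ((y - y₀) * ·) hbal
    linarith

end LatticePolygon

end ToricRefined

/-! ### Conclusion: Pick's formula and the adjunction formula -/

namespace ToricRefined

open Finset
open scoped PowerSeries

namespace LatticePolygon

variable {n : ℕ} [NeZero n] (Δ : LatticePolygon n)

theorem exists_isStrip_of_isHTransverse (h₁ : Δ.IsHTransverse) (h₂ : Δ.IsHorizontal)
    (h₃ : Δ.toCompleteFan.IsSmooth) :
    ∃ i₀ kL rL kR rR, Δ.toCompleteFan.IsStrip i₀ kL rL kR rR := by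
  obtain ⟨⟨j, hj⟩, i₀, h₀⟩ := h₂
  refine ⟨i₀, CompleteFan.exists_isStrip (fun i => ?_) h₃ hj h₀⟩
  have := h₁ i
  simp only [direction, Prod.mk.injEq] at this
  rcases this with ⟨h, h'⟩ | ⟨h, h'⟩ | ⟨k, h, h'⟩ | ⟨k, h, h'⟩
  · exact Or.inr (Or.inl (Prod.ext h' (by omega)))
  · exact Or.inl (Prod.ext h' (by omega))
  · exact Or.inr (Or.inr (Or.inl ⟨-k, Prod.ext h' (by simp only; omega)⟩))
  · exact Or.inr (Or.inr (Or.inr ⟨-k, Prod.ext h' (by simp only; omega)⟩))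

variable {Δ} {i₀ : ZMod n} {kL kR : ℤ} {rL rR : ℕ} (h : Δ.toCompleteFan.IsStrip i₀ kL rL kR rR)

include h

theorem sum_length : ∑ i, (Δ.length i : ℤ) = Δ.bottomLength + Δ.topLength + 2 * Δ.height := by
  rw [h.sum_eq, bottomLength_eq h, topLength_eq h]
  have e1 := congrArg (Nat.cast : ℕ → ℤ) (height_eq_right h)
  have e2 := congrArg (Nat.cast : ℕ → ℤ) (height_eq_left h)
  push_cast [rightLength, leftLength] at e1 e2 ⊢
  linarith

/-- The invariant of a polygon with long sides, modulo the `N`-th power of the variable. The integer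
`I` is the number of interior lattice points. -/
theorem truncHom_reversedInvariant {N : ℕ} (hN : 1 ≤ N) (hlen : ∀ i, 4 * N + 1 ≤ Δ.length i)
    {I : ℤ} (hI : 2 * I = 2 + Δ.twiceArea - ∑ i, (Δ.length i : ℤ)) :
    truncHom N (reversedInvariant Δ 1) =
      truncHom N (partitionSeries ^ n * (PowerSeries.C I - 12 * eisensteinSeries)) := by
  have hheight : 4 * N + 1 ≤ Δ.height := by
    rw [height_eq_right h]
    exact (hlen _).trans (single_le_sum (f := Δ.rightLength i₀) (fun _ _ => Nat.zero_le _)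
      (mem_range.mpr (Nat.succ_pos rR)))
  have hgap : ∀ (r : ℕ) (ℓ : ℕ → ℕ), (∀ s, 4 * N + 1 ≤ ℓ s) → ∀ t ≤ r,
      tailSum r ℓ (t + 1) + 2 * N ≤ tailSum r ℓ t := fun r ℓ hℓ t ht => by
    have := tailSum_succ ℓ ht
    have := hℓ t
    omega
  have hgL := hgap rL (Δ.leftLength i₀) fun s => hlen _
  have hgR := hgap rR (Δ.rightLength i₀) fun s => hlen _
  have hL0 := tailSum_zero rL (Δ.leftLength i₀)
  have hR0 := tailSum_zero rR (Δ.rightLength i₀)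
  rw [← height_eq_left h] at hL0
  rw [← height_eq_right h] at hR0
  have hbal := balance h
  have hA := twiceArea_eq h
  have hS := sum_length h
  -- 2 W has to be twice the area minus the two horizontal lengths. The other sides have total
  -- length 2 height, so Pick's formula gives W - (height - 1) = I.
  have key := map_reversedInvariant_eq (truncHom N) (truncHom_X_pow N) hN
    (mem_arrangements_left h) (mem_arrangements_right h) hbal
    (W := I + (Δ.height - 1)) ?_ ?_ (by omega) (by rw [topLength_eq h]; exact hlen _)
    (by rw [bottomLength_eq h]; exact hlen _)
    (fun t _ ht => hgL t ht.le) (fun _ => hL0 ▸ hgL 0 (Nat.zero_le _))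
    (fun _ => le_of_add_le_right (hgL rL le_rfl)) (fun t _ ht => hgR t ht.le)
    (fun _ => hR0 ▸ hgR 0 (Nat.zero_le _)) (fun _ => le_of_add_le_right (hgR rR le_rfl))
  · rw [key, ← h.card, map_mul, map_pow, truncHom_partitionSeries (a := Δ.height) (by omega),
      map_sub, map_mul, map_ofNat, truncHom_eisensteinSeries (a := Δ.height) (by omega)]
    simp
  · simp only [mul_sub, mul_one, sum_sub_distrib, ← sq]
    linear_combination hI - hS + hA - hbal
  · linear_combination -hI + hS

end LatticePolygon

namespace ToricSurface

variable {n : ℕ} [NeZero n] (X : ToricSurface n)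

/-- The support numbers of Δ define a class whose intersection numbers are the side lengths of Δ. -/
theorem exists_isAmple {Δ : LatticePolygon n} (hX : Δ.toCompleteFan = X.toCompleteFan) :
    ∃ β, X.IsAmple β :=
  ⟨X.classOf Δ.support, fun i => by
    change 0 < X.divisorDot i Δ.support
    rw [Δ.divisorDot_support X hX]
    exact_mod_cast Δ.length_pos i⟩

theorem isAsymptoticRefinedInvariant_one {i₀ : ZMod n} {kL kR : ℤ} {rL rR : ℕ}
    (h : X.toCompleteFan.IsStrip i₀ kL rL kR rR) :
    X.IsAsymptoticRefinedInvariant 1 fun β => partitionSeries ^ X.eulerCharacteristic *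
      (PowerSeries.C (X.maxGenus β) - 12 * eisensteinSeries) := by
  -- Sides of length at least 4 N + 1 keep the flow above 4 N through every level and provide the
  -- gaps of 2 N between the threshold counts.
  refine ⟨X.isPolynomialMap_maxGenus _ _, fun N => ⟨4 * N + 1, fun β hβ hC => ?_⟩⟩
  rcases Nat.eq_zero_or_pos N with rfl | hN
  · simp
  · rw [← truncHom_eq_iff, eulerCharacteristic, ZMod.card]
    refine LatticePolygon.truncHom_reversedInvariant (Δ := X.polygon β hβ) h hN (fun i => ?_) ?_
    · have := hC i
      change _ ≤ (X.dotDivisor i β).toNat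
      omega
    -- The adjunction formula for g_max is compared with Pick's formula: the self-intersection is
    -- twice the area, and the canonical degree is minus the boundary length.
    · rw [two_mul_maxGenus, intersection_self_eq_sum_support X β hβ,
        intersection_canonicalClass X β hβ, LatticePolygon.sum_support_mul_length h,
        LatticePolygon.twiceArea_eq h]
      ring

end ToricSurface

end ToricRefined

theorem theorem5p4 (n : ℕ) [NeZero n] (Δ : ToricRefined.LatticePolygon n)
    (hTransverse : Δ.IsHTransverse) (hHorizontal : Δ.IsHorizontal)
    (hNonsingular : Δ.toCompleteFan.IsSmooth)
    (AR : (Δ.toricSurface hNonsingular).H2 → PowerSeries ℤ) :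
    (Δ.toricSurface hNonsingular).IsAsymptoticRefinedInvariant 1 AR ↔
      ∀ β : (Δ.toricSurface hNonsingular).H2,
        AR β = ToricRefined.partitionSeries ^ (Δ.toricSurface hNonsingular).eulerCharacteristic *
          (PowerSeries.C ((Δ.toricSurface hNonsingular).maxGenus β) -
            12 * ToricRefined.eisensteinSeries) := by
  obtain ⟨i₀, kL, rL, kR, rR, h⟩ :=
    Δ.exists_isStrip_of_isHTransverse hTransverse hHorizontal hNonsingular
  have hAR := (Δ.toricSurface hNonsingular).isAsymptoticRefinedInvariant_one h
  constructor
  · intro hF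
    obtain ⟨β₀, hβ₀⟩ := (Δ.toricSurface hNonsingular).exists_isAmple (Δ := Δ) rfl
    exact congrFun (hF.unique hβ₀ hAR)
  · intro hF
    rw [show AR = _ from funext hF]
    exact hAR
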